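/- **Setting.** A shared variable with values in a finite set $V$, $|V|\ge 2$, is emulated by $N$ servers for arbitrarily many clients over an asynchronous network with reliable channels; nodes fail by crashing. Let $f,\nu$ be integers with $2f<N$, $\nu\ge 2$, and put $k=\lceil (N-2f)/\nu\rceil$. The *storage cost* at a point of an execution is the total size of the elements stored by the $N$ servers, tags and other metadata being neglected; an element of a set with $q$ elements has size $\log_2 q$, and the unit is $\log_2|V|$. *Condition 1* for an execution: at every point fewer than $\nu$ writes are in progress (invoked and not terminated). **Algorithm 2-A.** Let $\Phi:V\to W^N$ be an $(N,k)$ MDS code: $|V|=|W|^k$, and any $k$ of the $N$ symbols determine the value. Tags are pairs $(z,\mathrm{id})$ in lexicographic order. Server $s$ stores one pair $(t,y)$, initially $(0,\Phi(v_0)_s)$ for a default value $v_0$; on $put(t',y')$ it replaces the pair by $(t',y')$ if $t'>t$, and it acknowledges in any case. A *write* of $v$ at client $\mathrm{id}$ has two phases: it queries all servers for their tags and awaits a quorum ($\ge N-f$ answers); with $z$ the integer component of the largest tag received, it sends $put((z+1,\mathrm{id}),\Phi(v)_s)$ to every server $s$ and terminates after acknowledgements from a quorum. A *read* queries all servers for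 their pairs and awaits a quorum. Among the tags received with at least $k$ symbols that were received from at least $f+1$ servers or for which at most $\nu$ strictly higher tags were received, it takes the largest one, decodes its value $v$, writes it back with $put$ messages to all servers, awaits a quorum and returns $v$; if there is no such tag, it aborts (never returns). **Theorem.** 1. At every point of every execution of Algorithm 2-A that satisfies Condition 1, the storage cost is exactly $\dfrac{N}{\lceil (N-2f)/\nu\rceil}$. 2. For $N\gg f$ and $\nu\le f+1$ this cost asymptotically matches the lower bound $\frac{\nu N}{N-f+\nu-1}$ of Cadambe, Wang and Lynch: for every $\varepsilon>0$ there is $R$ such that for all $N,f,\nu$ with $2f<N$, $2\le\nu\le f+1$ and $N\ge Rf$, $$\frac{\nu N}{N-f+\nu-1}\;\le\;\frac{N}{\lceil (N-2f)/\nu\rceil}\;\le\;(1+\varepsilon)\,\frac{\nu N}{N-f+\nu-1}.$$ 3. For $N\gg f$ and $\nu\le f+1$ it is asymptotically optimal: for every $\varepsilon>0$ there is $R$ such that for all $N,f,\nu$ with $2f<N$, $2\le\nu\le f+1$ and $N\ge Rf$ there is $B$ such that for all $V$ with $|V|\ge B$, every protocol of the class below has an execution that satisfies Condition 1, with at most $f$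 server crashes, and in it a point where the storage cost is at least $(1-\varepsilon)\,\dfrac{N}{\lceil (N-2f)/\nu\rceil}$. *The class in 3.* Protocols on $N$ servers in which operations proceed in phases; in a phase a client sends a request to each server of a target set and, depending on the answers, goes on or terminates; a server changes its state and answers on receipt of a request only. A server state consists of metadata and of data from a finite alphabet that may depend on the metadata. A write sends information about its value in at most one phase, and all metadata in the course of writes (the rest of the requests, the answers to writers, their effect on server metadata) does not depend on the values; reads are arbitrary. In executions that satisfy Condition 1 and have at most $f$ server crashes, the protocol is atomic (linearizable), and it is $\nu$-concurrency wait-free: in fair executions, every write at a non-failing client terminates, and so does every read at a non-failing client that is concurrent with fewer than $\nu$ writes. -/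

import Mathlib

namespace SharedMemory

/-! ### Client-server protocols that emulate a shared variable -/

/-- Position of a phase of a write operation relative to the phase that sends the value. -/
inductive Stage where
  | before : Stage
  | value : Stage
  | after : Stage

/-- A protocol for `N` servers and clients `0, 1, 2, …` that emulates a shared variable with values
in `V`. A server state consists of metadata and of data from a finite alphabet, which may depend on
the metadata. Operations proceed in phases: in a phase a client sends one request to each
server of a target set, collects the answers, and, depending on them, goes on to its next phase or
terminates.

The metadata part of a write is value independent: only the payload, sent in at most one
phase of the write (`single`), depends on the value. Reads are arbitrary. -/
structure Protocol (N : ℕ) (V : Type) where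
  /-- server metadata -/
  Meta : Type
  /-- alphabet of the stored data -/
  Data : Meta → Type
  dataFintype : ∀ μ, Fintype (Data μ)
  /-- initial server states -/
  initServer : Fin N → (μ : Meta) × Data μ
  /-- the default value -/
  default : V
  Payload : Type
  WriteRequest : Type
  WriteReply : Type
  ReadRequest : Type
  ReadReply : Type
  /-- what a client remembers between its writes -/
  Local : Type
  initLocal : ℕ → Local
  /-- state of a write operation, apart from the value -/
  WriteState : Type
  beginWrite : ℕ → Local → WriteState
  stage : WriteState → Stage
  writeTargets : WriteState → Finset (Fin N)
  writeRequest : WriteState → Fin N → WriteRequest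
  /-- the value-dependent part of a request, sent only in the stage `value` -/
  payload : WriteState → Fin N → V → Payload
  /-- `none`: await further answers; otherwise the next phase or termination -/
  writeAdvance : WriteState → (Fin N → Option WriteReply) → Option (WriteState ⊕ Local)
  /-- the value is sent in at most one phase -/
  single : ∀ w r w', writeAdvance w r = some (Sum.inl w') → stage w ≠ Stage.before →
    stage w' = Stage.after
  /-- effect of a write request on a server -/
  writeMeta : Fin N → Meta → WriteRequest → Meta
  writeData : (s : Fin N) → (μ : Meta) → (q : WriteRequest) → Option Payload → Data μ →
    Data (writeMeta s μ q)
  writeReply : Fin N → Meta → WriteRequest → WriteReply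
  /-- state of a read operation -/
  ReadState : Type
  beginRead : ℕ → ReadState
  readTargets : ReadState → Finset (Fin N)
  readRequest : ReadState → Fin N → ReadRequest
  /-- `none`: await further answers; otherwise the next phase or the returned value -/
  readAdvance : ReadState → (Fin N → Option ReadReply) → Option (ReadState ⊕ V)
  /-- effect of a read request on a server, and the answer -/
  handleRead : Fin N → ReadRequest → ((μ : Meta) × Data μ) →
    ((μ : Meta) × Data μ) × ReadReply

namespace Protocol

variable {N : ℕ} {V : Type}

/-- A server state: metadata and data. -/
abbrev ServerState (P : Protocol N V) : Type := (μ : P.Meta) × P.Data μ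

/-- Messages from clients to servers. -/
abbrev Request (P : Protocol N V) : Type := (P.WriteRequest × Option P.Payload) ⊕ P.ReadRequest

/-- Messages from servers to clients. -/
abbrev Reply (P : Protocol N V) : Type := P.WriteReply ⊕ P.ReadReply

/-- What a client is doing, with the answers collected in the present phase. -/
inductive Activity (P : Protocol N V) : Type where
  | idle : Activity P
  | writing (v : V) (w : P.WriteState) (replies : Fin N → Option P.WriteReply) : Activity P
  | reading (r : P.ReadState) (replies : Fin N → Option P.ReadReply) : Activity P

variable {P : Protocol N V}

/-- The client has an ongoing write operation. -/
def Activity.IsWrite : P.Activity → Prop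
  | .writing _ _ _ => True
  | _ => False

/-- The servers to which a request is sent in the present phase. -/
def Activity.targets : P.Activity → Finset (Fin N)
  | .idle => ∅
  | .writing _ w _ => P.writeTargets w
  | .reading r _ => P.readTargets r

/-- The request sent to server `s` in the present phase. -/
def Activity.request (s : Fin N) : P.Activity → Option P.Request
  | .idle => none
  | .writing v w _ => some (.inl (P.writeRequest w s,
      match P.stage w with
      | .value => some (P.payload w s v)
      | _ => none))
  | .reading r _ => some (.inr (P.readRequest r s))

/-- Recording the answer of server `s`. -/
def Activity.record (s : Fin N) : P.Activity → P.Reply → P.Activity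
  | .writing v w replies, .inl a => .writing v w (Function.update replies s (some a))
  | .reading r replies, .inr a => .reading r (Function.update replies s (some a))
  | x, _ => x

/-- Effect of a request on a server, and the answer. -/
def handle (P : Protocol N V) (s : Fin N) : P.Request → P.ServerState → P.ServerState × P.Reply
  | .inl (q, p), ⟨μ, d⟩ => (⟨P.writeMeta s μ q, P.writeData s μ q p d⟩, .inl (P.writeReply s μ q))
  | .inr q, x => ((P.handleRead s q x).1, .inr (P.handleRead s q x).2)

/-- A client: its activity, the number of its present phase (counted over all its operations), the
servers to which the request of that phase remains to be sent, and its local memory. -/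
structure ClientState (P : Protocol N V) : Type where
  activity : P.Activity
  number : ℕ
  unsent : Finset (Fin N)
  memory : P.Local

/-- Entering a new phase. -/
def ClientState.start (γ : P.ClientState) (x : P.Activity) : P.ClientState :=
  ⟨x, γ.number + 1, x.targets, γ.memory⟩

/-- A global state. `requests c s n` and `replies c s n` hold the message in transit between client
`c` and server `s` (in the respective direction) that belongs to the phase of `c` with number
`n`; there is never more than one. -/
structure State (P : Protocol N V) : Type where
  server : Fin N → P.ServerState
  client : ℕ → P.ClientState
  requests : ℕ → Fin N → ℕ → Option P.Request
  replies : ℕ → Fin N → ℕ → Option P.Reply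
  crashedServers : Set (Fin N)
  crashedClients : Set ℕ

/-- Changing the state of one client. -/
def State.setClient (σ : P.State) (c : ℕ) (γ : P.ClientState) : P.State :=
  { σ with client := Function.update σ.client c γ }

/-- Changing one entry of a table of messages in transit. -/
def setMessage {M : Type} (m : ℕ → Fin N → ℕ → Option M) (c : ℕ) (s : Fin N) (n : ℕ)
    (x : Option M) : ℕ → Fin N → ℕ → Option M :=
  fun c' s' n' => if c' = c ∧ s' = s ∧ n' = n then x else m c' s' n'

/-- The initial state. -/
def initialState (P : Protocol N V) : P.State where
  server := P.initServer
  client c := ⟨.idle, 0, ∅, P.initLocal c⟩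
  requests _ _ _ := none
  replies _ _ _ := none
  crashedServers := ∅
  crashedClients := ∅

end Protocol

/-- Actions: invocations and responses of operations, internal actions, crashes. -/
inductive Action (N : ℕ) (V : Type) : Type where
  | invokeWrite (c : ℕ) (v : V) : Action N V
  | invokeRead (c : ℕ) : Action N V
  | returnWrite (c : ℕ) : Action N V
  | returnRead (c : ℕ) (v : V) : Action N V
  | send (c : ℕ) (s : Fin N) : Action N V
  | serverReceive (c : ℕ) (s : Fin N) (n : ℕ) : Action N V
  | clientReceive (c : ℕ) (s : Fin N) (n : ℕ) : Action N V
  | nextPhase (c : ℕ) : Action N V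
  | crashServer (s : Fin N) : Action N V
  | crashClient (c : ℕ) : Action N V
  | stutter : Action N V

/-- The actions controlled by the clients and servers, as opposed to those of the environment. -/
def Action.IsControlled {N : ℕ} {V : Type} : Action N V → Prop
  | .invokeWrite _ _ => False
  | .invokeRead _ => False
  | .crashServer _ => False
  | .crashClient _ => False
  | .stutter => False
  | _ => True

namespace Protocol

variable {N : ℕ} {V : Type}

/-- The steps of the asynchronous system. -/
inductive Step (P : Protocol N V) : Action N V → P.State → P.State → Prop where
  | invokeWrite (σ : P.State) (c : ℕ) (v : V) (hc : c ∉ σ.crashedClients)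
      (hx : (σ.client c).activity = .idle) :
      Step P (.invokeWrite c v) σ (σ.setClient c ((σ.client c).start
        (.writing v (P.beginWrite c (σ.client c).memory) fun _ => none)))
  | invokeRead (σ : P.State) (c : ℕ) (hc : c ∉ σ.crashedClients)
      (hx : (σ.client c).activity = .idle) :
      Step P (.invokeRead c) σ (σ.setClient c ((σ.client c).start
        (.reading (P.beginRead c) fun _ => none)))
  /-- a client sends the request of its present phase to one more server -/
  | send (σ : P.State) (c : ℕ) (s : Fin N) (q : P.Request) (hc : c ∉ σ.crashedClients)
      (hs : s ∈ (σ.client c).unsent) (hq : (σ.client c).activity.request s = some q) :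
      Step P (.send c s) σ
        { σ.setClient c { σ.client c with unsent := (σ.client c).unsent.erase s } with
          requests := setMessage σ.requests c s (σ.client c).number (some q) }
  /-- a server receives a request and answers it -/
  | serverReceive (σ : P.State) (c : ℕ) (s : Fin N) (n : ℕ) (q : P.Request)
      (hs : s ∉ σ.crashedServers) (hq : σ.requests c s n = some q) :
      Step P (.serverReceive c s n) σ
        { σ with
          server := Function.update σ.server s (P.handle s q (σ.server s)).1
          requests := setMessage σ.requests c s n none
          replies := setMessage σ.replies c s n (some (P.handle s q (σ.server s)).2) }
  /-- a client receives an answer; answers that belong to earlier phases are ignored -/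
  | clientReceive (σ : P.State) (c : ℕ) (s : Fin N) (n : ℕ) (a : P.Reply)
      (hc : c ∉ σ.crashedClients) (ha : σ.replies c s n = some a) :
      Step P (.clientReceive c s n) σ
        { σ.setClient c
            { σ.client c with
              activity := if n = (σ.client c).number then (σ.client c).activity.record s a
                else (σ.client c).activity } with
          replies := setMessage σ.replies c s n none }
  /-- a writer goes on to its next phase -/
  | nextWrite (σ : P.State) (c : ℕ) (v : V) (w w' : P.WriteState)
      (replies : Fin N → Option P.WriteReply) (hc : c ∉ σ.crashedClients)
      (hx : (σ.client c).activity = .writing v w replies) (hu : (σ.client c).unsent = ∅)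
      (hw : P.writeAdvance w replies = some (.inl w')) :
      Step P (.nextPhase c) σ
        (σ.setClient c ((σ.client c).start (.writing v w' fun _ => none)))
  /-- a write terminates -/
  | returnWrite (σ : P.State) (c : ℕ) (v : V) (w : P.WriteState) (l : P.Local)
      (replies : Fin N → Option P.WriteReply) (hc : c ∉ σ.crashedClients)
      (hx : (σ.client c).activity = .writing v w replies) (hu : (σ.client c).unsent = ∅)
      (hw : P.writeAdvance w replies = some (.inr l)) :
      Step P (.returnWrite c) σ
        (σ.setClient c { σ.client c with activity := .idle, memory := l })
  /-- a reader goes on to its next phase -/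
  | nextRead (σ : P.State) (c : ℕ) (r r' : P.ReadState)
      (replies : Fin N → Option P.ReadReply) (hc : c ∉ σ.crashedClients)
      (hx : (σ.client c).activity = .reading r replies) (hu : (σ.client c).unsent = ∅)
      (hr : P.readAdvance r replies = some (.inl r')) :
      Step P (.nextPhase c) σ
        (σ.setClient c ((σ.client c).start (.reading r' fun _ => none)))
  /-- a read terminates and returns a value -/
  | returnRead (σ : P.State) (c : ℕ) (v : V) (r : P.ReadState)
      (replies : Fin N → Option P.ReadReply) (hc : c ∉ σ.crashedClients)
      (hx : (σ.client c).activity = .reading r replies) (hu : (σ.client c).unsent = ∅)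
      (hr : P.readAdvance r replies = some (.inr v)) :
      Step P (.returnRead c v) σ (σ.setClient c { σ.client c with activity := .idle })
  | crashServer (σ : P.State) (s : Fin N) :
      Step P (.crashServer s) σ { σ with crashedServers := insert s σ.crashedServers }
  | crashClient (σ : P.State) (c : ℕ) :
      Step P (.crashClient c) σ { σ with crashedClients := insert c σ.crashedClients }
  /-- nothing happens; thus a finite execution is an infinite one that stutters in the end -/
  | stutter (σ : P.State) : Step P .stutter σ σ

/-- An execution: its points `state 0, state 1, …`, where `action n` leads from `state n` to
`state (n + 1)`. -/
structure Execution (P : Protocol N V) : Type where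
  state : ℕ → P.State
  action : ℕ → Action N V
  init : state 0 = P.initialState
  step : ∀ n, P.Step (action n) (state n) (state (n + 1))

variable {P : Protocol N V}

/-- At every point of the execution, fewer than `ν` writes are in progress (invoked and not
terminated; the last write of a crashed client stays in progress). -/
def Execution.BoundedConcurrency (ν : ℕ) (e : P.Execution) : Prop :=
  ∀ n, {c : ℕ | ((e.state n).client c).activity.IsWrite}.encard < ν

/-- At most `f` servers crash in the execution. -/
def Execution.BoundedFailures (f : ℕ) (e : P.Execution) : Prop :=
  ∀ n, (e.state n).crashedServers.encard ≤ f

/-- A controlled action is not forever enabled without being performed. -/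
def Execution.IsFair (e : P.Execution) : Prop :=
  ∀ a : Action N V, a.IsControlled →
    ∀ n, ∃ m, n ≤ m ∧ (e.action m = a ∨ ¬ ∃ σ, P.Step a (e.state m) σ)

/-- Operations are named by the times of their invocations: a write of `v` is invoked at time
`i`. -/
def Execution.WriteAt (e : P.Execution) (i : ℕ) (v : V) : Prop :=
  ∃ c, e.action i = .invokeWrite c v

/-- The operation invoked at client `c` at time `i`, if any. -/
def Execution.InvokedBy (e : P.Execution) (i c : ℕ) : Prop :=
  e.action i = .invokeRead c ∨ ∃ v, e.action i = .invokeWrite c v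

/-- A response occurs at client `c` at time `j`. -/
def Execution.ResponseAt (e : P.Execution) (j c : ℕ) : Prop :=
  e.action j = .returnWrite c ∨ ∃ v, e.action j = .returnRead c v

/-- The operation invoked at time `i` terminates at time `j`. -/
def Execution.Terminates (e : P.Execution) (i j : ℕ) : Prop :=
  ∃ c, e.InvokedBy i c ∧ i < j ∧ e.ResponseAt j c ∧ ∀ l, i < l → l < j → ¬ e.ResponseAt l c

/-- The read invoked at time `i` terminates and returns `v`. -/
def Execution.ReadReturns (e : P.Execution) (i : ℕ) (v : V) : Prop :=
  ∃ c j, e.action i = .invokeRead c ∧ e.Terminates i j ∧ e.action j = .returnRead c v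

/-- Neither of the operations invoked at the times `i` and `j` terminates before the other one is
invoked. -/
def Execution.Concurrent (e : P.Execution) (i j : ℕ) : Prop :=
  (¬ ∃ l, l < j ∧ e.Terminates i l) ∧ ¬ ∃ l, l < i ∧ e.Terminates j l

/-- Atomicity (linearizability): to all operations that terminate, and to some of the others, one can
assign distinct serialization points between invocation and response, such that every read that
terminates returns the value of the last write before it, or the default value if there is none. -/
def Execution.IsAtomic (e : P.Execution) : Prop :=
  ∃ (L : Set ℕ) (point : ℕ → ℝ), Set.InjOn point L ∧
    (∀ i ∈ L, ∃ c, e.InvokedBy i c) ∧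
    (∀ i ∈ L, (i : ℝ) < point i) ∧
    (∀ i j, e.Terminates i j → i ∈ L ∧ point i < j) ∧
    ∀ i v, e.ReadReturns i v →
      (∃ w ∈ L, e.WriteAt w v ∧ point w < point i ∧
        ∀ w' ∈ L, ∀ v', e.WriteAt w' v' → point w' < point i → point w' ≤ point w) ∨
      (v = P.default ∧ ∀ w ∈ L, ∀ v', e.WriteAt w v' → ¬ point w < point i)

/-- The protocol emulates an atomic variable, provided that always fewer than `ν` writes are in
progress and at most `f` servers crash. -/
def EmulatesAtomic (P : Protocol N V) (f ν : ℕ) : Prop :=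
  ∀ e : P.Execution, e.BoundedConcurrency ν → e.BoundedFailures f → e.IsAtomic

/-- `ν`-concurrency wait-freedom, again under the condition that always fewer than `ν` writes are in
progress: in fair executions with at most `f` server crashes, every write at a client that
does not crash terminates, and so does every read at such a client that is concurrent with fewer
than `ν` writes. -/
def ConcurrencyWaitFree (P : Protocol N V) (f ν : ℕ) : Prop :=
  ∀ e : P.Execution, e.BoundedConcurrency ν → e.BoundedFailures f → e.IsFair →
    ∀ i c, (∀ n, c ∉ (e.state n).crashedClients) →
      (∀ v, e.action i = .invokeWrite c v → ∃ j, e.Terminates i j) ∧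
      (e.action i = .invokeRead c →
        {w : ℕ | (∃ v, e.WriteAt w v) ∧ e.Concurrent w i}.encard < ν → ∃ j, e.Terminates i j)

/-- The storage cost at a point: the total size of the data stored by all `N` servers, in units of
`log₂ |V|` bits; an element of a set with `q` elements has size `log₂ q`, metadata is neglected. -/
noncomputable def State.storageCost [Fintype V] (σ : P.State) : ℝ :=
  (∑ s, Real.logb 2 (@Fintype.card (P.Data (σ.server s).1) (P.dataFintype _))) /
    Real.logb 2 (Fintype.card V)

end Protocol

/-! ### Algorithm 2-A -/

/-- The coding parameter `k = ⌈(N - 2 f) / ν⌉`. -/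
noncomputable def codingParameter (N f ν : ℕ) : ℕ := ⌈((N : ℝ) - 2 * f) / ν⌉₊

/-- An `(N, k)` maximum distance separable code: a value of `V` is encoded into `N` symbols of `W`,
a symbol has `1 / k` of the size of a value (`|V| = |W| ^ k`, that is
`log₂ |W| = (1 / k) log₂ |V|`), and any `k` symbols determine the value. -/
structure MDSCode (N k : ℕ) (V W : Type) [Fintype V] [Fintype W] where
  encode : V → Fin N → W
  card_eq : Fintype.card V = Fintype.card W ^ k
  decodable : ∀ S : Finset (Fin N), S.card = k →
    ∀ v v' : V, (∀ s ∈ S, encode v s = encode v' s) → v = v'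

namespace TwoA

/-- Tags `(z, id)` in lexicographic order, where `id` is the identifier of a client; the identifier
`⊥` occurs only in the tag of the default value. -/
abbrev Tag := ℕ ×ₗ WithBot ℕ

/-- The tag `0` of the default value. -/
def initialTag : Tag := toLex (0, ⊥)

inductive WriteRequest : Type where
  | getTag : WriteRequest
  | put (t : Tag) : WriteRequest

inductive WriteReply : Type where
  | tag (t : Tag) : WriteReply
  | ack : WriteReply

inductive ReadRequest (W : Type) : Type where
  | get : ReadRequest W
  | put (t : Tag) (y : W) : ReadRequest W

inductive ReadReply (W : Type) : Type where
  | pair (t : Tag) (y : W) : ReadReply W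
  | ack : ReadReply W

/-- The two phases of a write at client `id`: query, and propagation of the coded symbols. -/
inductive WriteState : Type where
  | query (id : ℕ) : WriteState
  | put (t : Tag) : WriteState

/-- The two phases of a read, and the state of an aborted read, which never returns. -/
inductive ReadState (V : Type) : Type where
  | get : ReadState V
  | writeBack (t : Tag) (v : V) : ReadState V
  | aborted : ReadState V

/-- A quorum, that is a set of at least `N - f` servers, has answered. -/
def Quorum {N : ℕ} {α : Type} (f : ℕ) (replies : Fin N → Option α) : Prop :=
  N ≤ (Finset.univ.filter fun s => (replies s).isSome).card + f

/-- The tag in an answer to a query. -/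
def WriteReply.getTag : Option WriteReply → Tag
  | some (.tag t) => t
  | _ => initialTag

/-- The largest tag among the answers to a query. -/
noncomputable def largestTag {N : ℕ} (replies : Fin N → Option WriteReply) : Tag :=
  Finset.univ.fold max initialTag fun s => WriteReply.getTag (replies s)

/-- Server `s` has answered with the tag `t`. -/
def Holds {N : ℕ} {W : Type} (replies : Fin N → Option (ReadReply W)) (t : Tag) (s : Fin N) :
    Prop :=
  ∃ y, replies s = some (.pair t y)

/-- The tag `t` occurs among the answers, it is decodable (at least `k` coded symbols), and it comes
with at least `f + 1` coded symbols or the number of strictly higher tags is at most `ν`. -/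
def Returnable {N : ℕ} {W : Type} (k f ν : ℕ) (replies : Fin N → Option (ReadReply W))
    (t : Tag) : Prop :=
  (∃ s, Holds replies t s) ∧ k ≤ {s | Holds replies t s}.ncard ∧
    (f + 1 ≤ {s | Holds replies t s}.ncard ∨
      {u : Tag | t < u ∧ ∃ s, Holds replies u s}.ncard ≤ ν)

/-- `t` is the largest returnable tag and `v` is its decoded value. -/
def Selected {N : ℕ} {V W : Type} (k f ν : ℕ) (Φ : V → Fin N → W)
    (replies : Fin N → Option (ReadReply W)) (p : Tag × V) : Prop :=
  Returnable k f ν replies p.1 ∧ (∀ u, Returnable k f ν replies u → u ≤ p.1) ∧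
    ∀ s y, replies s = some (.pair p.1 y) → Φ p.2 s = y

open Classical in
/-- Two-phase writes; the reads and servers use one coded symbol per server. -/
noncomputable def protocol (N f ν : ℕ) {V W : Type} [Fintype V] [Fintype W]
    (C : MDSCode N (codingParameter N f ν) V W) (v₀ : V) : Protocol N V where
  Meta := Tag
  Data _ := W
  dataFintype _ := inferInstance
  initServer s := ⟨initialTag, C.encode v₀ s⟩
  default := v₀
  Payload := W
  WriteRequest := WriteRequest
  WriteReply := WriteReply
  ReadRequest := ReadRequest W
  ReadReply := ReadReply W
  Local := Unit
  initLocal _ := ()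
  WriteState := WriteState
  beginWrite c _ := .query c
  stage w := match w with
    | .query _ => .before
    | .put _ => .value
  writeTargets _ := Finset.univ
  writeRequest w _ := match w with
    | .query _ => .getTag
    | .put t => .put t
  payload _ s v := C.encode v s
  writeAdvance w replies :=
    if Quorum f replies then
      match w with
      | .query c => some (.inl (.put (toLex ((ofLex (largestTag replies)).1 + 1, (c : WithBot ℕ)))))
      | .put _ => some (.inr ())
    else none
  single := by
    intro w r w' h hs
    cases w <;> simp_all
  writeMeta _ μ q := match q with
    | .getTag => μ
    | .put t => if μ < t then t else μ
  writeData _ μ q p y := match q, p with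
    | .put t, some y' => if μ < t then y' else y
    | _, _ => y
  writeReply _ μ q := match q with
    | .getTag => .tag μ
    | .put _ => .ack
  ReadState := ReadState V
  beginRead _ := .get
  readTargets r := match r with
    | .aborted => ∅
    | _ => Finset.univ
  readRequest r s := match r with
    | .writeBack t v => .put t (C.encode v s)
    | _ => .get
  readAdvance r replies :=
    if Quorum f replies then
      match r with
      | .get =>
        if h : ∃ p, Selected (codingParameter N f ν) f ν C.encode replies p then
          some (.inl (.writeBack h.choose.1 h.choose.2))
        else some (.inl .aborted)
      | .writeBack _ v => some (.inr v)
      | .aborted => none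
    else none
  handleRead _ q x := match q with
    | .get => (x, .pair x.1 x.2)
    | .put t y => (if x.1 < t then ⟨t, y⟩ else x, .ack)

end TwoA

/-- The lower bound, in units, of Cadambe, Wang and Lynch on the storage cost, for `ν ≤ f + 1`. -/
noncomputable def cadambeBound (N f ν : ℕ) : ℝ := (ν * N : ℝ) / ((N : ℝ) - f + ν - 1)

end SharedMemory

/-!
The storage cost of the algorithm is a direct computation: each server stores one symbol, and a
symbol has `1 / k` of the size of a value. The comparison with the bound of Cadambe, Wang and Lynch
is elementary, since `⌈(N - 2f) / ν⌉` lies between `(N - 2f) / ν` and `(N - 2f + ν - 1) / ν`, and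
`N - 2f` is almost `N`. As the cost of the algorithm is thus at most about `ν`, optimality amounts
to a lower bound of almost `ν` for all protocols of the class, where `N` and `f` are fixed and `V`
is large (`exists_storageCost_ge`). This is a counting argument: one point of an execution is
exhibited at which the server data distinguish between a fixed fraction of all `ν`-tuples of
distinct values.

*Preparation.* Client `0` writes `x 0`, and its write terminates. Then the clients `1, …, ν - 1`
are brought, one after the other, to the beginning of the phase in which they send their values
`x 1, …, x (ν - 1)` (`exists_prepared`). A writer gets there without help of the others: they might
have crashed, and if its write terminated without sending the value, then a subsequent read would
return a value of which no server has learned anything. Since there are no reads, everything up to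
here except the data and values in the messages is the same for all tuples `x`.

*Critical servers.* Now the values of the active writers are delivered to the servers in turn. Let
`returnable f K σ` be the values that a read starting at `σ` may return if servers receive further
values from clients in `K` only. A probe at `t` is the state in which the values have been delivered
to the servers before `t`, and then server `t - 1` has crashed. At first, no value of an active
writer `j` can be returned if `j` does not help any more, even if the other active writers do; when
all servers have been served, some value can be (`Setup.exists_returnable`). If `d + 1` is the
first probe at which this happens, server `d` is critical, and a writer `j` whose value can be
returned there is stopped forever. The schedule goes on from the probe at `d`, where none of these
values can be returned yet. After `ν - 1` rounds all writers have been stopped (`Setup.exists_critical`); together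
with the last probe, at most `ν - 1 ≤ f` servers have crashed at any time. Then a read can return
`x 0` only (`Setup.returnable_final`).

*Decoding.* The list of critical servers and stopped writers together with the final states of the
servers determines `x`. First, `x 0` is the only value that can be returned at the end. Then one
goes back through the list. When it comes to the critical server `d` and the writer `j`, the values
of the writers stopped later are known. In the probe at `d + 1` server `d` has crashed, so that its
data do not matter; the servers before `d` have not changed since then, and those after `d` depend
on `x 0` only. Hence it is known which values can be returned with the help of the writers stopped
later; the value of `j` is one of them, and the only one that is not known already
(`Setup.stopped_eq`). All this is expressed by comparing two tuples: states that agree up to the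
data of crashed servers and the values of clients outside of `K` have the same `returnable f K`
(`Sim.returnable_eq`). The number of lists does not depend on `V`, so for one of them the server
data take at least a fixed fraction of `|V| ^ ν` values (`exists_descFactorial_le`).
-/

namespace SharedMemory
namespace Protocol

variable {N : ℕ} {V : Type} {P : Protocol N V}

/-! ### Running lists and sequences of actions -/

theorem Step.deterministic {a : Action N V} {σ τ τ' : P.State} (h : P.Step a σ τ)
    (h' : P.Step a σ τ') : τ = τ' := by
  cases h <;> cases h' <;> simp_all

open Classical in
/-- The effect of an action; an action that is not enabled has none. -/
noncomputable def exec (a : Action N V) (σ : P.State) : P.State :=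
  if h : ∃ τ, P.Step a σ τ then h.choose else σ

theorem exec_of_step {a : Action N V} {σ τ : P.State} (h : P.Step a σ τ) : exec a σ = τ := by
  have h' : ∃ τ, P.Step a σ τ := ⟨τ, h⟩
  rw [exec, dif_pos h']
  exact h'.choose_spec.deterministic h

theorem exec_of_not_enabled {a : Action N V} {σ : P.State} (h : ¬ ∃ τ, P.Step a σ τ) :
    exec a σ = σ := by
  rw [exec, dif_neg h]

theorem exec_preserves {p : P.State → Prop} {a : Action N V} {σ : P.State} (h : p σ)
    (hs : ∀ τ, P.Step a σ τ → p τ) : p (exec a σ) := by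
  by_cases hx : ∃ τ, P.Step a σ τ
  · obtain ⟨τ, hτ⟩ := hx
    rw [exec_of_step hτ]
    exact hs τ hτ
  · rwa [exec_of_not_enabled hx]

/-- The state after a list of actions. -/
noncomputable def run (σ : P.State) (l : List (Action N V)) : P.State :=
  l.foldl (fun σ a => exec a σ) σ

@[simp] theorem run_nil (σ : P.State) : run σ [] = σ := rfl

@[simp] theorem run_cons (σ : P.State) (a : Action N V) (l : List (Action N V)) :
    run σ (a :: l) = run (exec a σ) l := rfl

@[simp] theorem run_append (σ : P.State) (l l' : List (Action N V)) :
    run σ (l ++ l') = run (run σ l) l' := by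
  simp [run]

/-- A property that every action of the list preserves is preserved by the list. -/
theorem run_preserves {p : P.State → Prop} {l : List (Action N V)} {σ : P.State} (h : p σ)
    (hs : ∀ a ∈ l, ∀ σ τ : P.State, p σ → P.Step a σ τ → p τ) : p (run σ l) := by
  induction l generalizing σ with
  | nil => exact h
  | cons a l ih =>
    exact ih (exec_preserves h fun τ => hs a (by simp) σ τ h) fun b hb => hs b (by simp [hb])

/-- The property holds at each point of the run of a list of actions. -/
def Always (p : P.State → Prop) (σ : P.State) (l : List (Action N V)) : Prop :=
  ∀ l₁ l₂, l = l₁ ++ l₂ → p (run σ l₁)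

theorem Always.last {p : P.State → Prop} {σ : P.State} {l : List (Action N V)}
    (h : Always p σ l) : p (run σ l) := h l [] (by simp)

theorem Always.append {p : P.State → Prop} {σ : P.State} {l l' : List (Action N V)}
    (h : Always p σ l) (h' : Always p (run σ l) l') : Always p σ (l ++ l') := by
  intro l₁ l₂ e
  rcases List.append_eq_append_iff.1 e with ⟨b, rfl, rfl⟩ | ⟨b, rfl, rfl⟩
  · rw [run_append]
    exact h' _ _ rfl
  · exact h _ _ rfl

theorem always_preserves {p : P.State → Prop} {l : List (Action N V)} {σ : P.State} (h : p σ)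
    (hs : ∀ a ∈ l, ∀ σ τ : P.State, p σ → P.Step a σ τ → p τ) : Always p σ l := by
  rintro l₁ l₂ rfl
  exact run_preserves h fun a ha => hs a (by simp [ha])

theorem Always.mono {p q : P.State → Prop} {σ : P.State} {l : List (Action N V)}
    (h : Always p σ l) (hpq : ∀ τ, p τ → q τ) : Always q σ l :=
  fun l₁ l₂ e => hpq _ (h l₁ l₂ e)

/-- The states visited by a sequence of actions. -/
noncomputable def trajectory (σ : P.State) (as : ℕ → Action N V) : ℕ → P.State
  | 0 => σ
  | n + 1 => exec (as n) (trajectory σ as n)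

open Classical in
/-- The execution that performs a sequence of actions, with `stutter` for those not enabled. -/
noncomputable def execution (P : Protocol N V) (as : ℕ → Action N V) : P.Execution where
  state := trajectory P.initialState as
  action n := if ∃ τ, P.Step (as n) (trajectory P.initialState as n) τ then as n else .stutter
  init := rfl
  step n := by
    by_cases h : ∃ τ, P.Step (as n) (trajectory P.initialState as n) τ
    · rw [if_pos h]
      obtain ⟨τ, hτ⟩ := h
      rw [trajectory, exec_of_step hτ]
      exact hτ
    · rw [if_neg h, trajectory, exec_of_not_enabled h]
      exact .stutter _

theorem execution_action_eq {as : ℕ → Action N V} {n : ℕ} {a : Action N V}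
    (h : (P.execution as).action n = a) (ha : a ≠ .stutter) :
    as n = a ∧ ∃ τ, P.Step a (trajectory P.initialState as n) τ := by
  classical
  change (if ∃ τ, P.Step (as n) (trajectory P.initialState as n) τ then as n else .stutter) = a at h
  by_cases hx : ∃ τ, P.Step (as n) (trajectory P.initialState as n) τ
  · rw [if_pos hx] at h
    exact ⟨h, h ▸ hx⟩
  · rw [if_neg hx] at h
    exact absurd h.symm ha

theorem execution_action_of_enabled {as : ℕ → Action N V} {n : ℕ}
    (h : ∃ τ, P.Step (as n) (trajectory P.initialState as n) τ) :
    (P.execution as).action n = as n := by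
  classical
  exact if_pos h

/-- A list of actions, continued by a sequence of actions. -/
def extend (l : List (Action N V)) (as : ℕ → Action N V) (n : ℕ) : Action N V :=
  if h : n < l.length then l[n] else as (n - l.length)

theorem extend_add (l : List (Action N V)) (as : ℕ → Action N V) (n : ℕ) :
    extend l as (l.length + n) = as n := by
  simp [extend]

theorem extend_of_lt {l : List (Action N V)} {as : ℕ → Action N V} {n : ℕ} (h : n < l.length) :
    extend l as n = l[n] := by
  simp [extend, h]

theorem trajectory_extend (σ : P.State) (l l' : List (Action N V)) (as : ℕ → Action N V) :
    trajectory σ (extend (l ++ l') as) l.length = run σ l := by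
  induction l using List.reverseRecOn generalizing l' with
  | nil => rfl
  | append_singleton l a ih =>
    have h := ih (a :: l')
    simp only [List.length_append, List.length_singleton, run_append, run_cons, run_nil,
      List.append_assoc, List.singleton_append, trajectory] at h ⊢
    rw [h, extend_of_lt (by simp)]
    simp

theorem trajectory_extend_length (σ : P.State) (l : List (Action N V)) (as : ℕ → Action N V) :
    trajectory σ (extend l as) l.length = run σ l := by
  have := trajectory_extend σ l [] as
  rwa [List.append_nil] at this

/-- The first `n` actions of a sequence. -/
def initial (as : ℕ → Action N V) (n : ℕ) : List (Action N V) := (List.range n).map as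

@[simp] theorem initial_length (as : ℕ → Action N V) (n : ℕ) : (initial as n).length = n := by
  simp [initial]

theorem mem_initial {as : ℕ → Action N V} {n : ℕ} {a : Action N V} :
    a ∈ initial as n ↔ ∃ k < n, as k = a := by
  simp [initial]

theorem trajectory_extend_add (σ : P.State) (l : List (Action N V)) (as : ℕ → Action N V) (n : ℕ) :
    trajectory σ (extend l as) (l.length + n) = run σ (l ++ initial as n) := by
  induction n with
  | zero => simpa [initial] using trajectory_extend_length σ l as
  | succ n ih =>
    rw [← Nat.add_assoc, trajectory, ih, extend_add]
    simp [initial, List.range_succ]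

/-- Along an extended list a property holds everywhere if it holds everywhere along the list and
along all finite initial parts of the continuation. -/
theorem trajectory_extend_of_always {p : P.State → Prop} {σ : P.State} {l : List (Action N V)}
    {as : ℕ → Action N V} (h : Always p σ l) (h' : ∀ n, p (run σ (l ++ initial as n))) (n : ℕ) :
    p (trajectory σ (extend l as) n) := by
  rcases le_or_gt l.length n with hn | hn
  · obtain ⟨k, rfl⟩ := Nat.exists_eq_add_of_le hn
    rw [trajectory_extend_add]
    exact h' k
  · have e : l = l.take n ++ l.drop n := (List.take_append_drop n l).symm
    have h1 := trajectory_extend σ (l.take n) (l.drop n) as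
    rw [← e, List.length_take, min_eq_left hn.le] at h1
    rw [h1]
    exact h _ _ e

/-- Executions of lists with a common initial part agree there. -/
theorem execution_extend_action (l l₁ l₂ : List (Action N V)) (as bs : ℕ → Action N V) {n : ℕ}
    (hn : n < l.length) :
    (P.execution (extend (l ++ l₁) as)).action n = (P.execution (extend (l ++ l₂) bs)).action n := by
  classical
  have e : l = l.take n ++ l.drop n := (List.take_append_drop n l).symm
  have h1 := trajectory_extend P.initialState (l.take n) (l.drop n ++ l₁) as
  have h2 := trajectory_extend P.initialState (l.take n) (l.drop n ++ l₂) bs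
  rw [← List.append_assoc, ← e, List.length_take, min_eq_left hn.le] at h1 h2
  change (if ∃ τ, P.Step _ _ τ then _ else _) = (if ∃ τ, P.Step _ _ τ then _ else _)
  rw [h1, h2, extend_of_lt (by simp; omega), extend_of_lt (by simp; omega),
    List.getElem_append_left hn, List.getElem_append_left hn]

/-! ### Fair schedules -/

instance [Countable V] : Countable (Action N V) := by
  let g : Action N V → ℕ × ℕ × ℕ × ℕ × Option V := fun a => match a with
    | .invokeWrite c v => (0, c, 0, 0, some v)
    | .invokeRead c => (1, c, 0, 0, none)
    | .returnWrite c => (2, c, 0, 0, none)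
    | .returnRead c v => (3, c, 0, 0, some v)
    | .send c s => (4, c, s, 0, none)
    | .serverReceive c s n => (5, c, s, n, none)
    | .clientReceive c s n => (6, c, s, n, none)
    | .nextPhase c => (7, c, 0, 0, none)
    | .crashServer s => (8, 0, s, 0, none)
    | .crashClient c => (9, c, 0, 0, none)
    | .stutter => (10, 0, 0, 0, none)
  refine Function.Injective.countable (f := g) fun a b h => ?_
  cases a <;> cases b <;> simp_all [g, Fin.ext_iff]

/-- A sequence of controlled actions and stuttering in which every controlled action occurs
infinitely often. -/
theorem exists_fair_schedule [Countable V] : ∃ as : ℕ → Action N V,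
    (∀ n, (as n).IsControlled ∨ as n = .stutter) ∧
    ∀ a : Action N V, a.IsControlled → ∀ n, ∃ m, n ≤ m ∧ as m = a := by
  classical
  have : Nonempty (Action N V) := ⟨.stutter⟩
  obtain ⟨g, hg⟩ := exists_surjective_nat (Action N V)
  refine ⟨fun n => if (g n.unpair.1).IsControlled then g n.unpair.1 else .stutter, fun n => ?_,
    fun a ha n => ?_⟩
  · by_cases h : (g n.unpair.1).IsControlled <;> simp [h]
  · obtain ⟨k, rfl⟩ := hg a
    exact ⟨Nat.pair k n, Nat.right_le_pair k n, by simp [ha]⟩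

theorem execution_isFair {as : ℕ → Action N V} {l : List (Action N V)}
    (h : ∀ a : Action N V, a.IsControlled → ∀ n, ∃ m, n ≤ m ∧ as m = a) :
    (P.execution (extend l as)).IsFair := by
  intro a ha n
  obtain ⟨m, hm, rfl⟩ := h a ha n
  refine ⟨l.length + m, by omega, ?_⟩
  by_cases hx : ∃ τ, P.Step (as m) ((P.execution (extend l as)).state (l.length + m)) τ
  · left
    have : extend l as (l.length + m) = as m := extend_add l as m
    rw [← this] at hx
    rw [execution_action_of_enabled hx, this]
  · exact .inr hx

/-! ### Simple invariants -/

/-- No value is in transit from client `c` to a server. -/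
def NoPayload (c : ℕ) (σ : P.State) : Prop :=
  ∀ s n q p, σ.requests c s n ≠ some (.inl (q, some p))

/-- No read is in progress, and no request of a read is in transit. -/
def NoReads (σ : P.State) : Prop :=
  (∀ c r rep, (σ.client c).activity ≠ .reading r rep) ∧
    ∀ c s n q, σ.requests c s n ≠ some (.inr q)

/-- Client `c` will not send a value any more, unless it begins another write. -/
def Mute (c : ℕ) (σ : P.State) : Prop :=
  NoPayload c σ ∧ (c ∈ σ.crashedClients ∨ ∀ v w rep, (σ.client c).activity = .writing v w rep →
    P.stage w = .after ∨ P.stage w = .value ∧ (σ.client c).unsent = ∅)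

/-- An action that does not start a write. -/
def _root_.SharedMemory.Action.NoWrite (a : Action N V) : Prop := ∀ c v, a ≠ .invokeWrite c v

/-- An action that does not start a read. -/
def _root_.SharedMemory.Action.NoRead (a : Action N V) : Prop := ∀ c, a ≠ .invokeRead c

/-- An action that does not crash a server. -/
def _root_.SharedMemory.Action.NoCrash (a : Action N V) : Prop := ∀ s, a ≠ .crashServer s

theorem _root_.SharedMemory.Action.IsControlled.noWrite {a : Action N V}
    (h : a.IsControlled ∨ a = .stutter) : a.NoWrite := by
  rintro c v rfl
  simp [Action.IsControlled] at h

theorem _root_.SharedMemory.Action.IsControlled.noRead {a : Action N V}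
    (h : a.IsControlled ∨ a = .stutter) : a.NoRead := by
  rintro c rfl
  simp [Action.IsControlled] at h

theorem _root_.SharedMemory.Action.IsControlled.noCrash {a : Action N V}
    (h : a.IsControlled ∨ a = .stutter) : a.NoCrash := by
  rintro c rfl
  simp [Action.IsControlled] at h

theorem Activity.request_eq_write {x : P.Activity} {s : Fin N} {q : P.WriteRequest}
    {p : Option P.Payload} (h : x.request s = some (.inl (q, p))) :
    ∃ v w rep, x = .writing v w rep ∧ (p.isSome → P.stage w = .value) := by
  cases x with
  | idle => simp [Activity.request] at h
  | reading r rep => simp [Activity.request] at h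
  | writing v w rep =>
    refine ⟨v, w, rep, rfl, fun hp => ?_⟩
    simp only [Activity.request, Option.some.injEq, Sum.inl.injEq, Prod.mk.injEq] at h
    obtain ⟨-, rfl⟩ := h
    cases hst : P.stage w <;> simp [hst] at hp ⊢

theorem Activity.record_isWrite (x : P.Activity) (s : Fin N) (a : P.Reply) :
    (x.record s a).IsWrite ↔ x.IsWrite := by
  cases x <;> cases a <;> simp [Activity.record, Activity.IsWrite]

theorem Activity.record_eq_writing {x : P.Activity} {s : Fin N} {a : P.Reply} {v : V}
    {w : P.WriteState} {rep : Fin N → Option P.WriteReply} (h : x.record s a = .writing v w rep) :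
    ∃ rep', x = .writing v w rep' := by
  cases x <;> cases a <;> simp_all [Activity.record]

theorem Activity.record_eq_reading {x : P.Activity} {s : Fin N} {a : P.Reply}
    {r : P.ReadState} {rep : Fin N → Option P.ReadReply} (h : x.record s a = .reading r rep) :
    ∃ rep', x = .reading r rep' := by
  cases x <;> cases a <;> simp_all [Activity.record]

theorem setClient_client (σ : P.State) (c c' : ℕ) (γ : P.ClientState) :
    (σ.setClient c γ).client c' = if c' = c then γ else σ.client c' := by
  simp [State.setClient, Function.update_apply]

theorem step_noReads {a : Action N V} {σ τ : P.State} (ha : a.NoRead) (h : NoReads σ)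
    (st : P.Step a σ τ) : NoReads τ := by
  obtain ⟨h1, h2⟩ := h
  cases st with
  | invokeRead _ c => exact absurd rfl (ha c)
  | invokeWrite _ c v hc hx =>
    refine ⟨fun c' => ?_, h2⟩
    rw [setClient_client]; split_ifs
    · simp [ClientState.start]
    · exact h1 c'
  | send _ c s q hc hs hq =>
    refine ⟨fun c' => ?_, fun c' s' n' q' => ?_⟩
    · change ∀ r rep, ((σ.setClient c _).client c').activity ≠ _
      rw [setClient_client]; split_ifs
      · exact h1 c
      · exact h1 c'
    · simp only [setMessage]
      split_ifs
      · rintro e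
        simp only [Option.some.injEq] at e
        subst e
        cases hx : (σ.client c).activity with
        | idle => simp [hx, Activity.request] at hq
        | writing => simp [hx, Activity.request] at hq
        | reading r rep => exact h1 c r rep hx
      · exact h2 _ _ _ _
  | serverReceive _ c s n q hs hq =>
    refine ⟨h1, fun c' s' n' q' => ?_⟩
    simp only [setMessage]
    split_ifs
    · simp
    · exact h2 _ _ _ _
  | clientReceive _ c s n a hc ha' =>
    refine ⟨fun c' => ?_, h2⟩
    change ∀ r rep, ((σ.setClient c _).client c').activity ≠ _
    rw [setClient_client]
    split_ifs
    · intro r rep e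
      obtain ⟨rep', e'⟩ := Activity.record_eq_reading e
      exact h1 c _ _ e'
    · exact h1 c
    · exact h1 c'
  | nextRead _ c r r' rep hc hx hu hr => exact absurd hx (h1 c _ _)
  | returnRead _ c v r rep hc hx hu hr => exact absurd hx (h1 c _ _)
  | nextWrite _ c v w w' rep hc hx hu hw =>
    refine ⟨fun c' => ?_, h2⟩
    rw [setClient_client]; split_ifs
    · simp [ClientState.start]
    · exact h1 c'
  | returnWrite _ c v w l rep hc hx hu hw =>
    refine ⟨fun c' => ?_, h2⟩
    rw [setClient_client]; split_ifs
    · simp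
    · exact h1 c'
  | crashServer => exact ⟨h1, h2⟩
  | crashClient => exact ⟨h1, h2⟩
  | stutter => exact ⟨h1, h2⟩

/-- Values are put in transit only in the stage `value`. -/
theorem step_noPayload {a : Action N V} {σ τ : P.State} {c : ℕ} (h : NoPayload c σ)
    (hs : c ∈ σ.crashedClients ∨ ∀ v w rep, (σ.client c).activity = .writing v w rep →
      P.stage w = .value → (σ.client c).unsent = ∅)
    (st : P.Step a σ τ) : NoPayload c τ := by
  cases st with
  | send _ c' s q hc hs' hq =>
    intro s' n' q' p'
    simp only [setMessage]
    split_ifs with e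
    · obtain ⟨rfl, rfl, rfl⟩ := e
      rintro e
      simp only [Option.some.injEq] at e
      subst e
      obtain ⟨v, w, rep, hx, hp⟩ := Activity.request_eq_write hq
      rcases hs with hs | hs
      · exact hc hs
      · rw [hs v w rep hx (hp rfl)] at hs'
        simp at hs'
    · exact h _ _ _ _
  | serverReceive _ c' s n q hs hq =>
    intro s' n' q' p'
    simp only [setMessage]
    split_ifs with e
    · simp
    · exact h _ _ _ _
  | _ => exact h

theorem step_mute {a : Action N V} {σ τ : P.State} {c : ℕ} (ha : ∀ v, a ≠ .invokeWrite c v)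
    (h : Mute c σ) (st : P.Step a σ τ) : Mute c τ := by
  refine ⟨step_noPayload h.1 (h.2.imp id fun h v w rep hx hw => ?_) st, ?_⟩
  · rcases h v w rep hx with h | h
    · simp [h] at hw
    · exact h.2
  obtain ⟨-, h⟩ := h
  rcases h with h | h
  · left
    cases st <;> first | exact h | exact Set.mem_insert_of_mem _ h
  by_cases hcr : c ∈ τ.crashedClients
  · exact .inl hcr
  right
  cases st with
  | invokeWrite _ c' v hc hx =>
    intro v' w' rep' hx'
    rw [setClient_client] at hx' ⊢
    split_ifs at hx' ⊢ with e
    · exact absurd (by rw [e]) (ha v)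
    · exact h _ _ _ hx'
  | invokeRead _ c' hc hx =>
    intro v' w' rep' hx'
    rw [setClient_client] at hx' ⊢
    split_ifs at hx' ⊢ with e
    · simp [ClientState.start] at hx'
    · exact h _ _ _ hx'
  | send _ c' s q hc hs hq =>
    intro v' w' rep' hx'
    change ((σ.setClient c' _).client c).activity = _ at hx'
    change _ ∨ _ ∧ ((σ.setClient c' _).client c).unsent = _
    rw [setClient_client] at hx' ⊢
    split_ifs at hx' ⊢ with e
    · subst e
      refine (h _ _ _ hx').imp id (And.imp id fun hu => ?_)
      simp [hu]
    · exact h _ _ _ hx'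
  | serverReceive _ c' s n q hs hq => exact h
  | clientReceive _ c' s n q hs hq =>
    intro v' w' rep' hx'
    change ((σ.setClient c' _).client c).activity = _ at hx'
    change _ ∨ _ ∧ ((σ.setClient c' _).client c).unsent = _
    rw [setClient_client] at hx' ⊢
    by_cases e : c = c'
    · subst e
      rw [if_pos rfl] at hx' ⊢
      simp only at hx' ⊢
      split_ifs at hx'
      · obtain ⟨rep, e⟩ := Activity.record_eq_writing hx'
        exact h _ _ _ e
      · exact h _ _ _ hx'
    · rw [if_neg e] at hx' ⊢
      exact h _ _ _ hx'
  | nextWrite _ c' v w w' rep hc hx hu hw =>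
    intro v' w'' rep' hx'
    rw [setClient_client] at hx' ⊢
    split_ifs at hx' ⊢ with e
    · subst e
      simp only [ClientState.start, Activity.writing.injEq] at hx'
      left
      rw [← hx'.2.1]
      refine P.single _ _ _ hw ?_
      rcases h _ _ _ hx with h | h <;> simp [h]
    · exact h _ _ _ hx'
  | returnWrite _ c' v w l rep hc hx hu hw =>
    intro v' w' rep' hx'
    rw [setClient_client] at hx' ⊢
    split_ifs at hx' ⊢ with e
    exact h _ _ _ hx'
  | nextRead _ c' r r' rep hc hx hu hr =>
    intro v' w' rep' hx'
    rw [setClient_client] at hx' ⊢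
    split_ifs at hx' ⊢ with e
    · simp [ClientState.start] at hx'
    · exact h _ _ _ hx'
  | returnRead _ c' v r rep hc hx hu hr =>
    intro v' w' rep' hx'
    rw [setClient_client] at hx' ⊢
    split_ifs at hx' ⊢ with e
    exact h _ _ _ hx'
  | crashServer => exact h
  | crashClient => exact h
  | stutter => exact h

/-- Only an invocation turns a client into a writer. -/
theorem step_not_isWrite {a : Action N V} {σ τ : P.State} {c : ℕ} (ha : ∀ v, a ≠ .invokeWrite c v)
    (h : ¬ (σ.client c).activity.IsWrite) (st : P.Step a σ τ) :
    ¬ (τ.client c).activity.IsWrite := by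
  cases st with
  | invokeWrite _ c' v hc hx =>
    rw [setClient_client]; split_ifs with e
    · exact absurd (by rw [e]) (ha v)
    · exact h
  | send _ c' s q hc hs hq =>
    change ¬ ((σ.setClient c' _).client c).activity.IsWrite
    rw [setClient_client]; split_ifs with e
    · exact e ▸ h
    · exact h
  | clientReceive _ c' s n q hs hq =>
    change ¬ ((σ.setClient c' _).client c).activity.IsWrite
    rw [setClient_client]
    by_cases e : c = c'
    · rw [if_pos e]
      simp only
      split_ifs
      · rw [Activity.record_isWrite]; exact e ▸ h
      · exact e ▸ h
    · rw [if_neg e]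
      exact h
  | nextWrite _ c' v w w' rep hc hx hu hw =>
    rw [setClient_client]; split_ifs with e
    · subst e; exact absurd (by rw [hx]; trivial) h
    · exact h
  | invokeRead | returnWrite | nextRead | returnRead =>
    rw [setClient_client]; split_ifs with e
    · simp [ClientState.start, Activity.IsWrite]
    · exact h
  | _ => exact h

/-- The values of the writes in progress are those prescribed by `x`. -/
def HasValues (x : ℕ → V) (σ : P.State) : Prop :=
  ∀ c v w rep, (σ.client c).activity = .writing v w rep → v = x c

theorem step_hasValues {x : ℕ → V} {a : Action N V} {σ τ : P.State}
    (ha : ∀ c v, a = .invokeWrite c v → v = x c) (h : HasValues x σ) (st : P.Step a σ τ) :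
    HasValues x τ := by
  intro c v w rep hx'
  cases st with
  | invokeWrite _ c' v' hc hx =>
    rw [setClient_client] at hx'; split_ifs at hx' with e
    · simp only [ClientState.start, Activity.writing.injEq] at hx'
      rw [← hx'.1, e]
      exact ha _ _ rfl
    · exact h _ _ _ _ hx'
  | send _ c' s q hc hs hq =>
    change ((σ.setClient c' _).client c).activity = _ at hx'
    rw [setClient_client] at hx'; split_ifs at hx' with e
    · exact h _ _ _ _ (e ▸ hx')
    · exact h _ _ _ _ hx'
  | clientReceive _ c' s n q hs hq =>
    change ((σ.setClient c' _).client c).activity = _ at hx'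
    rw [setClient_client] at hx'
    by_cases e : c = c'
    · subst e
      rw [if_pos rfl] at hx'
      simp only at hx'
      split_ifs at hx'
      · obtain ⟨rep, e⟩ := Activity.record_eq_writing hx'
        exact h _ _ _ _ e
      · exact h _ _ _ _ hx'
    · rw [if_neg e] at hx'
      exact h _ _ _ _ hx'
  | nextWrite _ c' v' w' w'' rep' hc hx hu hw =>
    rw [setClient_client] at hx'; split_ifs at hx' with e
    · simp only [ClientState.start, Activity.writing.injEq] at hx'
      rw [← hx'.1, e]
      exact h _ _ _ _ hx
    · exact h _ _ _ _ hx'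
  | invokeRead | nextRead =>
    rw [setClient_client] at hx'; split_ifs at hx' with e
    · simp [ClientState.start] at hx'
    · exact h _ _ _ _ hx'
  | returnWrite | returnRead =>
    rw [setClient_client] at hx'; split_ifs at hx' with e
    exact h _ _ _ _ hx'
  | _ => exact h _ _ _ _ hx'

/-- A client has not sent requests of phases to come. -/
def Numbered (σ : P.State) : Prop := ∀ c s n, σ.requests c s n ≠ none → n ≤ (σ.client c).number

theorem step_numbered {a : Action N V} {σ τ : P.State} (h : Numbered σ) (st : P.Step a σ τ) :
    Numbered τ := by
  have hnum : ∀ c, (σ.client c).number ≤ (τ.client c).number := by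
    intro c
    cases st with
    | send _ c' | clientReceive _ c' =>
      change (σ.client c).number ≤ ((σ.setClient c' _).client c).number
      rw [setClient_client]
      by_cases e : c = c'
      · subst e; simp
      · simp [e]
    | invokeWrite | invokeRead | nextWrite | nextRead | returnWrite | returnRead =>
      rw [setClient_client]; split_ifs with e
      · subst e; simp [ClientState.start]
      · exact le_rfl
    | _ => exact le_rfl
  intro c s n hn
  cases st with
  | send _ c' s' q hc hs hq =>
    simp only [setMessage] at hn
    split_ifs at hn with e
    · obtain ⟨rfl, rfl, rfl⟩ := e
      exact hnum c
    · exact (h _ _ _ hn).trans (hnum c)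
  | serverReceive _ c' s' n' q hs hq =>
    simp only [setMessage] at hn
    split_ifs at hn with e
    · exact absurd rfl hn
    · exact (h _ _ _ hn).trans (hnum c)
  | _ => exact (h _ _ _ hn).trans (hnum c)

/-- Servers act only on receipt of a request. -/
theorem run_server {σ : P.State} {l : List (Action N V)} {s : Fin N}
    (h : ∀ c n, Action.serverReceive c s n ∉ l) : (run σ l).server s = σ.server s := by
  refine run_preserves (p := fun τ => τ.server s = σ.server s) rfl fun a ha τ τ' hτ st => ?_
  rw [← hτ]
  cases st with
  | serverReceive _ c s' n q hs hq =>
    have : s ≠ s' := by rintro rfl; exact h _ _ ha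
    simp [Function.update_of_ne this]
  | _ => rfl

theorem step_crashedServers {a : Action N V} {σ τ : P.State} (ha : a.NoCrash)
    (st : P.Step a σ τ) : τ.crashedServers = σ.crashedServers := by
  cases st with
  | crashServer _ s => exact absurd rfl (ha s)
  | _ => rfl

theorem crashedServers_subset {a : Action N V} {σ τ : P.State}
    (st : P.Step a σ τ) : σ.crashedServers ⊆ τ.crashedServers := by
  cases st with
  | crashServer _ s => exact Set.subset_insert _ _
  | _ => exact subset_rfl

theorem run_crashedServers {σ : P.State} {l : List (Action N V)} (h : ∀ a ∈ l, a.NoCrash) :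
    (run σ l).crashedServers = σ.crashedServers :=
  run_preserves (p := fun τ => τ.crashedServers = σ.crashedServers) rfl fun a ha _ _ hτ st =>
    (step_crashedServers (h a ha) st).trans hτ

theorem subset_run_crashedServers (σ : P.State) (l : List (Action N V)) :
    σ.crashedServers ⊆ (run σ l).crashedServers :=
  run_preserves (p := fun τ => σ.crashedServers ⊆ τ.crashedServers) subset_rfl
    fun _ _ _ _ hτ st => hτ.trans (crashedServers_subset st)

/-- The writes in progress. -/
def writers (σ : P.State) : Set ℕ := {c | (σ.client c).activity.IsWrite}

theorem run_writers {σ : P.State} {l : List (Action N V)} (h : ∀ a ∈ l, a.NoWrite) :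
    writers (run σ l) ⊆ writers σ :=
  run_preserves (p := fun τ => writers τ ⊆ writers σ) subset_rfl
    fun a ha _ _ hτ st c hc => hτ (by
      by_contra hn
      exact step_not_isWrite (fun v => h a ha c v) hn st hc)

theorem initialState_noReads : NoReads P.initialState :=
  ⟨fun c r rep => by simp [initialState], fun c s n q => by simp [initialState]⟩

/-! ### Lockstep simulation of runs with different values -/

/-- Equality of activities up to the value of a write, which agrees if `k` holds. -/
inductive ActivitySim (k : Prop) : P.Activity → P.Activity → Prop
  | idle : ActivitySim k .idle .idle
  | writing (v v' : V) (w : P.WriteState) (rep : Fin N → Option P.WriteReply) (h : k → v = v') :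
      ActivitySim k (.writing v w rep) (.writing v' w rep)
  | reading (r : P.ReadState) (rep : Fin N → Option P.ReadReply) :
      ActivitySim k (.reading r rep) (.reading r rep)

/-- Equality of requests up to the payload, which agrees if `k` holds. -/
inductive RequestSim (k : Prop) : Option P.Request → Option P.Request → Prop
  | none : RequestSim k .none .none
  | write (q : P.WriteRequest) (p p' : Option P.Payload)
      (h : p = p' ∨ ¬ k ∧ p.isSome ∧ p'.isSome) :
      RequestSim k (some (.inl (q, p))) (some (.inl (q, p')))
  | read (q : P.ReadRequest) : RequestSim k (some (.inr q)) (some (.inr q))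

/-- Equality of client states up to the value of a write, which agrees if `k` holds. -/
structure ClientSim (k : Prop) (γ δ : P.ClientState) : Prop where
  activity : ActivitySim k γ.activity δ.activity
  number : γ.number = δ.number
  unsent : γ.unsent = δ.unsent
  memory : γ.memory = δ.memory

/-- Equality of global states up to the data of the servers in `D` and the values of the clients
outside of `K`. -/
structure Sim (D : Set (Fin N)) (K : Set ℕ) (σ τ : P.State) : Prop where
  metadata : ∀ s, (σ.server s).1 = (τ.server s).1
  server : ∀ s, s ∉ D → σ.server s = τ.server s
  client : ∀ c, ClientSim (c ∈ K) (σ.client c) (τ.client c)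
  requests : ∀ c s n, RequestSim (c ∈ K) (σ.requests c s n) (τ.requests c s n)
  replies : σ.replies = τ.replies
  crashedServers : σ.crashedServers = τ.crashedServers
  crashedClients : σ.crashedClients = τ.crashedClients

theorem ActivitySim.symm {k : Prop} {x y : P.Activity} (h : ActivitySim k x y) :
    ActivitySim k y x := by
  cases h with
  | idle => exact .idle
  | writing v v' w rep h => exact .writing _ _ _ _ fun hk => (h hk).symm
  | reading => exact .reading _ _

theorem RequestSim.symm {k : Prop} {x y : Option P.Request} (h : RequestSim k x y) :
    RequestSim k y x := by
  cases h with
  | none => exact .none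
  | write q p p' h => exact .write _ _ _ (h.imp Eq.symm fun h => ⟨h.1, h.2.2, h.2.1⟩)
  | read => exact .read _

theorem Sim.symm {D : Set (Fin N)} {K : Set ℕ} {σ τ : P.State} (h : Sim D K σ τ) :
    Sim D K τ σ where
  metadata s := (h.metadata s).symm
  server s hs := (h.server s hs).symm
  client c := ⟨(h.client c).activity.symm, (h.client c).number.symm, (h.client c).unsent.symm,
    (h.client c).memory.symm⟩
  requests c s n := (h.requests c s n).symm
  replies := h.replies.symm
  crashedServers := h.crashedServers.symm
  crashedClients := h.crashedClients.symm

theorem Sim.refl (D : Set (Fin N)) (K : Set ℕ) (σ : P.State) : Sim D K σ σ where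
  metadata _ := rfl
  server _ _ := rfl
  client c := by
    refine ⟨?_, rfl, rfl, rfl⟩
    cases (σ.client c).activity with
    | idle => exact .idle
    | writing v w rep => exact .writing _ _ _ _ fun _ => rfl
    | reading => exact .reading _ _
  requests c s n := by
    rcases σ.requests c s n with _ | ⟨q, p⟩ | q
    · exact .none
    · exact .write _ _ _ (.inl rfl)
    · exact .read _
  replies := rfl
  crashedServers := rfl
  crashedClients := rfl

theorem ActivitySim.request {k : Prop} {x y : P.Activity} (h : ActivitySim k x y) (s : Fin N) :
    RequestSim k (x.request s) (y.request s) := by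
  cases h with
  | idle => exact .none
  | writing v v' w rep h =>
    refine .write _ _ _ ?_
    cases P.stage w with
    | before => exact .inl rfl
    | after => exact .inl rfl
    | value =>
      by_cases hk : k
      · rw [h hk]; exact .inl rfl
      · exact .inr ⟨hk, rfl, rfl⟩
  | reading => exact .read _

theorem ActivitySim.record {k : Prop} {x y : P.Activity} (h : ActivitySim k x y) (s : Fin N)
    (a : P.Reply) : ActivitySim k (x.record s a) (y.record s a) := by
  cases h with
  | idle => exact .idle
  | writing v v' w rep h => cases a <;> exact .writing _ _ _ _ h
  | reading => cases a <;> exact .reading _ _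

theorem ActivitySim.isWrite_iff {k : Prop} {x y : P.Activity} (h : ActivitySim k x y) :
    x.IsWrite ↔ y.IsWrite := by
  cases h <;> rfl

theorem Sim.writers {D : Set (Fin N)} {K : Set ℕ} {σ τ : P.State} (h : Sim D K σ τ) :
    Protocol.writers σ = Protocol.writers τ :=
  Set.ext fun c => (h.client c).activity.isWrite_iff

theorem Sim.noPayload {D : Set (Fin N)} {K : Set ℕ} {σ τ : P.State} (h : Sim D K σ τ) {c : ℕ}
    (hc : NoPayload c σ) : NoPayload c τ := by
  intro s n q p e
  have hr := h.requests c s n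
  generalize hx : σ.requests c s n = X at hr
  rw [e] at hr
  cases hr with
  | write q p p' hp =>
    rcases hp with rfl | hp
    · exact hc _ _ _ _ hx
    · obtain ⟨p₀, rfl⟩ := Option.isSome_iff_exists.1 hp.2.1
      exact hc _ _ _ _ hx

theorem ClientSim.start {k : Prop} {γ δ : P.ClientState} (h : ClientSim k γ δ) {x y : P.Activity}
    (hx : ActivitySim k x y) : ClientSim k (γ.start x) (δ.start y) where
  activity := hx
  number := by simp [ClientState.start, h.number]
  unsent := by cases hx <;> rfl
  memory := h.memory

theorem Sim.setClient {D : Set (Fin N)} {K : Set ℕ} {σ τ : P.State} (h : Sim D K σ τ) {c : ℕ}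
    {γ δ : P.ClientState} (hγ : ClientSim (c ∈ K) γ δ) :
    Sim D K (σ.setClient c γ) (τ.setClient c δ) where
  metadata := h.metadata
  server := h.server
  client c' := by
    rw [setClient_client, setClient_client]
    split_ifs with e
    · exact e ▸ hγ
    · exact h.client c'
  requests := h.requests
  replies := h.replies
  crashedServers := h.crashedServers
  crashedClients := h.crashedClients

theorem Sim.setRequest {D : Set (Fin N)} {K : Set ℕ} {σ τ : P.State} (h : Sim D K σ τ) {c : ℕ}
    (s : Fin N) (n : ℕ) {q q' : Option P.Request} (hq : RequestSim (c ∈ K) q q') (c' : ℕ)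
    (s' : Fin N) (n' : ℕ) :
    RequestSim (c' ∈ K) (setMessage σ.requests c s n q c' s' n')
      (setMessage τ.requests c s n q' c' s' n') := by
  unfold setMessage
  split_ifs with e
  · exact e.1 ▸ hq
  · exact h.requests _ _ _

theorem writing_of_sim {k : Prop} {x y : P.Activity} (h : ActivitySim k x y) {v : V}
    {w : P.WriteState} {rep : Fin N → Option P.WriteReply} (hx : x = .writing v w rep) :
    ∃ v', y = .writing v' w rep ∧ (k → v = v') := by
  subst hx
  cases h with
  | writing _ v' _ _ h => exact ⟨v', rfl, h⟩

theorem reading_of_sim {k : Prop} {x y : P.Activity} (h : ActivitySim k x y) {r : P.ReadState}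
    {rep : Fin N → Option P.ReadReply} (hx : x = .reading r rep) : y = .reading r rep := by
  subst hx
  cases h
  rfl

theorem idle_of_sim {k : Prop} {x y : P.Activity} (h : ActivitySim k x y) (hx : x = .idle) :
    y = .idle := by
  subst hx
  cases h
  rfl

/-- Equality of actions up to the value of an invoked write, which agrees for clients in `K`. -/
def ActionSim (K : Set ℕ) (a a' : Action N V) : Prop :=
  a = a' ∨ ∃ c v v', c ∉ K ∧ a = .invokeWrite c v ∧ a' = .invokeWrite c v'

theorem ActionSim.symm {K : Set ℕ} {a a' : Action N V} (h : ActionSim K a a') :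
    ActionSim K a' a := by
  rcases h with rfl | ⟨c, v, v', hc, rfl, rfl⟩
  · exact .inl rfl
  · exact .inr ⟨c, v', v, hc, rfl, rfl⟩

/-- The request handled in a step does not reveal the data of the servers in `D` or the values of
the clients outside of `K`: servers in `D` do not handle reads, and payloads of clients outside of
`K` reach only servers in `D`. -/
def Blind (D : Set (Fin N)) (K : Set ℕ) (σ : P.State) (a : Action N V) : Prop :=
  ∀ c s n, a = .serverReceive c s n → s ∉ σ.crashedServers →
    (s ∈ D → ∀ q, σ.requests c s n ≠ some (.inr q)) ∧
    (s ∉ D → c ∉ K → ∀ q p, σ.requests c s n ≠ some (.inl (q, some p)))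

theorem Sim.blind {D : Set (Fin N)} {K : Set ℕ} {σ τ : P.State} (h : Sim D K σ τ)
    {a a' : Action N V} (ha : ActionSim K a a') (hb : Blind D K σ a) : Blind D K τ a' := by
  rintro c s n rfl hs
  rcases ha with rfl | ⟨_, _, _, _, _, ha⟩
  · rw [← h.crashedServers] at hs
    obtain ⟨h1, h2⟩ := hb c s n rfl hs
    have hr := h.requests c s n
    generalize σ.requests c s n = X at hr h1 h2
    refine ⟨fun hD q e => ?_, fun hD hK q p e => ?_⟩
    · rw [e] at hr
      cases hr
      exact h1 hD _ rfl
    · rw [e] at hr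
      cases hr with
      | write q p p' hp =>
        rcases hp with rfl | hp
        · exact h2 hD hK _ _ rfl
        · obtain ⟨p₀, rfl⟩ := Option.isSome_iff_exists.1 hp.2.1
          exact h2 hD hK _ _ rfl
  · cases ha

theorem handle_write (s : Fin N) (q : P.WriteRequest) (p : Option P.Payload)
    (x : P.ServerState) : P.handle s (.inl (q, p)) x =
      (⟨P.writeMeta s x.1 q, P.writeData s x.1 q p x.2⟩, .inl (P.writeReply s x.1 q)) := rfl

theorem Sim.step {D : Set (Fin N)} {K : Set ℕ} {σ τ σ' : P.State} (h : Sim D K σ τ)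
    {a a' : Action N V} (ha : ActionSim K a a') (hb : Blind D K σ a) (st : P.Step a σ σ') :
    ∃ τ', P.Step a' τ τ' ∧ Sim D K σ' τ' := by
  cases st with
  | invokeWrite _ c v hc hx =>
    obtain ⟨v', rfl, hv⟩ : ∃ v', a' = .invokeWrite c v' ∧ (c ∈ K → v = v') := by
      rcases ha with rfl | ⟨c', v₁, v₂, hK, e, rfl⟩
      · exact ⟨v, rfl, fun _ => rfl⟩
      · cases e
        exact ⟨v₂, rfl, fun hc => absurd hc hK⟩
    refine ⟨_, .invokeWrite _ c v' (h.crashedClients ▸ hc)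
      (idle_of_sim (h.client c).activity hx), h.setClient ((h.client c).start ?_)⟩
    rw [(h.client c).memory]
    exact .writing _ _ _ _ hv
  | invokeRead _ c hc hx =>
    obtain rfl : _ = a' := ha.resolve_right (by rintro ⟨_, _, _, _, e, _⟩; cases e)
    exact ⟨_, .invokeRead _ c (h.crashedClients ▸ hc) (idle_of_sim (h.client c).activity hx),
      h.setClient ((h.client c).start (.reading _ _))⟩
  | send _ c s q hc hs hq =>
    obtain rfl : _ = a' := ha.resolve_right (by rintro ⟨_, _, _, _, e, _⟩; cases e)
    have hr := (h.client c).activity.request s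
    obtain ⟨q', hq'⟩ : ∃ q', (τ.client c).activity.request s = some q' := by
      rw [hq] at hr
      generalize (τ.client c).activity.request s = Y at hr
      cases hr with
      | write => exact ⟨_, rfl⟩
      | read => exact ⟨_, rfl⟩
    refine ⟨_, .send _ c s q' (h.crashedClients ▸ hc) ((h.client c).unsent ▸ hs) hq', ?_⟩
    have h1 := h.setClient (c := c)
      (γ := { σ.client c with unsent := (σ.client c).unsent.erase s })
      (δ := { τ.client c with unsent := (τ.client c).unsent.erase s })
      ⟨(h.client c).activity, (h.client c).number, by simp [(h.client c).unsent],
        (h.client c).memory⟩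
    refine ⟨h1.metadata, h1.server, h1.client, ?_, h1.replies, h1.crashedServers,
      h1.crashedClients⟩
    change ∀ c' s' n', RequestSim (c' ∈ K) (setMessage σ.requests c s _ _ c' s' n')
      (setMessage τ.requests c s _ _ c' s' n')
    rw [hq, hq'] at hr
    rw [(h.client c).number]
    exact h.setRequest s _ hr
  | serverReceive _ c s n q hs hq =>
    obtain rfl : _ = a' := ha.resolve_right (by rintro ⟨_, _, _, _, e, _⟩; cases e)
    have hr := h.requests c s n
    obtain ⟨h1, h2⟩ := hb c s n rfl hs
    rw [hq] at hr h1 h2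
    obtain ⟨q', hq'⟩ : ∃ q', τ.requests c s n = some q' := by
      generalize τ.requests c s n = Y at hr
      cases hr with
      | write => exact ⟨_, rfl⟩
      | read => exact ⟨_, rfl⟩
    rw [hq'] at hr
    have key : (P.handle s q (σ.server s)).2 = (P.handle s q' (τ.server s)).2 ∧
        (P.handle s q (σ.server s)).1.1 = (P.handle s q' (τ.server s)).1.1 ∧
        (s ∉ D → (P.handle s q (σ.server s)).1 = (P.handle s q' (τ.server s)).1) := by
      have hm := h.metadata s
      cases hr with
      | write q p p' hp =>
        rw [handle_write, handle_write]
        refine ⟨congrArg (fun μ => Sum.inl (P.writeReply s μ q)) hm,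
          congrArg (fun μ => P.writeMeta s μ q) hm, fun hD => ?_⟩
        have hpp : p = p' := by
          rcases hp with rfl | ⟨hk, hp, -⟩
          · rfl
          · obtain ⟨p₀, rfl⟩ := Option.isSome_iff_exists.1 hp
            exact absurd rfl (h2 hD hk _ _)
        rw [h.server s hD, hpp]
      | read q =>
        have hD : s ∉ D := fun hD => h1 hD q rfl
        rw [h.server s hD]
        exact ⟨rfl, rfl, fun _ => rfl⟩
    refine ⟨_, .serverReceive _ c s n q' (h.crashedServers ▸ hs) hq', ?_⟩
    constructor
    · intro s'
      simp only [Function.update_apply]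
      split_ifs with e
      · exact key.2.1
      · exact h.metadata s'
    · intro s' hs'
      simp only [Function.update_apply]
      split_ifs with e
      · exact key.2.2 (e ▸ hs')
      · exact h.server s' hs'
    · exact h.client
    · exact h.setRequest s n .none
    · simp only [h.replies, key.1]
    · exact h.crashedServers
    · exact h.crashedClients
  | clientReceive _ c s n a hc ha' =>
    obtain rfl : _ = a' := ha.resolve_right (by rintro ⟨_, _, _, _, e, _⟩; cases e)
    refine ⟨_, .clientReceive _ c s n a (h.crashedClients ▸ hc) (h.replies ▸ ha'), ?_⟩
    have h1 := h.setClient (c := c)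
      (γ := { σ.client c with activity := if n = (σ.client c).number then
        (σ.client c).activity.record s a else (σ.client c).activity })
      (δ := { τ.client c with activity := if n = (τ.client c).number then
        (τ.client c).activity.record s a else (τ.client c).activity })
      ⟨by
        simp only [(h.client c).number]
        split_ifs
        · exact (h.client c).activity.record s a
        · exact (h.client c).activity, (h.client c).number, (h.client c).unsent,
        (h.client c).memory⟩
    exact ⟨h1.metadata, h1.server, h1.client, h1.requests, by simp only [h.replies],
      h1.crashedServers, h1.crashedClients⟩
  | nextWrite _ c v w w' rep hc hx hu hw =>
    obtain rfl : _ = a' := ha.resolve_right (by rintro ⟨_, _, _, _, e, _⟩; cases e)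
    obtain ⟨v', hx', hv⟩ := writing_of_sim (h.client c).activity hx
    exact ⟨_, .nextWrite _ c v' w w' rep (h.crashedClients ▸ hc) hx' ((h.client c).unsent ▸ hu) hw,
      h.setClient ((h.client c).start (.writing _ _ _ _ hv))⟩
  | returnWrite _ c v w l rep hc hx hu hw =>
    obtain rfl : _ = a' := ha.resolve_right (by rintro ⟨_, _, _, _, e, _⟩; cases e)
    obtain ⟨v', hx', hv⟩ := writing_of_sim (h.client c).activity hx
    exact ⟨_, .returnWrite _ c v' w l rep (h.crashedClients ▸ hc) hx' ((h.client c).unsent ▸ hu) hw,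
      h.setClient ⟨.idle, (h.client c).number, (h.client c).unsent, rfl⟩⟩
  | nextRead _ c r r' rep hc hx hu hr =>
    obtain rfl : _ = a' := ha.resolve_right (by rintro ⟨_, _, _, _, e, _⟩; cases e)
    exact ⟨_, .nextRead _ c r r' rep (h.crashedClients ▸ hc)
      (reading_of_sim (h.client c).activity hx) ((h.client c).unsent ▸ hu) hr,
      h.setClient ((h.client c).start (.reading _ _))⟩
  | returnRead _ c v r rep hc hx hu hr =>
    obtain rfl : _ = a' := ha.resolve_right (by rintro ⟨_, _, _, _, e, _⟩; cases e)
    exact ⟨_, .returnRead _ c v r rep (h.crashedClients ▸ hc)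
      (reading_of_sim (h.client c).activity hx) ((h.client c).unsent ▸ hu) hr,
      h.setClient ⟨.idle, (h.client c).number, (h.client c).unsent, (h.client c).memory⟩⟩
  | crashServer _ s =>
    obtain rfl : _ = a' := ha.resolve_right (by rintro ⟨_, _, _, _, e, _⟩; cases e)
    exact ⟨_, .crashServer _ s, h.metadata, h.server, h.client, h.requests, h.replies,
      by simp only [h.crashedServers], h.crashedClients⟩
  | crashClient _ c =>
    obtain rfl : _ = a' := ha.resolve_right (by rintro ⟨_, _, _, _, e, _⟩; cases e)
    exact ⟨_, .crashClient _ c, h.metadata, h.server, h.client, h.requests, h.replies,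
      h.crashedServers, by simp only [h.crashedClients]⟩
  | stutter =>
    obtain rfl : _ = a' := ha.resolve_right (by rintro ⟨_, _, _, _, e, _⟩; cases e)
    exact ⟨_, .stutter _, h⟩

theorem Sim.enabled_iff {D : Set (Fin N)} {K : Set ℕ} {σ τ : P.State} (h : Sim D K σ τ)
    {a a' : Action N V} (ha : ActionSim K a a') (hb : Blind D K σ a) :
    (∃ σ', P.Step a σ σ') ↔ ∃ τ', P.Step a' τ τ' := by
  constructor
  · rintro ⟨σ', st⟩
    obtain ⟨τ', st', -⟩ := h.step ha hb st
    exact ⟨τ', st'⟩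
  · rintro ⟨τ', st⟩
    obtain ⟨σ', st', -⟩ := h.symm.step ha.symm (h.blind ha hb) st
    exact ⟨σ', st'⟩

theorem Sim.exec {D : Set (Fin N)} {K : Set ℕ} {σ τ : P.State} (h : Sim D K σ τ)
    {a a' : Action N V} (ha : ActionSim K a a') (hb : Blind D K σ a) :
    Sim D K (Protocol.exec a σ) (Protocol.exec a' τ) := by
  by_cases hx : ∃ σ', P.Step a σ σ'
  · obtain ⟨σ', st⟩ := hx
    obtain ⟨τ', st', h'⟩ := h.step ha hb st
    rwa [exec_of_step st, exec_of_step st']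
  · rw [exec_of_not_enabled hx, exec_of_not_enabled ((h.enabled_iff ha hb).not.1 hx)]
    exact h

/-- Replacing the values of the invoked writes by those prescribed by `x`. -/
def assign (x : ℕ → V) : Action N V → Action N V
  | .invokeWrite c _ => .invokeWrite c (x c)
  | a => a

theorem assign_of_noWrite {x : ℕ → V} {a : Action N V} (h : a.NoWrite) : assign x a = a := by
  cases a with
  | invokeWrite c v => exact absurd rfl (h c v)
  | _ => rfl

theorem map_assign_of_noWrite {x : ℕ → V} {l : List (Action N V)} (h : ∀ a ∈ l, a.NoWrite) :
    l.map (assign x) = l := by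
  rw [List.map_congr_left fun a ha => assign_of_noWrite (h a ha)]
  simp

theorem assign_eq_iff {x : ℕ → V} {a b : Action N V} (hb : b.NoWrite) :
    assign x a = b ↔ a = b := by
  cases a with
  | invokeWrite c v =>
    simp only [assign]
    exact ⟨fun h => absurd h.symm (hb _ _), fun h => absurd h.symm (hb _ _)⟩
  | _ => rfl

theorem actionSim_assign {K : Set ℕ} {x x' : ℕ → V} (h : ∀ c ∈ K, x c = x' c)
    (a : Action N V) : ActionSim K (assign x a) (assign x' a) := by
  cases a with
  | invokeWrite c v =>
    by_cases hc : c ∈ K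
    · left; simp [assign, h c hc]
    · exact .inr ⟨c, _, _, hc, rfl, rfl⟩
  | _ => exact .inl rfl

/-- Blindness of all steps of a run. -/
def BlindRun (D : Set (Fin N)) (K : Set ℕ) (σ : P.State) (l : List (Action N V)) : Prop :=
  ∀ l₁ a l₂, l = l₁ ++ a :: l₂ → Blind D K (run σ l₁) a

theorem Sim.run {D : Set (Fin N)} {K : Set ℕ} {x x' : ℕ → V} (hx : ∀ c ∈ K, x c = x' c)
    {l : List (Action N V)} {σ τ : P.State} (h : Sim D K σ τ)
    (hb : BlindRun D K σ (l.map (assign x))) :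
    Sim D K (Protocol.run σ (l.map (assign x))) (Protocol.run τ (l.map (assign x'))) := by
  induction l generalizing σ τ with
  | nil => exact h
  | cons a l ih =>
    refine ih (h.exec (actionSim_assign hx a) (hb [] _ _ rfl)) fun l₁ b l₂ e => ?_
    exact hb (assign x a :: l₁) b l₂ (by simp [e])

/-- Without reads, the metadata and the control flow do not depend on the values. -/
theorem noReads_sim {σ τ : P.State} (h : Sim Set.univ ∅ σ τ) (hr : NoReads σ)
    {l : List (Action N V)} (hl : ∀ a ∈ l, a.NoRead) (x x' : ℕ → V) :
    Sim Set.univ ∅ (run σ (l.map (assign x))) (run τ (l.map (assign x'))) := by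
  refine h.run (by simp) fun l₁ a l₂ e c s n _ _ => ⟨fun _ q => ?_, by simp⟩
  refine (run_preserves hr fun b hb _ _ h st => step_noReads ?_ h st).2 _ _ _ _
  have hb₁ : b ∈ l.map (assign x) := by rw [e]; simp [hb]
  obtain ⟨b', hb₂, rfl⟩ := List.mem_map.1 hb₁
  rintro c e'
  exact hl b' hb₂ c ((assign_eq_iff (by rintro _ _ ⟨⟩)).1 e')

/-! ### Operations in executions -/

theorem isWrite_iff_exists {x : P.Activity} : x.IsWrite ↔ ∃ v w rep, x = .writing v w rep := by
  cases x <;> simp [Activity.IsWrite]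

theorem Execution.idle_of_response {e : P.Execution} {j c : ℕ} (h : e.ResponseAt j c) :
    ((e.state (j + 1)).client c).activity = .idle := by
  have st := e.step j
  rcases h with h | ⟨v, h⟩ <;>
  · rw [h] at st
    generalize e.state (j + 1) = τ at st
    cases st
    simp [setClient_client]

/-- A write stays in progress until its response. -/
theorem Execution.isWrite_of_no_response {e : P.Execution} {i c n : ℕ} {v : V}
    (hi : e.action i = .invokeWrite c v) (hn : ∀ l, i < l → l < n → ¬ e.ResponseAt l c) (him : i < n) :
    c ∈ writers (e.state n) := by
  induction n, him using Nat.le_induction with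
  | base =>
    have st := e.step i
    rw [hi] at st
    change ((e.state (i + 1)).client c).activity.IsWrite
    generalize e.state (i + 1) = τ at st
    cases st
    simp [setClient_client, ClientState.start, Activity.IsWrite]
  | succ n hin ih =>
    have h1 : ((e.state n).client c).activity.IsWrite := ih fun l h1 h2 => hn l h1 (by omega)
    have h2 := hn n hin (by omega)
    obtain ⟨v₀, w₀, rep₀, hx₀⟩ := isWrite_iff_exists.1 h1
    change ((e.state (n + 1)).client c).activity.IsWrite
    have st := e.step n
    unfold Execution.ResponseAt at h2
    generalize e.state (n + 1) = τ at st
    generalize e.state n = σ at st h1 hx₀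
    generalize e.action n = a at st h2
    cases st with
    | send _ c' s q hc hs hq =>
      change ((σ.setClient c' _).client c).activity.IsWrite
      rw [setClient_client]; split_ifs with ec
      · exact ec ▸ h1
      · exact h1
    | clientReceive _ c' s n q hs hq =>
      change ((σ.setClient c' _).client c).activity.IsWrite
      rw [setClient_client]
      by_cases ec : c = c'
      · subst ec
        rw [if_pos rfl]
        simp only
        split_ifs
        · rwa [Activity.record_isWrite]
        · exact h1
      · rwa [if_neg ec]
    | nextWrite _ c' v w w' rep hc hx hu hw =>
      rw [setClient_client]; split_ifs with ec
      · trivial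
      · exact h1
    | invokeWrite _ c' v' hc hx =>
      rw [setClient_client]; split_ifs with ec
      · trivial
      · exact h1
    | invokeRead _ c' hc hx =>
      rw [setClient_client]; split_ifs with ec
      · subst ec; simp [hx] at hx₀
      · exact h1
    | nextRead _ c' r r' rep hc hx =>
      rw [setClient_client]; split_ifs with ec
      · subst ec; simp [hx] at hx₀
      · exact h1
    | returnWrite _ c' v w l rep hc hx hu hw =>
      rw [setClient_client]; split_ifs with ec
      · subst ec; exact absurd (.inl rfl) h2
      · exact h1
    | returnRead _ c' v r rep hc hx hu hr =>
      rw [setClient_client]; split_ifs with ec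
      · subst ec; exact absurd (.inr ⟨_, rfl⟩) h2
      · exact h1
    | _ => exact h1

/-- A read in progress has been invoked, and it has not returned since. -/
theorem Execution.exists_invokeRead {e : P.Execution} {n c : ℕ} {r : P.ReadState}
    {rep : Fin N → Option P.ReadReply} (h : ((e.state n).client c).activity = .reading r rep) :
    ∃ i, i < n ∧ e.action i = .invokeRead c ∧
      ∀ m, i < m → m ≤ n → ((e.state m).client c).activity ≠ .idle := by
  induction n generalizing r rep with
  | zero => simp [e.init, initialState] at h
  | succ n ih =>
    have key : e.action n = .invokeRead c ∨
        ∃ r rep, ((e.state n).client c).activity = .reading r rep := by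
      have st := e.step n
      generalize e.state (n + 1) = τ at st h
      generalize e.state n = σ at st
      generalize e.action n = a at st
      cases st with
      | send _ c' s q hc hs hq =>
        change ((σ.setClient c' _).client c).activity = _ at h
        rw [setClient_client] at h; split_ifs at h with ec
        · subst ec; exact .inr ⟨_, _, h⟩
        · exact .inr ⟨_, _, h⟩
      | clientReceive _ c' s n q hs hq =>
        change ((σ.setClient c' _).client c).activity = _ at h
        rw [setClient_client] at h
        by_cases ec : c = c'
        · subst ec
          rw [if_pos rfl] at h
          simp only at h
          split_ifs at h
          · obtain ⟨rep', h'⟩ := Activity.record_eq_reading h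
            exact .inr ⟨_, _, h'⟩
          · exact .inr ⟨_, _, h⟩
        · rw [if_neg ec] at h
          exact .inr ⟨_, _, h⟩
      | invokeRead _ c' hc hx =>
        rw [setClient_client] at h; split_ifs at h with ec
        · subst ec; exact .inl rfl
        · exact .inr ⟨_, _, h⟩
      | nextRead _ c' r r' rep hc hx =>
        rw [setClient_client] at h; split_ifs at h with ec
        · subst ec; exact .inr ⟨_, _, hx⟩
        · exact .inr ⟨_, _, h⟩
      | invokeWrite _ c' | nextWrite _ c' =>
        rw [setClient_client] at h; split_ifs at h with ec
        · simp [ClientState.start] at h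
        · exact .inr ⟨_, _, h⟩
      | returnWrite _ c' | returnRead _ c' =>
        rw [setClient_client] at h; split_ifs at h with ec
        exact .inr ⟨_, _, h⟩
      | _ => exact .inr ⟨_, _, h⟩
    rcases key with hi | ⟨r', rep', h'⟩
    · refine ⟨n, by omega, hi, fun m h1 h2 => ?_⟩
      obtain rfl : m = n + 1 := by omega
      simp [h]
    · obtain ⟨i, hi, hia, hm⟩ := ih h'
      refine ⟨i, by omega, hia, fun m h1 h2 => ?_⟩
      rcases Nat.lt_or_ge m (n + 1) with h3 | h3
      · exact hm m h1 (by omega)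
      · obtain rfl : m = n + 1 := by omega
        simp [h]

theorem Execution.readReturns_of_action {e : P.Execution} {j c : ℕ} {v : V}
    (h : e.action j = .returnRead c v) :
    ∃ i, i < j ∧ e.action i = .invokeRead c ∧
      (∀ m, i < m → m ≤ j → ((e.state m).client c).activity ≠ .idle) ∧ e.ReadReturns i v := by
  have hx : ∃ r rep, ((e.state j).client c).activity = .reading r rep := by
    have st := e.step j
    rw [h] at st
    generalize e.state (j + 1) = τ at st
    cases st with
    | returnRead _ c v r rep hc hx => exact ⟨r, rep, hx⟩
  obtain ⟨r, rep, hx⟩ := hx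
  obtain ⟨i, hij, hi, hm⟩ := e.exists_invokeRead hx
  refine ⟨i, hij, hi, hm, c, j, hi, ⟨c, .inl hi, hij, .inr ⟨v, h⟩, fun l h1 h2 h3 => ?_⟩, h⟩
  exact hm (l + 1) (by omega) (by omega) (e.idle_of_response h3)

theorem Execution.exists_terminates {e : P.Execution} {i j c : ℕ} (hi : e.InvokedBy i c)
    (hij : i < j) (hj : e.ResponseAt j c) : ∃ l, l ≤ j ∧ e.Terminates i l := by
  classical
  have hex : ∃ l, i < l ∧ e.ResponseAt l c := ⟨j, hij, hj⟩
  refine ⟨Nat.find hex, Nat.find_min' hex ⟨hij, hj⟩, c, hi, (Nat.find_spec hex).1,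
    (Nat.find_spec hex).2, fun l h1 h2 h3 => Nat.find_min hex h2 ⟨h1, h3⟩⟩

/-- If no write is invoked after the invocation of a read, then the read is concurrent with at most
those writes that are in progress when it is invoked. -/
theorem Execution.concurrent_encard_le {e : P.Execution} {i c : ℕ}
    (hi : e.action i = .invokeRead c) (hw : ∀ l, i < l → ∀ v, ¬ e.WriteAt l v) :
    {w : ℕ | (∃ v, e.WriteAt w v) ∧ e.Concurrent w i}.encard ≤ (writers (e.state i)).encard := by
  classical
  have key : ∀ w ∈ {w : ℕ | (∃ v, e.WriteAt w v) ∧ e.Concurrent w i}, ∃ d v,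
      e.action w = .invokeWrite d v ∧ w < i ∧ ∀ l, w < l → l < i → ¬ e.ResponseAt l d := by
    rintro w ⟨⟨v, d, hd⟩, hc, -⟩
    have hwi : w < i := by
      rcases lt_trichotomy w i with h | h | h
      · exact h
      · subst h; rw [hi] at hd; cases hd
      · exact absurd ⟨d, hd⟩ (hw w h v)
    refine ⟨d, v, hd, hwi, fun l h1 h2 h3 => hc ?_⟩
    obtain ⟨l', hl', ht⟩ := e.exists_terminates (.inr ⟨v, hd⟩) h1 h3
    exact ⟨l', by omega, ht⟩
  let g : ℕ → ℕ := fun w => if h : ∃ d v, e.action w = .invokeWrite d v then h.choose else 0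
  have hg : ∀ w d v, e.action w = .invokeWrite d v → g w = d := by
    intro w d v h
    have hex : ∃ d v, e.action w = .invokeWrite d v := ⟨d, v, h⟩
    simp only [g, dif_pos hex]
    obtain ⟨v', hv'⟩ := hex.choose_spec
    have h' := h.symm.trans hv'
    simp only [Action.invokeWrite.injEq] at h'
    exact h'.1.symm
  have hidle : ∀ w d v, e.action w = .invokeWrite d v → d ∉ writers (e.state w) := by
    intro w d v h
    have st := e.step w
    rw [h] at st
    generalize e.state (w + 1) = τ at st
    cases st with
    | invokeWrite _ _ _ _ hx => simp [writers, hx, Activity.IsWrite]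
  refine Set.encard_le_encard_of_injOn (f := g) (fun w hw => ?_) fun w hw w' hw' h => ?_
  · obtain ⟨d, v, hd, hwi, hn⟩ := key w hw
    rw [hg w d v hd]
    exact e.isWrite_of_no_response hd hn hwi
  · obtain ⟨d, v, hd, hwi, hn⟩ := key w hw
    obtain ⟨d', v', hd', hwi', hn'⟩ := key w' hw'
    rw [hg w d v hd, hg w' d' v' hd'] at h
    subst h
    rcases lt_trichotomy w w' with h | h | h
    · exact absurd (e.isWrite_of_no_response hd (fun l h1 h2 => hn l h1 (by omega)) h)
        (hidle _ _ _ hd')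
    · exact h
    · exact absurd (e.isWrite_of_no_response hd' (fun l h1 h2 => hn' l h1 (by omega)) h)
        (hidle _ _ _ hd)

/-- A read that follows a terminated write `i` returns the value of a write that did not terminate
before `i`. -/
theorem Execution.IsAtomic.read_value {e : P.Execution} (h : e.IsAtomic) {i j r : ℕ} {u v : V}
    (hi : e.WriteAt i u) (hij : e.Terminates i j) (hjr : j ≤ r) (hr : e.ReadReturns r v) :
    ∃ w, e.WriteAt w v ∧ ∀ l, e.Terminates w l → i < l := by
  obtain ⟨L, point, -, -, hlow, hterm, hread⟩ := h
  obtain ⟨hiL, hpi⟩ := hterm i j hij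
  have hrL : r ∈ L := by
    obtain ⟨c, j', -, ht, -⟩ := hr
    exact (hterm r j' ht).1
  have hir : point i < point r := by
    have := hlow r hrL
    have h2 : (j : ℝ) ≤ r := by exact_mod_cast hjr
    linarith
  rcases hread r v hr with ⟨w, hwL, hwv, hwr, hmax⟩ | ⟨-, hno⟩
  · refine ⟨w, hwv, fun l hl => ?_⟩
    have h1 := (hterm w l hl).2
    have h2 := hmax i hiL u hi hir
    have h3 := hlow i hiL
    have : (i : ℝ) < l := by linarith
    exact_mod_cast this
  · exact absurd hir (hno i hiL u hi)

/-! ### Histories of one terminated write and several later ones -/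

/-- Up to time `T` client `0` writes `x 0`; after the response the clients `1, …, m - 1` invoke
writes of the values prescribed by `x`; no other writes are ever invoked. -/
structure History (x : ℕ → V) (m T : ℕ) (e : P.Execution) : Prop where
  first : e.action 0 = .invokeWrite 0 (x 0)
  returned : ∃ j, 0 < j ∧ j < T ∧ e.action j = .returnWrite 0 ∧
    ∀ i c v, e.action i = .invokeWrite c v → i = 0 ∨ j < i ∧ i < T ∧ 1 ≤ c ∧ c < m ∧ v = x c
  invoked : ∀ c, 1 ≤ c → c < m → ∃ i, i < T ∧ e.action i = .invokeWrite c (x c)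

theorem History.read_value {x : ℕ → V} {m T : ℕ} {e : P.Execution} (h : History x m T e)
    (ha : e.IsAtomic) {r : ℕ} {v : V} (hr : e.ReadReturns r v) (hT : T ≤ r) (hm : 1 ≤ m) :
    ∃ c, c < m ∧ v = x c := by
  obtain ⟨j, hj0, hjT, hj, hi⟩ := h.returned
  obtain ⟨l, hl, ht⟩ := e.exists_terminates (.inr ⟨_, h.first⟩) hj0 (.inl hj)
  obtain ⟨w, ⟨c, hw⟩, -⟩ := ha.read_value ⟨0, h.first⟩ ht (by omega) hr
  rcases hi w c v hw with rfl | ⟨-, -, -, h4, h5⟩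
  · have := h.first
    rw [hw] at this
    simp only [Action.invokeWrite.injEq] at this
    exact ⟨0, by omega, this.2⟩
  · exact ⟨c, h4, h5⟩

/-- After the termination of one of the later writes the first value is not returned any more. -/
theorem History.read_value_of_terminates {x : ℕ → V} {m T : ℕ} {e : P.Execution}
    (h : History x m T e) (ha : e.IsAtomic) {i c j r : ℕ} {u v : V}
    (hi : e.action i = .invokeWrite c u) (hi0 : i ≠ 0) (hij : e.Terminates i j) (hjr : j ≤ r)
    (hr : e.ReadReturns r v) : ∃ c, 1 ≤ c ∧ c < m ∧ v = x c := by
  obtain ⟨j₀, hj0, hjT, hj, hinv⟩ := h.returned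
  obtain ⟨l, hl, ht⟩ := e.exists_terminates (.inr ⟨_, h.first⟩) hj0 (.inl hj)
  obtain ⟨w, ⟨d, hw⟩, hwt⟩ := ha.read_value ⟨c, hi⟩ hij hjr hr
  have h1 := (hinv i c u hi).resolve_left hi0
  rcases hinv w d v hw with rfl | ⟨-, -, h3, h4, h5⟩
  · have := hwt l ht
    omega
  · exact ⟨d, h3, h4, h5⟩

theorem execution_action_noWrite {l : List (Action N V)} {as : ℕ → Action N V}
    (h : ∀ n, (as n).NoWrite) {i c : ℕ} {v : V}
    (hi : (P.execution (extend l as)).action i = .invokeWrite c v) : i < l.length := by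
  by_contra hn
  have := (execution_action_eq hi (by simp)).1
  unfold extend at this
  rw [dif_neg hn] at this
  exact h _ c v this

theorem extend_append_noWrite {l : List (Action N V)} {as : ℕ → Action N V}
    (h : ∀ n, (as n).NoWrite) {l' : List (Action N V)} (h' : ∀ a ∈ l', a.NoWrite) {i c : ℕ} {v : V}
    (hi : (P.execution (extend (l ++ l') as)).action i = .invokeWrite c v) : i < l.length := by
  by_contra hn
  have h1 := execution_action_noWrite h hi
  have h2 := (execution_action_eq hi (by simp)).1
  rw [extend_of_lt h1, List.getElem_append_right (by omega)] at h2
  exact h' _ (List.getElem_mem _) c v h2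

theorem History.extend {x : ℕ → V} {m T : ℕ} {l l₁ l₂ : List (Action N V)} {as bs : ℕ → Action N V}
    (h : History x m T (P.execution (Protocol.extend (l ++ l₁) as))) (hT : T ≤ l.length)
    (hl : ∀ a ∈ l₂, a.NoWrite) (hb : ∀ n, (bs n).NoWrite) :
    History x m T (P.execution (Protocol.extend (l ++ l₂) bs)) := by
  have key : ∀ n, n < l.length → (P.execution (Protocol.extend (l ++ l₂) bs)).action n =
      (P.execution (Protocol.extend (l ++ l₁) as)).action n := fun n hn =>
    execution_extend_action l l₂ l₁ bs as hn
  obtain ⟨j, hj0, hjT, hj, hinv⟩ := h.returned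
  refine ⟨?_, ⟨j, hj0, hjT, ?_, fun i c v hi => ?_⟩, fun c h1 h2 => ?_⟩
  · rw [key 0 (by omega)]; exact h.first
  · rw [key j (by omega)]; exact hj
  · have hil := extend_append_noWrite hb hl hi
    rw [key i hil] at hi
    exact hinv i c v hi
  · obtain ⟨i, hi, hia⟩ := h.invoked c h1 h2
    exact ⟨i, hi, by rw [key i (by omega)]; exact hia⟩

/-- Doing nothing for ever. -/
def idleSchedule (N : ℕ) (V : Type) : ℕ → Action N V := fun _ => .stutter

theorem idleSchedule_controlled (n : ℕ) :
    (idleSchedule N V n).IsControlled ∨ idleSchedule N V n = .stutter := .inr rfl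

/-- The execution that consists of a list of actions. -/
noncomputable def finiteExecution (P : Protocol N V) (l : List (Action N V)) : P.Execution :=
  P.execution (extend l (idleSchedule N V))

/-- A finite run with the history described above, fewer than `ν` writes in progress at every
point, and at most `f` server crashes. -/
structure Valid (P : Protocol N V) (f ν : ℕ) (x : ℕ → V) (m : ℕ) (l : List (Action N V)) :
    Prop where
  history : History x m l.length (P.finiteExecution l)
  bounded : Always (fun σ => (writers σ).encard < ν) P.initialState l
  crashes : (run P.initialState l).crashedServers.encard ≤ f

theorem bounded_extend {ν : ℕ} {l : List (Action N V)}
    (h : Always (fun σ => (writers σ).encard < ν) P.initialState l) {as : ℕ → Action N V}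
    (has : ∀ n, (as n).NoWrite) : (P.execution (extend l as)).BoundedConcurrency ν := by
  refine trajectory_extend_of_always h fun n => ?_
  rw [run_append]
  refine lt_of_le_of_lt (Set.encard_le_encard (run_writers fun a ha => ?_)) h.last
  obtain ⟨k, -, rfl⟩ := mem_initial.1 ha
  exact has k

theorem crashes_extend {f : ℕ} {l : List (Action N V)}
    (h : (run P.initialState l).crashedServers.encard ≤ f) {as : ℕ → Action N V}
    (has : ∀ n, (as n).NoCrash) : (P.execution (extend l as)).BoundedFailures f := by
  refine trajectory_extend_of_always (p := fun σ => σ.crashedServers.encard ≤ f) ?_ fun n => ?_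
  · rintro l₁ l₂ rfl
    rw [run_append] at h
    exact (Set.encard_le_encard (subset_run_crashedServers _ _)).trans h
  · rw [run_append, run_crashedServers fun a ha => ?_]
    · exact h
    · obtain ⟨k, -, rfl⟩ := mem_initial.1 ha
      exact has k

theorem Valid.append {f ν m : ℕ} {x : ℕ → V} {l l' : List (Action N V)} (h : P.Valid f ν x m l)
    (hl : ∀ a ∈ l', a.NoWrite)
    (hc : (run P.initialState (l ++ l')).crashedServers.encard ≤ f) :
    P.Valid f ν x m (l ++ l') where
  history := by
    have h1 : History x m l.length (P.execution (extend (l ++ []) (idleSchedule N V))) := by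
      rw [List.append_nil]; exact h.history
    have h2 := h1.extend le_rfl hl fun n => Action.IsControlled.noWrite (idleSchedule_controlled n)
    obtain ⟨j, hj0, hjT, hj, hinv⟩ := h2.returned
    refine ⟨h2.first, ⟨j, hj0, by simp; omega, hj, fun i c v hi => ?_⟩, fun c h1 h3 => ?_⟩
    · refine (hinv i c v hi).imp id fun h => ⟨h.1, ?_, h.2.2⟩
      have := h.2.1
      simp; omega
    · obtain ⟨i, hi, hia⟩ := h2.invoked c h1 h3
      exact ⟨i, by simp; omega, hia⟩
  bounded := h.bounded.append (always_preserves h.bounded.last fun a ha σ τ hσ st =>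
    lt_of_le_of_lt (Set.encard_le_encard fun c hc => by
      by_contra hn
      exact step_not_isWrite (fun v => hl a ha c v) hn st hc) hσ)
  crashes := hc

theorem Valid.isAtomic {f ν m : ℕ} {x : ℕ → V} {l : List (Action N V)} (h : P.Valid f ν x m l)
    (hP : P.EmulatesAtomic f ν) : (P.finiteExecution l).IsAtomic :=
  hP _ (bounded_extend h.bounded fun n => Action.IsControlled.noWrite (idleSchedule_controlled n))
    (crashes_extend h.crashes fun n => Action.IsControlled.noCrash (idleSchedule_controlled n))

/-- A read that is able to return `v` after the run `l ++ l'`, where no read was in progress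
after `l`, has been invoked in `l'`; one may let it return. -/
theorem readReturns_of_enabled {l l' : List (Action N V)}
    (hr : NoReads (run P.initialState l)) {c : ℕ} {v : V}
    (hv : ∃ τ, P.Step (.returnRead c v) (run P.initialState (l ++ l')) τ) :
    ∃ r, l.length ≤ r ∧ (P.finiteExecution (l ++ (l' ++ [.returnRead c v]))).ReadReturns r v := by
  set e := P.finiteExecution (l ++ (l' ++ [.returnRead c v])) with he
  have hst : e.state (l ++ l').length = run P.initialState (l ++ l') := by
    have := trajectory_extend P.initialState (l ++ l') [.returnRead c v] (idleSchedule N V)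
    rwa [List.append_assoc] at this
  have hact : extend (l ++ (l' ++ [Action.returnRead c v])) (idleSchedule N V) (l ++ l').length =
      .returnRead c v := by
    rw [← List.append_assoc, extend_of_lt (by simp)]
    simp
  have hj : e.action (l ++ l').length = .returnRead c v := by
    rw [← hact]
    refine execution_action_of_enabled ?_
    rw [hact]
    change ∃ τ, P.Step _ (e.state (l ++ l').length) τ
    rw [hst]
    exact hv
  obtain ⟨i, hij, hi, hm, hret⟩ := e.readReturns_of_action hj
  refine ⟨i, ?_, hret⟩
  by_contra hlt
  push Not at hlt
  -- otherwise the read would be in progress after `l`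
  have hx : ∃ r rep, ((e.state (l.length)).client c).activity = .reading r rep := by
    have hmono : ∀ n, i < n → n ≤ (l ++ l').length →
        ∃ r rep, ((e.state n).client c).activity = .reading r rep := by
      intro n hn
      induction n, hn using Nat.le_induction with
      | base =>
        intro _
        have st := e.step i
        rw [hi] at st
        generalize e.state (i + 1) = τ at st
        cases st
        exact ⟨_, _, by simp [setClient_client, ClientState.start]; exact ⟨rfl, rfl⟩⟩
      | succ n hn ih =>
        intro hle
        have hni := hm (n + 1) (by omega) hle
        have hnw : c ∉ writers (e.state (n + 1)) := by
          obtain ⟨r, rep, hx⟩ := ih (by omega)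
          refine step_not_isWrite (fun v hv => ?_) ?_ (e.step n)
          · have st := e.step n
            rw [hv] at st
            generalize e.state (n + 1) = τ at st
            cases st with
            | invokeWrite _ _ _ _ hy => simp [hx] at hy
          · simp [hx, Activity.IsWrite]
        cases hy : ((e.state (n + 1)).client c).activity with
        | idle => exact absurd hy hni
        | writing v w rep => exact absurd (by simp [writers, hy, Activity.IsWrite]) hnw
        | reading r rep => exact ⟨r, rep, rfl⟩
    exact hmono _ hlt (by simp)
  obtain ⟨r, rep, hx⟩ := hx
  have : e.state l.length = run P.initialState l :=
    trajectory_extend P.initialState l (l' ++ [Action.returnRead c v]) (idleSchedule N V)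
  rw [this] at hx
  exact hr.1 _ _ _ hx

/-- The values that a read invoked from now on may return if at most `f` servers are crashed
altogether, no further writes are invoked, and servers receive values from clients in `K` only. -/
def returnable (f : ℕ) (K : Set ℕ) (σ : P.State) : Set V :=
  {v | ∃ l, (∀ a ∈ l, a.NoWrite) ∧ BlindRun ∅ K σ l ∧ (run σ l).crashedServers.encard ≤ f ∧
    ∃ c τ, P.Step (.returnRead c v) (run σ l) τ}

theorem returnRead_valid {f ν m : ℕ} {x : ℕ → V} {l l' : List (Action N V)}
    (h : P.Valid f ν x m l) (hl : ∀ a ∈ l', a.NoWrite)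
    (hc : (run P.initialState (l ++ l')).crashedServers.encard ≤ f) {c : ℕ} {v : V} :
    P.Valid f ν x m (l ++ (l' ++ [.returnRead c v])) := by
  refine h.append (fun a ha => ?_) ?_
  · rcases List.mem_append.1 ha with ha | ha
    · exact hl a ha
    · rw [List.mem_singleton.1 ha]; rintro _ _ ⟨⟩
  · rw [← List.append_assoc, run_append, run_crashedServers (l := [_])]
    · exact hc
    · intro a ha
      rw [List.mem_singleton.1 ha]; rintro _ ⟨⟩

/-- Reads return values that have been written. -/
theorem Valid.returnable_subset {f ν m : ℕ} {x : ℕ → V} {l : List (Action N V)}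
    (h : P.Valid f ν x m l) (hP : P.EmulatesAtomic f ν) (hr : NoReads (run P.initialState l))
    (hm : 1 ≤ m) {K : Set ℕ} {v : V} (hv : v ∈ returnable f K (run P.initialState l)) :
    ∃ c, c < m ∧ v = x c := by
  obtain ⟨l', hl, -, hc, c, hen⟩ := hv
  rw [← run_append] at hc hen
  have hval := returnRead_valid h hl hc (c := c) (v := v)
  obtain ⟨r, hr', hret⟩ := readReturns_of_enabled hr hen
  have h1 : History x m l.length (P.execution (extend (l ++ []) (idleSchedule N V))) := by
    rw [List.append_nil]; exact h.history
  refine (h1.extend (l₂ := l' ++ [Action.returnRead c v]) (bs := idleSchedule N V) le_rfl ?_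
    fun n => Action.IsControlled.noWrite (idleSchedule_controlled n)).read_value
    (hval.isAtomic hP) hret hr' hm
  intro a ha
  rcases List.mem_append.1 ha with ha | ha
  · exact hl a ha
  · rw [List.mem_singleton.1 ha]; rintro _ _ ⟨⟩

/-- Once a later write has terminated, reads return values of later writes only. -/
theorem Valid.returnRead_of_terminates {f ν m : ℕ} {x : ℕ → V} {l l' : List (Action N V)}
    (h : P.Valid f ν x m l) (hP : P.EmulatesAtomic f ν) (hr : NoReads (run P.initialState l))
    (hl : ∀ a ∈ l', a.NoWrite) (hc : (run P.initialState (l ++ l')).crashedServers.encard ≤ f)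
    {c : ℕ} {v : V} (hen : ∃ τ, P.Step (.returnRead c v) (run P.initialState (l ++ l')) τ)
    {i j d : ℕ} {u : V} (hi : (P.finiteExecution l).action i = .invokeWrite d u) (hi0 : i ≠ 0)
    (hij : (P.finiteExecution l).Terminates i j) (hj : j < l.length) :
    ∃ c, 1 ≤ c ∧ c < m ∧ v = x c := by
  have hval := returnRead_valid h hl hc (c := c) (v := v)
  obtain ⟨r, hr', hret⟩ := readReturns_of_enabled hr hen
  have key : ∀ n, n < l.length →
      (P.finiteExecution (l ++ (l' ++ [.returnRead c v]))).action n =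
        (P.finiteExecution l).action n := fun n hn => by
    have := execution_extend_action (P := P) l (l' ++ [.returnRead c v]) [] (idleSchedule N V)
      (idleSchedule N V) hn
    rwa [List.append_nil] at this
  obtain ⟨c', hinv, hlt, hres, hno⟩ := hij
  have hil : i < l.length := by omega
  refine hval.history.read_value_of_terminates (hval.isAtomic hP) (i := i) (j := j) (c := d) (u := u)
    (by rw [key i hil, hi]) hi0 ⟨c', ?_, hlt, ?_, fun n h1 h2 => ?_⟩ (by omega) hret
  · unfold Execution.InvokedBy; rw [key i hil]; exact hinv
  · unfold Execution.ResponseAt; rw [key j hj]; exact hres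
  · unfold Execution.ResponseAt; rw [key n (by omega)]; exact hno n h1 h2

/-! ### Liveness from finite runs -/

theorem run_crashedClients {σ : P.State} {l : List (Action N V)}
    (h : ∀ a ∈ l, a.IsControlled ∨ a = .stutter) :
    (run σ l).crashedClients = σ.crashedClients := by
  refine run_preserves (p := fun τ => τ.crashedClients = σ.crashedClients) rfl
    fun a ha _ _ hτ st => ?_
  rw [← hτ]
  have := h a ha
  cases st with
  | crashClient => simp [Action.IsControlled] at this
  | _ => rfl

theorem subset_run_crashedClients (σ : P.State) (l : List (Action N V)) :
    σ.crashedClients ⊆ (run σ l).crashedClients := by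
  refine run_preserves (p := fun τ => σ.crashedClients ⊆ τ.crashedClients) subset_rfl
    fun _ _ _ _ hτ st => hτ.trans ?_
  cases st with
  | crashClient => exact Set.subset_insert _ _
  | _ => exact subset_rfl

theorem notMem_crashedClients_extend {l : List (Action N V)} {c : ℕ}
    (hc : c ∉ (run P.initialState l).crashedClients) {as : ℕ → Action N V}
    (has : ∀ n, (as n).IsControlled ∨ as n = .stutter) (n : ℕ) :
    c ∉ ((P.execution (extend l as)).state n).crashedClients := by
  refine trajectory_extend_of_always (p := fun σ => c ∉ σ.crashedClients) ?_ (fun n => ?_) n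
  · rintro l₁ l₂ rfl h
    rw [run_append] at hc
    exact hc (subset_run_crashedClients _ _ h)
  · rw [run_append, run_crashedClients fun a ha => ?_]
    · exact hc
    · obtain ⟨k, -, rfl⟩ := mem_initial.1 ha
      exact has k

/-- A write that has been invoked terminates after some actions of the clients and servers. -/
theorem exists_write_terminates [Countable V] {f ν : ℕ} (hP : P.ConcurrencyWaitFree f ν)
    {l : List (Action N V)} (hb : Always (fun σ => (writers σ).encard < ν) P.initialState l)
    (hc : (run P.initialState l).crashedServers.encard ≤ f) {i c : ℕ} {v : V} (hil : i < l.length)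
    (hi : (P.finiteExecution l).action i = .invokeWrite c v)
    (hcc : c ∉ (run P.initialState l).crashedClients) :
    ∃ l' : List (Action N V), (∀ a ∈ l', a.IsControlled ∨ a = .stutter) ∧ ∃ j,
      j < (l ++ l').length ∧ (P.finiteExecution (l ++ l')).Terminates i j := by
  obtain ⟨as, has, hfair⟩ := exists_fair_schedule (N := N) (V := V)
  have hi' : (P.execution (extend l as)).action i = .invokeWrite c v := by
    rw [← hi]
    have := execution_extend_action (P := P) l [] [] as (idleSchedule N V) hil
    rwa [List.append_nil] at this
  obtain ⟨j, hj⟩ := (hP (P.execution (extend l as))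
    (bounded_extend hb fun n => Action.IsControlled.noWrite (has n))
    (crashes_extend hc fun n => Action.IsControlled.noCrash (has n)) (execution_isFair hfair) i c
    (notMem_crashedClients_extend hcc has)).1 v hi'
  refine ⟨initial as (j + 1), fun a ha => ?_, j, by simp; omega, ?_⟩
  · obtain ⟨k, -, rfl⟩ := mem_initial.1 ha
    exact has k
  have key : ∀ n, n < l.length + (j + 1) → (P.finiteExecution (l ++ initial as (j + 1))).action n =
      (P.execution (extend l as)).action n := by
    intro n hn
    have e : extend l as = extend (l ++ initial as (j + 1)) fun k => as (k + (j + 1)) := by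
      funext k
      unfold extend
      by_cases h1 : k < l.length
      · rw [dif_pos h1, dif_pos (by simp; omega), List.getElem_append_left h1]
      · rw [dif_neg h1]
        by_cases h2 : k < (l ++ initial as (j + 1)).length
        · rw [dif_pos h2, List.getElem_append_right (by omega)]
          simp [initial]
        · rw [dif_neg h2]
          congr 1
          simp at h2 ⊢
          omega
    rw [e]
    have := execution_extend_action (P := P) (l ++ initial as (j + 1)) [] [] (idleSchedule N V)
      (fun k => as (k + (j + 1))) (n := n) (by simp; omega)
    rwa [List.append_nil] at this
  obtain ⟨c', hinv, hlt, hres, hno⟩ := hj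
  refine ⟨c', ?_, hlt, ?_, fun n h1 h2 => ?_⟩
  · unfold Execution.InvokedBy; rw [key i (by omega)]; exact hinv
  · unfold Execution.ResponseAt; rw [key j (by omega)]; exact hres
  · unfold Execution.ResponseAt; rw [key n (by omega)]; exact hno n h1 h2

/-- A read can be invoked and be brought to its return. -/
theorem exists_read_returns [Countable V] {f ν : ℕ} (hP : P.ConcurrencyWaitFree f ν)
    {l : List (Action N V)} (hb : Always (fun σ => (writers σ).encard < ν) P.initialState l)
    (hc : (run P.initialState l).crashedServers.encard ≤ f) {c : ℕ}
    (hcc : c ∉ (run P.initialState l).crashedClients)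
    (hidle : ((run P.initialState l).client c).activity = .idle) :
    ∃ l' : List (Action N V), (∀ a ∈ l', a.NoWrite) ∧ (∀ a ∈ l', a.NoCrash) ∧
      ∃ v τ, P.Step (.returnRead c v) (run P.initialState (l ++ l')) τ := by
  obtain ⟨as, has, hfair⟩ := exists_fair_schedule (N := N) (V := V)
  set l₁ := l ++ [Action.invokeRead c] with hl₁
  have hst : P.Step (.invokeRead c) (run P.initialState l) _ := .invokeRead _ c hcc hidle
  have hrun : run P.initialState l₁ = (run P.initialState l).setClient c
      (((run P.initialState l).client c).start (.reading (P.beginRead c) fun _ => none)) := by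
    rw [hl₁, run_append, run_cons, run_nil, exec_of_step hst]
  have hb₁ : Always (fun σ => (writers σ).encard < ν) P.initialState l₁ := by
    refine hb.append (always_preserves hb.last fun a ha σ τ hσ st =>
      lt_of_le_of_lt (Set.encard_le_encard fun c hc => ?_) hσ)
    by_contra hn
    refine step_not_isWrite (fun v => ?_) hn st hc
    rw [List.mem_singleton.1 ha]; rintro ⟨⟩
  have hc₁ : (run P.initialState l₁).crashedServers.encard ≤ f := by rw [hrun]; exact hc
  have hcc₁ : c ∉ (run P.initialState l₁).crashedClients := by rw [hrun]; exact hcc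
  set e := P.execution (extend l₁ as) with he
  have hstate : e.state l.length = run P.initialState l :=
    trajectory_extend P.initialState l [.invokeRead c] as
  have hact : extend l₁ as l.length = .invokeRead c := by
    rw [extend_of_lt (by simp [hl₁])]; simp [hl₁]
  have hi : e.action l.length = .invokeRead c := by
    rw [← hact]
    refine execution_action_of_enabled ?_
    change ∃ τ, P.Step _ (e.state l.length) τ
    rw [hact, hstate]
    exact ⟨_, hst⟩
  have hbe : e.BoundedConcurrency ν := bounded_extend hb₁ fun n => Action.IsControlled.noWrite (has n)
  have hnw : ∀ k, l.length < k → ∀ v, ¬ e.WriteAt k v := by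
    rintro k hk v ⟨d, hd⟩
    have := execution_action_noWrite (fun n => Action.IsControlled.noWrite (has n)) hd
    simp [hl₁] at this
    omega
  obtain ⟨j, c', hinv, hlt, hres, -⟩ := (hP e hbe
    (crashes_extend hc₁ fun n => Action.IsControlled.noCrash (has n)) (execution_isFair hfair)
    l.length c (notMem_crashedClients_extend hcc₁ has)).2 hi
    (lt_of_le_of_lt (e.concurrent_encard_le hi hnw) (hbe _))
  obtain rfl : c' = c := by
    rcases hinv with h | ⟨v, h⟩ <;> rw [hi] at h <;> cases h
    rfl
  obtain ⟨k, rfl⟩ : ∃ k, j = l₁.length + k := Nat.exists_eq_add_of_le (by simp [hl₁]; omega)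
  have hstj : e.state (l₁.length + k) = run P.initialState (l₁ ++ initial as k) :=
    trajectory_extend_add P.initialState l₁ as k
  have hseq : ∀ a ∈ initial as k, a.IsControlled ∨ a = .stutter := fun a ha => by
    obtain ⟨k, -, rfl⟩ := mem_initial.1 ha
    exact has k
  have hmem : ∀ a ∈ Action.invokeRead c' :: initial as k, a.NoWrite ∧ a.NoCrash := by
    intro a ha
    rcases List.mem_cons.1 ha with rfl | ha
    · exact ⟨by rintro _ _ ⟨⟩, by rintro _ ⟨⟩⟩
    · exact ⟨Action.IsControlled.noWrite (hseq a ha), Action.IsControlled.noCrash (hseq a ha)⟩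
  refine ⟨.invokeRead c' :: initial as k, fun a ha => (hmem a ha).1, fun a ha => (hmem a ha).2, ?_⟩
  rcases hres with hres | ⟨v, hres⟩
  · -- the client is not writing
    exfalso
    have hen := (execution_action_eq hres (by simp)).2
    change ∃ τ, P.Step _ (e.state _) τ at hen
    rw [hstj, run_append] at hen
    obtain ⟨τ, hen⟩ := hen
    have hw : c' ∈ writers (run (run P.initialState l₁) (initial as k)) := by
      generalize run (run P.initialState l₁) (initial as k) = σ at hen
      cases hen with
      | returnWrite _ _ _ _ _ _ _ hx => simp [writers, hx, Activity.IsWrite]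
    have := run_writers (fun a ha => Action.IsControlled.noWrite (hseq a ha)) hw
    rw [hrun] at this
    simp [writers, setClient_client, ClientState.start, Activity.IsWrite] at this
  · have hen := (execution_action_eq hres (by simp)).2
    change ∃ τ, P.Step _ (e.state _) τ at hen
    rw [hstj, hl₁, List.append_assoc, List.singleton_append] at hen
    exact ⟨v, hen⟩

/-! ### Properties of the set of returnable values -/

theorem BlindRun.mono {D : Set (Fin N)} {K K' : Set ℕ} {σ : P.State} {l : List (Action N V)}
    (h : BlindRun D K σ l) (hK : K ⊆ K') : BlindRun D K' σ l :=
  fun l₁ a l₂ e c s n ha hs => ⟨(h l₁ a l₂ e c s n ha hs).1,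
    fun hD hc => (h l₁ a l₂ e c s n ha hs).2 hD fun hc' => hc (hK hc')⟩

theorem BlindRun.of_crashed {D : Set (Fin N)} {K : Set ℕ} {σ : P.State} {l : List (Action N V)}
    (h : BlindRun ∅ K σ l) (hD : D ⊆ σ.crashedServers) : BlindRun D K σ l :=
  fun l₁ a l₂ e c s n ha hs => ⟨fun h => absurd (subset_run_crashedServers _ _ (hD h)) hs,
    fun _ => (h l₁ a l₂ e c s n ha hs).2 (by simp)⟩

theorem BlindRun.append {D : Set (Fin N)} {K : Set ℕ} {σ : P.State} {l l' : List (Action N V)}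
    (h : BlindRun D K σ l) (h' : BlindRun D K (run σ l) l') : BlindRun D K σ (l ++ l') := by
  intro l₁ a l₂ e
  rcases List.append_eq_append_iff.1 e with ⟨b, rfl, e'⟩ | ⟨b, e', e''⟩
  · rw [run_append]
    exact h' _ _ _ e'
  · cases b with
    | nil =>
      simp only [List.append_nil] at e'
      subst e'
      exact h' [] a l₂ (by simpa using e''.symm)
    | cons b bs =>
      simp only [List.cons_append, List.cons.injEq] at e''
      obtain ⟨rfl, -⟩ := e''
      exact h _ _ _ e'

/-- Mute clients do not reveal their values. -/
theorem blindRun_of_mute {K : Set ℕ} {σ : P.State} {l : List (Action N V)}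
    (hl : ∀ a ∈ l, a.NoWrite) (h : ∀ c, c ∉ K → Mute c σ) : BlindRun ∅ K σ l := by
  rintro l₁ a l₂ rfl c s n - -
  refine ⟨by simp, fun _ hc q p => ?_⟩
  refine (run_preserves (p := Mute c) (h c hc) fun a ha _ _ h st => step_mute ?_ h st).1 _ _ _ _
  exact fun v => hl a (by simp [ha]) c v

theorem returnable_mono {f : ℕ} {K K' : Set ℕ} (hK : K ⊆ K') (σ : P.State) :
    returnable f K σ ⊆ returnable f K' σ := by
  rintro v ⟨l, hl, hb, h⟩
  exact ⟨l, hl, hb.mono hK, h⟩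

theorem returnable_run_subset {f : ℕ} {K : Set ℕ} {σ : P.State} {l : List (Action N V)}
    (hl : ∀ a ∈ l, a.NoWrite) (hb : BlindRun ∅ K σ l) :
    returnable f K (run σ l) ⊆ returnable f K σ := by
  rintro v ⟨l', hl', hb', h⟩
  rw [← run_append] at h
  refine ⟨l ++ l', fun a ha => ?_, hb.append hb', h⟩
  rcases List.mem_append.1 ha with ha | ha
  · exact hl a ha
  · exact hl' a ha

/-- States that differ only in data of crashed servers and values of clients outside of `K` cannot
be told apart by reads, as long as only clients in `K` send values. -/
theorem Sim.returnable_subset {f : ℕ} {D : Set (Fin N)} {K : Set ℕ} {σ τ : P.State}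
    (h : Sim D K σ τ) (hD : D ⊆ σ.crashedServers) : returnable f K σ ⊆ returnable f K τ := by
  rintro v ⟨l, hl, hb, hc, c, hen⟩
  have hb' := hb.of_crashed hD
  have hsim : ∀ l₁ l₂, l = l₁ ++ l₂ → Sim D K (Protocol.run σ l₁) (Protocol.run τ l₁) := by
    rintro l₁ l₂ rfl
    have hl₁ : ∀ a ∈ l₁, a.NoWrite := fun a ha => hl a (by simp [ha])
    have := h.run (x := fun _ => P.default) (x' := fun _ => P.default) (fun _ _ => rfl) (l := l₁) ?_
    · rwa [map_assign_of_noWrite hl₁] at this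
    · rw [map_assign_of_noWrite hl₁]
      rintro l₃ a l₄ rfl
      exact hb' l₃ a (l₄ ++ l₂) (by simp)
  refine ⟨l, hl, fun l₁ a l₂ e => ?_, ?_, c, ?_⟩
  · have h1 := (hsim l₁ _ e).blind (.inl rfl) (hb' l₁ a l₂ e)
    intro c s n ha hs
    refine ⟨by simp, fun _ => (h1 c s n ha hs).2 fun hsD => hs ?_⟩
    rw [← (hsim l₁ _ e).crashedServers]
    exact subset_run_crashedServers _ _ (hD hsD)
  · rw [← (hsim l [] (by simp)).crashedServers]
    exact hc
  · refine ((hsim l [] (by simp)).enabled_iff (.inl rfl) ?_).1 hen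
    rintro _ _ _ ⟨⟩

theorem Sim.returnable_eq {f : ℕ} {D : Set (Fin N)} {K : Set ℕ} {σ τ : P.State}
    (h : Sim D K σ τ) (hD : D ⊆ σ.crashedServers) : returnable f K σ = returnable f K τ :=
  (h.returnable_subset hD).antisymm (h.symm.returnable_subset (h.crashedServers ▸ hD))

/-! ### Independence of the values -/

theorem assign_assign (x x' : ℕ → V) (a : Action N V) : assign x' (assign x a) = assign x' a := by
  cases a <;> rfl

theorem initialState_sim (D : Set (Fin N)) (K : Set ℕ) :
    Sim D K P.initialState P.initialState := Sim.refl _ _ _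

theorem noReads_run {l : List (Action N V)} (hl : ∀ a ∈ l, a.NoRead) :
    NoReads (run P.initialState l) :=
  run_preserves initialState_noReads fun a ha _ _ h st => step_noReads (hl a ha) h st

/-- Without reads, the states reached with different values agree up to data and values. -/
theorem run_assign_sim {x : ℕ → V} {l : List (Action N V)} (hx : l.map (assign x) = l)
    (hl : ∀ a ∈ l, a.NoRead) (x' : ℕ → V) :
    Sim Set.univ ∅ (run P.initialState l) (run P.initialState (l.map (assign x'))) := by
  have := noReads_sim (initialState_sim (P := P) Set.univ ∅) initialState_noReads hl x x'
  rwa [hx] at this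

theorem map_assign_prefix {x : ℕ → V} {l₁ l₂ : List (Action N V)}
    (hx : (l₁ ++ l₂).map (assign x) = l₁ ++ l₂) : l₁.map (assign x) = l₁ := by
  rw [List.map_append] at hx
  exact (List.append_inj hx (by simp)).1

theorem always_assign {p : P.State → Prop} {q : P.State → Prop}
    (hpq : ∀ σ τ, Sim Set.univ ∅ σ τ → p σ → q τ) {x : ℕ → V} {l : List (Action N V)}
    (hx : l.map (assign x) = l) (hl : ∀ a ∈ l, a.NoRead) (x' : ℕ → V)
    (h : Always p P.initialState l) : Always q P.initialState (l.map (assign x')) := by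
  intro l₁ l₂ e
  obtain ⟨l₃, l₄, rfl, rfl, rfl⟩ := List.map_eq_append_iff.1 e
  exact hpq _ _ (run_assign_sim (map_assign_prefix hx) (fun a ha => hl a (by simp [ha])) x')
    (h _ _ rfl)

/-- With other values, the same actions occur, up to these values. -/
theorem finiteExecution_assign {x : ℕ → V} {l : List (Action N V)} (hx : l.map (assign x) = l)
    (hl : ∀ a ∈ l, a.NoRead) (x' : ℕ → V) (n : ℕ) :
    (P.finiteExecution (l.map (assign x'))).action n =
      assign x' ((P.finiteExecution l).action n) := by
  classical
  by_cases hn : n < l.length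
  · have e : l = l.take n ++ l.drop n := (List.take_append_drop n l).symm
    have hx₁ : (l.take n).map (assign x) = l.take n := map_assign_prefix (l₂ := l.drop n) (by rwa [← e])
    have hl₁ : ∀ a ∈ l.take n, a.NoRead := fun a ha => hl a (List.mem_of_mem_take ha)
    have hs := run_assign_sim (P := P) hx₁ hl₁ x'
    have h1 := trajectory_extend P.initialState (l.take n) (l.drop n) (idleSchedule N V)
    have h2 := trajectory_extend P.initialState ((l.take n).map (assign x'))
      ((l.drop n).map (assign x')) (idleSchedule N V)
    rw [← List.map_append, ← e, List.length_map, List.length_take, min_eq_left hn.le] at h2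
    rw [← e, List.length_take, min_eq_left hn.le] at h1
    change (if ∃ τ, P.Step _ (trajectory _ _ n) τ then _ else _) =
      assign x' (if ∃ τ, P.Step _ (trajectory _ _ n) τ then _ else _)
    rw [h1, h2, extend_of_lt hn, extend_of_lt (by simpa using hn)]
    have ha : ActionSim ∅ l[n] (assign x' l[n]) := by
      have h3 : assign x l[n] = l[n] := by
        have := List.getElem_map (assign x) (l := l) (i := n) (h := by simpa using hn)
        rw [← this]
        simp only [hx]
      have := actionSim_assign (K := ∅) (x := x) (x' := x') (by simp) l[n]
      rwa [h3] at this
    have hen := hs.enabled_iff ha (fun c s k _ _ => ⟨fun _ q => (noReads_run hl₁).2 _ _ _ _, by simp⟩)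
    rw [List.getElem_map]
    by_cases hc : ∃ τ, P.Step l[n] (run P.initialState (l.take n)) τ
    · rw [if_pos hc, if_pos (hen.1 hc)]
    · rw [if_neg hc, if_neg (hen.not.1 hc)]
      rfl
  · have h1 : ∀ l : List (Action N V), ¬ n < l.length →
        (P.finiteExecution l).action n = .stutter := by
      intro l hn
      by_contra h
      have := (execution_action_eq (P := P) (as := extend l (idleSchedule N V)) rfl h).1
      rw [extend, dif_neg hn] at this
      exact h this.symm
    rw [h1 _ hn, h1 _ (by simpa using hn)]
    rfl

theorem assign_eq_invokeWrite {x : ℕ → V} {a : Action N V} {c : ℕ} {v : V}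
    (h : assign x a = .invokeWrite c v) : v = x c ∧ ∃ u, a = .invokeWrite c u := by
  cases a with
  | invokeWrite c' u =>
    simp only [assign, Action.invokeWrite.injEq] at h
    obtain ⟨rfl, rfl⟩ := h
    exact ⟨rfl, u, rfl⟩
  | _ => cases h

theorem Valid.assign {f ν m : ℕ} {x : ℕ → V} {l : List (Action N V)} (h : P.Valid f ν x m l)
    (hx : l.map (assign x) = l) (hl : ∀ a ∈ l, a.NoRead) (x' : ℕ → V) :
    P.Valid f ν x' m (l.map (Protocol.assign x')) where
  history := by
    have key := finiteExecution_assign (P := P) hx hl x'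
    obtain ⟨j, hj0, hjT, hj, hinv⟩ := h.history.returned
    refine ⟨?_, ⟨j, hj0, by simpa using hjT, ?_, fun i c v hi => ?_⟩, fun c h1 h2 => ?_⟩
    · rw [key, h.history.first]; rfl
    · rw [key, hj]; rfl
    · rw [key] at hi
      obtain ⟨rfl, u, hu⟩ := assign_eq_invokeWrite hi
      rw [List.length_map]
      exact (hinv i c u hu).imp id fun h => ⟨h.1, h.2.1, h.2.2.1, h.2.2.2.1, rfl⟩
    · obtain ⟨i, hi, hia⟩ := h.history.invoked c h1 h2
      exact ⟨i, by simpa using hi, by rw [key, hia]; rfl⟩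
  bounded := always_assign (fun σ τ hs hp => by rwa [← hs.writers]) hx hl x' h.bounded
  crashes := by
    rw [← (run_assign_sim hx hl x').crashedServers]
    exact h.crashes

/-- As long as no server has received the value of client `j`, a read cannot return it: it would
return the same if client `j` had written a value that nobody has written. -/
theorem Valid.ne_of_noPayload {f ν m : ℕ} {x : ℕ → V} {l : List (Action N V)}
    (h : P.Valid f ν x m l) (hP : P.EmulatesAtomic f ν) (hx : l.map (Protocol.assign x) = l)
    (hl : ∀ a ∈ l, a.NoRead) (hm : 1 ≤ m) {j : ℕ}
    (hj : Always (NoPayload j) P.initialState l)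
    (hinj : ∀ c, c < m → x c = x j → c = j) {y : V} (hy : y ≠ x j) {K : Set ℕ} (hjK : j ∉ K)
    {v : V} (hv : v ∈ returnable f K (run P.initialState l)) : v ≠ x j := by
  rintro rfl
  set x' := Function.update x j y with hx'
  have hs : Sim ∅ {j}ᶜ (run P.initialState (l.map (Protocol.assign x)))
      (run P.initialState (l.map (Protocol.assign x'))) := by
    refine (initialState_sim ∅ {j}ᶜ).run (fun c hc => ?_) ?_
    · rw [hx', Function.update_of_ne hc]
    · rw [hx]
      intro l₁ a l₂ e c s n _ _
      refine ⟨by simp, fun _ hc => ?_⟩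
      simp only [Set.mem_compl_iff, Set.mem_singleton_iff, not_not] at hc
      subst hc
      exact hj l₁ _ e s n
  rw [hx] at hs
  have hv' := hs.returnable_subset (by simp)
    (returnable_mono (K' := {j}ᶜ) (fun c hc => by rintro rfl; exact hjK hc) _ hv)
  have hx₁ : (l.map (Protocol.assign x')).map (Protocol.assign x') = l.map (Protocol.assign x') := by
    rw [List.map_map]
    exact List.map_congr_left fun a _ => assign_assign _ _ _
  have hl₁ : ∀ a ∈ l.map (Protocol.assign x'), a.NoRead := by
    intro a ha c hc
    obtain ⟨b, hb, rfl⟩ := List.mem_map.1 ha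
    exact hl b hb c ((assign_eq_iff (by rintro _ _ ⟨⟩)).1 hc)
  obtain ⟨c, hc, e⟩ := (h.assign hx hl x').returnable_subset hP (noReads_run hl₁) hm hv'
  by_cases hcj : c = j
  · subst hcj
    rw [hx', Function.update_self] at e
    exact hy e.symm
  · rw [hx', Function.update_of_ne hcj] at e
    exact hcj (hinj c hc e.symm)

/-! ### Preparation: one terminated write, the others about to send their values -/

/-- After the run `l`, the write of client `0` has terminated, the writes of the clients
`1, …, m - 1` have just entered the phase that sends the value, and no value is in transit. All
values are those prescribed by `x`. -/
structure Prepared (P : Protocol N V) (f ν : ℕ) (x : ℕ → V) (m : ℕ) (l : List (Action N V)) :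
    Prop where
  assigned : l.map (assign x) = l
  noRead : ∀ a ∈ l, a.NoRead
  valid : P.Valid f ν x m l
  crashedServers : (run P.initialState l).crashedServers = ∅
  crashedClients : (run P.initialState l).crashedClients = ∅
  noPayload : ∀ c, NoPayload c (run P.initialState l)
  always_noPayload : ∀ c, 1 ≤ c → Always (NoPayload c) P.initialState l
  idle : ∀ c, c = 0 ∨ m ≤ c → ((run P.initialState l).client c).activity = .idle
  ready : ∀ c, 1 ≤ c → c < m → ∃ v w, ((run P.initialState l).client c).activity =
    .writing v w (fun _ => none) ∧ P.stage w = .value ∧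
    ((run P.initialState l).client c).unsent = P.writeTargets w

theorem Prepared.noReads {f ν m : ℕ} {x : ℕ → V} {l : List (Action N V)}
    (h : P.Prepared f ν x m l) : NoReads (run P.initialState l) := noReads_run h.noRead

theorem Prepared.assign {f ν m : ℕ} {x : ℕ → V} {l : List (Action N V)}
    (h : P.Prepared f ν x m l) (x' : ℕ → V) :
    P.Prepared f ν x' m (l.map (Protocol.assign x')) := by
  have hs := run_assign_sim (P := P) h.assigned h.noRead x'
  refine ⟨?_, ?_, h.valid.assign h.assigned h.noRead x', hs.crashedServers ▸ h.crashedServers,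
    hs.crashedClients ▸ h.crashedClients, fun c => hs.noPayload (h.noPayload c), fun c hc =>
    always_assign (fun σ τ hs hp => hs.noPayload hp) h.assigned h.noRead x'
      (h.always_noPayload c hc), fun c hc => idle_of_sim (hs.client c).activity (h.idle c hc),
    fun c h1 h2 => ?_⟩
  · rw [List.map_map]
    exact List.map_congr_left fun a _ => assign_assign _ _ _
  · intro a ha c hc
    obtain ⟨b, hb, rfl⟩ := List.mem_map.1 ha
    exact h.noRead b hb c ((assign_eq_iff (by rintro _ _ ⟨⟩)).1 hc)
  · obtain ⟨v, w, h3, h4, h5⟩ := h.ready c h1 h2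
    obtain ⟨v', h6, -⟩ := writing_of_sim (hs.client c).activity h3
    exact ⟨v', w, h6, h4, (hs.client c).unsent ▸ h5⟩

theorem idle_of_notMem_writers {σ : P.State} (h : NoReads σ) {c : ℕ} (hc : c ∉ writers σ) :
    (σ.client c).activity = .idle := by
  cases hx : (σ.client c).activity with
  | idle => rfl
  | writing => exact absurd (by simp [writers, hx, Activity.IsWrite]) hc
  | reading r rep => exact absurd hx (h.1 c r rep)

theorem notMem_writers_of_idle {σ : P.State} {c : ℕ} (h : (σ.client c).activity = .idle) :
    c ∉ writers σ := by
  simp [writers, h, Activity.IsWrite]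

theorem mute_of_idle {σ : P.State} {c : ℕ} (h : c ∉ writers σ) (hp : NoPayload c σ) : Mute c σ :=
  ⟨hp, .inr fun v w rep hx => absurd (by simp [writers, hx, Activity.IsWrite]) h⟩

theorem Execution.notMem_writers_of_terminates {e : P.Execution} {i j c : ℕ} {v : V}
    (hi : e.action i = .invokeWrite c v) (hij : e.Terminates i j)
    (hw : ∀ k, i < k → ∀ v, e.action k ≠ .invokeWrite c v) {n : ℕ} (hn : j < n) :
    c ∉ writers (e.state n) := by
  obtain ⟨c', hinv, hlt, hres, -⟩ := hij
  obtain rfl : c' = c := by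
    rcases hinv with h | ⟨u, h⟩ <;> rw [hi] at h <;> cases h
    rfl
  induction n, hn using Nat.le_induction with
  | base => exact notMem_writers_of_idle (e.idle_of_response hres)
  | succ n hn ih => exact step_not_isWrite (hw n (by omega)) ih (e.step n)

/-- All requests of client `c` in transit are delivered by receiving them. -/
theorem exists_drain (σ : P.State) (hnum : Numbered σ) (hs : σ.crashedServers = ∅) (c : ℕ) :
    ∃ l : List (Action N V), (∀ a ∈ l, a.IsControlled) ∧ NoPayload c (run σ l) := by
  set l : List (Action N V) := (List.finRange N).flatMap fun s =>
    (List.range ((σ.client c).number + 1)).map fun n => .serverReceive c s n with hl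
  have hmem : ∀ a ∈ l, ∃ s n, a = .serverReceive c s n := by
    intro a ha
    simp only [hl, List.mem_flatMap, List.mem_map] at ha
    obtain ⟨s, -, n, -, rfl⟩ := ha
    exact ⟨s, n, rfl⟩
  refine ⟨l, fun a ha => ?_, fun s n q p h => ?_⟩
  · obtain ⟨s, n, rfl⟩ := hmem a ha
    trivial
  have hpres : ∀ l' : List (Action N V), (∀ a ∈ l', ∃ s n, a = .serverReceive c s n) →
      ∀ τ : P.State, τ.requests c s n = none → (run τ l').requests c s n = none := by
    intro l' hl' τ hτ
    refine run_preserves (p := fun τ : P.State => τ.requests c s n = none) hτ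
      fun a ha σ τ hσ st => ?_
    obtain ⟨s', n', rfl⟩ := hl' a ha
    cases st
    simp only [setMessage]
    split_ifs
    · rfl
    · exact hσ
  by_cases hn : n ≤ (σ.client c).number
  · have : Action.serverReceive c s n ∈ l := by
      simp only [hl, List.mem_flatMap, List.mem_map, List.mem_range]
      exact ⟨s, List.mem_finRange s, n, by omega, rfl⟩
    obtain ⟨l₁, l₂, e⟩ := List.append_of_mem this
    rw [e, run_append, run_cons] at h
    rw [hpres l₂ (fun a ha => hmem a (by rw [e]; simp [ha]))] at h
    · cases h
    · have hcr : (run σ l₁).crashedServers = ∅ := by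
        rw [run_crashedServers, hs]
        intro a ha s' e'
        obtain ⟨_, _, e''⟩ := hmem a (by rw [e]; simp [ha])
        rw [e'] at e''
        cases e''
      cases hq : (run σ l₁).requests c s n with
      | none => exact hpres [.serverReceive c s n] (by simp) _ hq
      | some q =>
        have st := Step.serverReceive (run σ l₁) c s n q (by simp [hcr]) hq
        rw [exec_of_step st]
        simp [setMessage]
  · have h0 : σ.requests c s n = none := by
      by_contra h'
      exact hn (hnum c s n h')
    rw [hpres l hmem σ h0] at h
    cases h

theorem initialState_numbered : Numbered P.initialState := by
  intro c s n h
  simp [initialState] at h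

/-- The terminated write. -/
theorem exists_prepared_one [Countable V] {f ν : ℕ} (hν : 2 ≤ ν) (hP : P.ConcurrencyWaitFree f ν)
    (x : ℕ → V) : ∃ l, P.Prepared f ν x 1 l := by
  set a : Action N V := .invokeWrite 0 (x 0) with ha
  have hst : P.Step a P.initialState _ :=
    .invokeWrite _ 0 (x 0) (by simp [initialState]) (by simp [initialState])
  have hwr : writers (exec a P.initialState) ⊆ {0} := by
    intro c hc
    rw [exec_of_step hst] at hc
    by_contra h
    simp only [Set.mem_singleton_iff] at h
    simp [writers, setClient_client, h, initialState, Activity.IsWrite] at hc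
  have hb : Always (fun σ => (writers σ).encard < ν) P.initialState [a] := by
    intro l₁ l₂ e
    have hν' : (1 : ℕ∞) < ν := by exact_mod_cast hν
    rcases List.cons_eq_append_iff.1 e with ⟨rfl, -⟩ | ⟨l₃, rfl, e'⟩
    · have : writers P.initialState = ∅ := by
        ext c; simp [writers, initialState, Activity.IsWrite]
      rw [run_nil, this]
      simp
      omega
    · obtain ⟨rfl, rfl⟩ := List.nil_eq_append_iff.1 e'
      refine lt_of_le_of_lt (Set.encard_le_encard hwr) ?_
      simpa using hν'
  have hi : (P.finiteExecution [a]).action 0 = a :=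
    execution_action_of_enabled (as := extend [a] (idleSchedule N V)) ⟨_, hst⟩
  have hcs : (run P.initialState [a]).crashedServers = ∅ := by
    rw [run_cons, run_nil, exec_of_step hst]; rfl
  have hcc : (run P.initialState [a]).crashedClients = ∅ := by
    rw [run_cons, run_nil, exec_of_step hst]; rfl
  obtain ⟨l', hl', j, hj, hterm⟩ := exists_write_terminates hP hb (by rw [hcs]; simp) (i := 0)
    (by simp) hi (by rw [hcc]; simp)
  have hNR : ∀ b ∈ [a] ++ l', b.NoRead := by
    intro b hb
    rcases List.mem_append.1 hb with hb | hb
    · rw [List.mem_singleton.1 hb, ha]; rintro _ ⟨⟩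
    · exact Action.IsControlled.noRead (hl' b hb)
  have hcs₁ : (run P.initialState ([a] ++ l')).crashedServers = ∅ := by
    rw [run_append, run_crashedServers fun b hb => Action.IsControlled.noCrash (hl' b hb), hcs]
  obtain ⟨d, hd, hdrain⟩ := exists_drain (run P.initialState ([a] ++ l'))
    (run_preserves initialState_numbered fun _ _ _ _ h st => step_numbered h st) hcs₁ 0
  -- The messages that the write has left in transit are delivered.
  set l₂ := l' ++ d with hl₂
  have hctl : ∀ b ∈ l₂, b.IsControlled ∨ b = .stutter := by
    intro b hb
    rcases List.mem_append.1 hb with hb | hb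
    · exact hl' b hb
    · exact .inl (hd b hb)
  have hNW : ∀ b ∈ l₂, b.NoWrite := fun b hb => Action.IsControlled.noWrite (hctl b hb)
  have hfull : [a] ++ l₂ = ([a] ++ l') ++ d := by simp [hl₂]
  have hNR₂ : ∀ b ∈ [a] ++ l₂, b.NoRead := by
    intro b hb
    rcases List.mem_append.1 hb with hb | hb
    · rw [List.mem_singleton.1 hb, ha]; rintro _ ⟨⟩
    · exact Action.IsControlled.noRead (hctl b hb)
  set e := P.finiteExecution ([a] ++ l') with he
  have hact0 : e.action 0 = a := by
    rw [← hi]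
    exact execution_extend_action (P := P) [a] l' [] (idleSchedule N V) (idleSchedule N V) (by simp)
  have hinv : ∀ i c v, e.action i = .invokeWrite c v → i = 0 := by
    intro i c v h
    have := extend_append_noWrite (P := P) (l := [a]) (l' := l') (as := idleSchedule N V)
      (fun n => Action.IsControlled.noWrite (idleSchedule_controlled n))
      (fun b hb => Action.IsControlled.noWrite (hl' b hb)) h
    simpa using this
  have hwrite : 0 ∉ writers (run P.initialState ([a] ++ l')) := by
    have := e.notMem_writers_of_terminates hact0 hterm (fun k hk v h => by
      have := hinv _ _ _ h; omega) hj
    rw [he, finiteExecution] at this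
    change 0 ∉ writers (trajectory _ _ _) at this
    rwa [trajectory_extend_length] at this
  have hjr : e.action j = .returnWrite 0 := by
    obtain ⟨c', hinv', -, hres, -⟩ := hterm
    obtain rfl : c' = 0 := by
      rcases hinv' with h | ⟨u, h⟩ <;> rw [hact0, ha] at h <;> cases h
      rfl
    rcases hres with h | ⟨v, h⟩
    · exact h
    · obtain ⟨r, -, hr, -⟩ := e.readReturns_of_action h
      have h1 := (execution_action_eq hr (by simp)).1
      unfold extend at h1
      split_ifs at h1 with h2
      · exact absurd h1 (hNR _ (List.getElem_mem _) _)
      · cases h1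
  have h1 : History x 1 ([a] ++ l').length e := by
    refine ⟨hact0, ⟨j, ?_, hj, hjr, fun i c v h => .inl (hinv i c v h)⟩, fun c h1 h2 => by omega⟩
    obtain ⟨_, -, hlt, -⟩ := hterm
    exact hlt
  have hb₁ : Always (fun σ => (writers σ).encard < ν) P.initialState ([a] ++ l') :=
    hb.append (always_preserves hb.last fun b hb σ τ hσ st =>
      lt_of_le_of_lt (Set.encard_le_encard fun c hc => by
        by_contra hn
        exact step_not_isWrite (fun v => Action.IsControlled.noWrite (hl' b hb) c v) hn st hc) hσ)
  have hcs₂ : (run P.initialState ([a] ++ l₂)).crashedServers = ∅ := by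
    rw [hfull, run_append, run_crashedServers fun b hb => Action.IsControlled.noCrash (.inl (hd b hb)),
      hcs₁]
  have hval : P.Valid f ν x 1 ([a] ++ l₂) := by
    rw [hfull]
    refine Valid.append ⟨h1, hb₁, by rw [hcs₁]; simp⟩
      (fun b hb => Action.IsControlled.noWrite (.inl (hd b hb))) ?_
    rw [← hfull, hcs₂]
    simp
  have hmute : ∀ c, 1 ≤ c → Always (Mute c) P.initialState ([a] ++ l₂) := by
    intro c hc
    refine always_preserves ⟨fun s n q p h => by simp [initialState] at h,
      .inr fun v w rep h => by simp [initialState] at h⟩ fun b hb σ τ hσ st => step_mute ?_ hσ st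
    intro v hv
    rcases List.mem_append.1 hb with hb | hb
    · rw [List.mem_singleton.1 hb, ha] at hv
      simp only [Action.invokeWrite.injEq] at hv
      omega
    · exact hNW b hb c v hv
  refine ⟨[a] ++ l₂, ?_, hNR₂, hval, hcs₂, ?_, fun c => ?_, fun c hc => (hmute c hc).mono
    fun τ h => h.1, fun c _ => ?_, fun c h1 h2 => by omega⟩
  · rw [List.map_append, map_assign_of_noWrite hNW]
    rfl
  · rw [run_append, run_crashedClients hctl, hcc]
  · rcases Nat.eq_zero_or_pos c with rfl | hc
    · rw [hfull, run_append]; exact hdrain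
    · exact (hmute c hc).last.1
  · refine idle_of_notMem_writers (noReads_run hNR₂) ?_
    rcases Nat.eq_zero_or_pos c with rfl | hc
    · intro h
      rw [hfull, run_append] at h
      exact hwrite (run_writers (fun b hb => Action.IsControlled.noWrite (.inl (hd b hb))) h)
    · intro h
      rw [run_append, run_cons, run_nil] at h
      have := hwr (run_writers hNW h)
      simp at this
      omega

/-! ### One more writer -/

/-- After a step a writer is in the same phase as before, or at the very beginning of a phase. -/
theorem step_enter_value {a : Action N V} {σ τ : P.State} {c : ℕ} (ha : ∀ v, a ≠ .invokeWrite c v)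
    (st : P.Step a σ τ) {v : V} {w : P.WriteState} {rep : Fin N → Option P.WriteReply}
    (h : (τ.client c).activity = .writing v w rep) :
    (∃ rep', (σ.client c).activity = .writing v w rep') ∨
      rep = (fun _ => none) ∧ (τ.client c).unsent = P.writeTargets w := by
  cases st with
  | invokeWrite _ c' v' hc hx =>
    rw [setClient_client] at h; split_ifs at h with e
    · exact absurd (by rw [e]) (ha v')
    · exact .inl ⟨_, h⟩
  | send _ c' s q hc hs hq =>
    change ((σ.setClient c' _).client c).activity = _ at h
    rw [setClient_client] at h; split_ifs at h with e
    · exact .inl ⟨_, e ▸ h⟩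
    · exact .inl ⟨_, h⟩
  | clientReceive _ c' s n q hs hq =>
    change ((σ.setClient c' _).client c).activity = _ at h
    rw [setClient_client] at h
    by_cases e : c = c'
    · subst e
      rw [if_pos rfl] at h
      simp only at h
      split_ifs at h
      · obtain ⟨rep, e⟩ := Activity.record_eq_writing h
        exact .inl ⟨_, e⟩
      · exact .inl ⟨_, h⟩
    · rw [if_neg e] at h
      exact .inl ⟨_, h⟩
  | nextWrite _ c' v' w' w'' rep' hc hx hu hw =>
    rw [setClient_client] at h ⊢; split_ifs at h ⊢ with e
    · simp only [ClientState.start, Activity.writing.injEq] at h ⊢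
      obtain ⟨-, rfl, rfl⟩ := h
      exact .inr ⟨rfl, rfl⟩
    · exact .inl ⟨_, h⟩
  | invokeRead | nextRead =>
    rw [setClient_client] at h; split_ifs at h with e
    · simp [ClientState.start] at h
    · exact .inl ⟨_, h⟩
  | returnWrite | returnRead =>
    rw [setClient_client] at h; split_ifs at h with e
    exact .inl ⟨_, h⟩
  | _ => exact .inl ⟨_, h⟩

/-- A crashed client does not change its state. -/
theorem step_client_of_crashed {a : Action N V} {σ τ : P.State} {c : ℕ}
    (h : c ∈ σ.crashedClients) (st : P.Step a σ τ) : τ.client c = σ.client c := by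
  have key : ∀ c' γ, c' ∉ σ.crashedClients → (σ.setClient c' γ).client c = σ.client c := by
    intro c' γ hc'
    rw [setClient_client, if_neg (by rintro rfl; exact hc' h)]
  cases st with
  | invokeWrite | invokeRead | nextWrite | nextRead | returnWrite | returnRead | send |
      clientReceive => exact key _ _ ‹_›
  | _ => rfl

theorem run_client_of_crashed {σ : P.State} {c : ℕ} (h : c ∈ σ.crashedClients)
    (l : List (Action N V)) : (run σ l).client c = σ.client c :=
  (run_preserves (p := fun τ => c ∈ τ.crashedClients ∧ τ.client c = σ.client c) ⟨h, rfl⟩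
    fun a _ σ τ hσ st => ⟨by
      have := subset_run_crashedClients σ [a] hσ.1
      rwa [run_cons, run_nil, exec_of_step st] at this,
      (step_client_of_crashed hσ.1 st).trans hσ.2⟩).2

/-- The state in which no client has crashed. -/
def State.revive (σ : P.State) : P.State := { σ with crashedClients := ∅ }

theorem step_revive {a : Action N V} {σ τ : P.State} (st : P.Step a σ τ)
    (ha : a.IsControlled ∨ a = .stutter) : P.Step a σ.revive τ.revive := by
  cases st with
  | invokeWrite | invokeRead | crashServer | crashClient => simp [Action.IsControlled] at ha
  | send _ c s q hc hs hq => exact .send σ.revive c s q (by simp [State.revive]) hs hq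
  | serverReceive _ c s n q hs hq => exact .serverReceive σ.revive c s n q hs hq
  | clientReceive _ c s n a hc ha => exact .clientReceive σ.revive c s n a (by simp [State.revive]) ha
  | nextWrite _ c v w w' rep hc hx hu hw =>
    exact .nextWrite σ.revive c v w w' rep (by simp [State.revive]) hx hu hw
  | returnWrite _ c v w l rep hc hx hu hw =>
    exact .returnWrite σ.revive c v w l rep (by simp [State.revive]) hx hu hw
  | nextRead _ c r r' rep hc hx hu hr =>
    exact .nextRead σ.revive c r r' rep (by simp [State.revive]) hx hu hr
  | returnRead _ c v r rep hc hx hu hr =>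
    exact .returnRead σ.revive c v r rep (by simp [State.revive]) hx hu hr
  | stutter => exact .stutter _

/-- What can be done although some clients have crashed can be done if they merely wait. -/
theorem exists_revived_run {p : P.State → Prop} (hp : ∀ σ, p σ → p σ.revive) {σ : P.State}
    {l : List (Action N V)} (hl : ∀ a ∈ l, a.IsControlled ∨ a = .stutter) (h : Always p σ l) :
    ∃ l' : List (Action N V), (∀ a ∈ l', a.IsControlled ∨ a = .stutter) ∧
      run σ.revive l' = (run σ l).revive ∧ Always p σ.revive l' := by
  induction l generalizing σ with
  | nil =>
    refine ⟨[], by simp, rfl, ?_⟩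
    intro l₁ l₂ e
    obtain ⟨rfl, rfl⟩ := List.nil_eq_append_iff.1 e
    exact hp _ h.last
  | cons a l ih =>
    obtain ⟨l', h1, h2, h3⟩ := ih (σ := exec a σ) (fun b hb => hl b (by simp [hb]))
      (fun l₁ l₂ e => h (a :: l₁) l₂ (by simp [e]))
    by_cases hen : ∃ τ, P.Step a σ τ
    · obtain ⟨τ, st⟩ := hen
      have st' := step_revive st (hl a (by simp))
      rw [exec_of_step st] at h2 h3
      refine ⟨a :: l', ?_, ?_, ?_⟩
      · intro b hb
        rcases List.mem_cons.1 hb with rfl | hb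
        · exact hl b (by simp)
        · exact h1 b hb
      · rw [run_cons, run_cons, exec_of_step st, exec_of_step st', h2]
      · intro l₁ l₂ e
        rcases List.cons_eq_append_iff.1 e with ⟨rfl, -⟩ | ⟨l₃, rfl, e'⟩
        · exact hp _ (h [] _ rfl)
        · rw [run_cons, exec_of_step st']
          exact h3 l₃ l₂ e'
    · rw [exec_of_not_enabled hen] at h2 h3
      exact ⟨l', h1, by rw [run_cons, exec_of_not_enabled hen, h2], h3⟩

theorem run_crashClients (σ : P.State) (cs : List ℕ) :
    run σ (cs.map .crashClient) = { σ with crashedClients := {c | c ∈ cs} ∪ σ.crashedClients } := by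
  induction cs generalizing σ with
  | nil => simp
  | cons c cs ih =>
    rw [List.map_cons, run_cons, exec_of_step (.crashClient σ c), ih]
    simp only [State.mk.injEq, true_and]
    ext d
    simp only [Set.mem_union, Set.mem_ofPred_eq, Set.mem_insert_iff, List.mem_cons]
    tauto

theorem map_assign_append {x : ℕ → V} {l l' : List (Action N V)} (h : l.map (assign x) = l)
    (hl : ∀ a ∈ l', a.NoWrite) : (l ++ l').map (assign x) = l ++ l' := by
  rw [List.map_append, h, map_assign_of_noWrite hl]

/-- Client `m` may invoke its write as well. -/
theorem Prepared.valid_invoke {f ν m : ℕ} {x : ℕ → V} {l : List (Action N V)}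
    (h : P.Prepared f ν x m l) (hm : 1 ≤ m) (hmν : m < ν) :
    P.Valid f ν x (m + 1) (l ++ [.invokeWrite m (x m)]) ∧
      (P.finiteExecution (l ++ [.invokeWrite m (x m)])).action l.length = .invokeWrite m (x m) ∧
      run P.initialState (l ++ [.invokeWrite m (x m)]) =
        (run P.initialState l).setClient m (((run P.initialState l).client m).start
          (.writing (x m) (P.beginWrite m ((run P.initialState l).client m).memory)
            fun _ => none)) ∧
      writers (run P.initialState (l ++ [.invokeWrite m (x m)])) ⊆ Finset.Icc 1 m := by
  set a : Action N V := .invokeWrite m (x m) with ha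
  have hst : P.Step a (run P.initialState l) _ :=
    .invokeWrite _ m (x m) (by simp [h.crashedClients]) (h.idle m (.inr le_rfl))
  have hrun : run P.initialState (l ++ [a]) =
      (run P.initialState l).setClient m (((run P.initialState l).client m).start
        (.writing (x m) (P.beginWrite m ((run P.initialState l).client m).memory)
          fun _ => none)) := by
    rw [run_append, run_cons, run_nil, exec_of_step hst]
  have hwr : writers (run P.initialState (l ++ [a])) ⊆ Finset.Icc 1 m := by
    intro c hc
    rw [hrun] at hc
    by_cases hcm : c = m
    · subst hcm; simp [hm]
    · have hc' : c ∈ writers (run P.initialState l) := by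
        simpa [writers, setClient_client, hcm] using hc
      by_contra hn
      refine notMem_writers_of_idle (h.idle c ?_) hc'
      simp only [Finset.coe_Icc, Set.mem_Icc, not_and, not_le] at hn
      omega
  set e := P.finiteExecution (l ++ [a]) with he
  have key : ∀ n, n < l.length → e.action n = (P.finiteExecution l).action n := fun n hn => by
    have := execution_extend_action (P := P) l [a] [] (idleSchedule N V) (idleSchedule N V) hn
    rwa [List.append_nil] at this
  have hstate : e.state l.length = run P.initialState l :=
    trajectory_extend P.initialState l [a] (idleSchedule N V)
  have hseq : extend (l ++ [a]) (idleSchedule N V) l.length = a := by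
    rw [extend_of_lt (by simp)]; simp
  have hact : e.action l.length = a := by
    rw [← hseq]
    refine execution_action_of_enabled ?_
    change ∃ τ, P.Step _ (e.state l.length) τ
    rw [hseq, hstate]
    exact ⟨_, hst⟩
  refine ⟨⟨?_, ?_, ?_⟩, hact, hrun, hwr⟩
  · obtain ⟨j, hj0, hjT, hj, hinv⟩ := h.valid.history.returned
    refine ⟨?_, ⟨j, hj0, by simp; omega, by rw [key j hjT, hj], fun i c v hi => ?_⟩,
      fun c h1 h2 => ?_⟩
    · rw [key 0 (by omega)]; exact h.valid.history.first
    · have hil := execution_action_noWrite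
        (fun n => Action.IsControlled.noWrite (idleSchedule_controlled n)) hi
      rcases Nat.lt_or_ge i l.length with hlt | hge
      · rw [key i hlt] at hi
        refine (hinv i c v hi).imp id fun h => ⟨h.1, hil, h.2.2.1, ?_, h.2.2.2.2⟩
        have := h.2.2.2.1
        omega
      · obtain rfl : i = l.length := by simp at hil; omega
        rw [hact, ha] at hi
        simp only [Action.invokeWrite.injEq] at hi
        obtain ⟨rfl, rfl⟩ := hi
        exact .inr ⟨hjT, hil, hm, by omega, rfl⟩
    · rcases Nat.lt_or_ge c m with hlt | hge
      · obtain ⟨i, hi, hia⟩ := h.valid.history.invoked c h1 hlt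
        exact ⟨i, by simp; omega, by rw [key i hi, hia]⟩
      · obtain rfl : c = m := by omega
        exact ⟨l.length, by simp, hact⟩
  · refine h.valid.bounded.append fun l₁ l₂ e => ?_
    rcases List.cons_eq_append_iff.1 e with ⟨rfl, -⟩ | ⟨l₃, rfl, e'⟩
    · exact h.valid.bounded.last
    · obtain ⟨rfl, rfl⟩ := List.nil_eq_append_iff.1 e'
      rw [← run_append]
      refine lt_of_le_of_lt (Set.encard_le_encard hwr) ?_
      rw [Set.encard_coe_eq_coe_finsetCard, Nat.card_Icc]
      simpa using hmν
  · rw [hrun]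
    change (run P.initialState l).crashedServers.encard ≤ f
    simp [h.crashedServers]

/-- Client `c` is in the phase that sends the value. -/
def AtValue (c : ℕ) (σ : P.State) : Prop :=
  ∃ v w rep, (σ.client c).activity = .writing v w rep ∧ P.stage w = .value

/-- A further client can be brought to the phase of its write that sends the value. For this, the
other writers are assumed to have crashed. If the write terminated without sending the value, a
subsequent read would return a value that no server has received. -/
theorem Prepared.exists_succ [Countable V] {f ν m : ℕ} {x : ℕ → V} {l : List (Action N V)}
    (h : P.Prepared f ν x m l) (hP : P.EmulatesAtomic f ν) (hW : P.ConcurrencyWaitFree f ν)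
    (hm : 1 ≤ m) (hmν : m < ν) (hinj : ∀ c d, c < ν → d < ν → x c = x d → c = d)
    {y : V} (hy : ∀ c, c < ν → y ≠ x c) : ∃ l', P.Prepared f ν x (m + 1) l' := by
  classical
  obtain ⟨hval, hact, hrun, hwr⟩ := h.valid_invoke hm hmν
  set a : Action N V := .invokeWrite m (x m) with ha
  set σ := run P.initialState l with hσ
  set σ₁ := run P.initialState (l ++ [a]) with hσ₁
  set crash : List (Action N V) := (List.range m).map .crashClient with hcrash
  set σ₂ := run σ₁ crash with hσ₂
  have hσ₂' : σ₂ = { σ₁ with crashedClients := {c | c ∈ List.range m} ∪ σ₁.crashedClients } :=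
    run_crashClients σ₁ _
  have hc₁ : σ₁.crashedClients = ∅ := by rw [hrun]; exact h.crashedClients
  have hs₁ : σ₁.crashedServers = ∅ := by rw [hrun]; exact h.crashedServers
  have hrev : σ₂.revive = σ₁ := by
    rw [hσ₂', State.revive, ← hc₁]
  have hcl₂ : σ₂.client = σ₁.client := by rw [hσ₂']
  have hcc₂ : ∀ c, c ∈ σ₂.crashedClients ↔ c < m := by
    intro c; rw [hσ₂', hc₁]; simp
  have hnp₁ : ∀ c, NoPayload c σ₁ := by
    intro c; rw [hrun]; exact h.noPayload c
  have hnp₂ : ∀ c, NoPayload c σ₂ := by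
    intro c; rw [hσ₂']; exact hnp₁ c
  have hmute : ∀ c, c ≠ m → Mute c σ₂ := by
    intro c hcm
    refine ⟨hnp₂ c, ?_⟩
    rcases Nat.lt_or_ge c m with hlt | hge
    · exact .inl ((hcc₂ c).2 hlt)
    · refine (mute_of_idle ?_ (hnp₂ c)).2
      intro hc
      rw [writers, hcl₂] at hc
      have := hwr hc
      simp at this
      omega
  have hcl : ∀ c, c ≠ m → σ₁.client c = σ.client c := by
    intro c hcm
    rw [hrun, setClient_client, if_neg hcm]
  have hclm : σ₁.client m = (σ.client m).start
      (.writing (x m) (P.beginWrite m (σ.client m).memory) fun _ => none) := by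
    rw [hrun, setClient_client, if_pos rfl]
  have hcrashNW : ∀ b ∈ crash, b.NoWrite ∧ b.NoRead ∧ b.NoCrash := by
    intro b hb
    obtain ⟨c, -, rfl⟩ := List.mem_map.1 hb
    exact ⟨by rintro _ _ ⟨⟩, by rintro _ ⟨⟩, by rintro _ ⟨⟩⟩
  have hNR₁ : ∀ b ∈ l ++ [a], b.NoRead := by
    intro b hb
    rcases List.mem_append.1 hb with hb | hb
    · exact h.noRead b hb
    · rw [List.mem_singleton.1 hb, ha]; rintro _ ⟨⟩
  have hass₁ : (l ++ [a]).map (Protocol.assign x) = l ++ [a] := by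
    rw [List.map_append, h.assigned]; rfl
  -- Before client `m` enters the stage `value`, no value is sent.
  have hleak : ∀ l₂ : List (Action N V), (∀ b ∈ l₂, b.IsControlled ∨ b = .stutter) →
      (∀ l₃ b l₄, l₂ = l₃ ++ b :: l₄ → ¬ AtValue m (run σ₂ l₃)) →
      ∀ c, NoPayload c (run σ₂ l₂) := by
    intro l₂ hl₂ hnv c
    by_cases hcm : c = m
    · subst hcm
      induction l₂ using List.reverseRecOn with
      | nil => exact hnp₂ c
      | append_singleton l₂ b ih =>
        rw [run_append]
        refine exec_preserves (ih (fun b hb => hl₂ b (by simp [hb])) fun l₃ b' l₄ e => ?_)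
          fun τ st => step_noPayload (ih (fun b hb => hl₂ b (by simp [hb])) fun l₃ b' l₄ e => ?_)
            (.inr fun v w rep hx hw => ?_) st
        · exact hnv l₃ b' (l₄ ++ [b]) (by simp [e])
        · exact hnv l₃ b' (l₄ ++ [b]) (by simp [e])
        · exact absurd ⟨v, w, rep, hx, hw⟩ (hnv l₂ b [] rfl)
    · exact (run_preserves (hmute c hcm) fun b hb _ _ hτ st => step_mute
        (fun v => Action.IsControlled.noWrite (hl₂ b hb) c v) hτ st).1
  by_cases hA : ∃ n, ∃ l₂ : List (Action N V), l₂.length = n ∧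
      (∀ b ∈ l₂, b.IsControlled ∨ b = .stutter) ∧ AtValue m (run σ₂ l₂)
  · -- Take the shortest run that brings client `m` there.
    obtain ⟨l₂, hlen, hl₂, hv⟩ := Nat.find_spec hA
    have hnv : ∀ l₃ b l₄, l₂ = l₃ ++ b :: l₄ → ¬ AtValue m (run σ₂ l₃) := by
      rintro l₃ b l₄ e hv'
      refine Nat.find_min hA (m := l₃.length) ?_ ⟨l₃, rfl, fun b hb => hl₂ b (by simp [e, hb]), hv'⟩
      rw [← hlen, e]
      simp
    have halw : Always (fun τ => ∀ c, NoPayload c τ) σ₂ l₂ := by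
      intro l₃ l₄ e
      refine hleak l₃ (fun b hb => hl₂ b (by simp [e, hb])) fun l₅ b l₆ e' => ?_
      exact hnv l₅ b (l₆ ++ l₄) (by simp [e, e'])
    obtain ⟨l₀, hl₀, hrun₀, halw₀⟩ := exists_revived_run (fun τ hτ => hτ) hl₂ halw
    rw [hrev] at hrun₀ halw₀
    have hNW₀ : ∀ b ∈ l₀, b.NoWrite := fun b hb => Action.IsControlled.noWrite (hl₀ b hb)
    have hNR : ∀ b ∈ l ++ [a] ++ l₀, b.NoRead := by
      intro b hb
      rcases List.mem_append.1 hb with hb | hb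
      · exact hNR₁ b hb
      · exact Action.IsControlled.noRead (hl₀ b hb)
    have hfin : run P.initialState (l ++ [a] ++ l₀) = (run σ₂ l₂).revive := by
      rw [run_append, hrun₀]
    have hcs : (run P.initialState (l ++ [a] ++ l₀)).crashedServers = ∅ := by
      rw [run_append, run_crashedServers fun b hb => Action.IsControlled.noCrash (hl₀ b hb)]
      exact hs₁
    refine ⟨l ++ [a] ++ l₀, map_assign_append hass₁ hNW₀, hNR,
      hval.append hNW₀ (by rw [hcs]; simp), hcs, by rw [hfin]; rfl, fun c => ?_, fun c hc => ?_,
      fun c hc => ?_, fun c h1 h2 => ?_⟩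
    · rw [hfin]; exact halw.last c
    · refine ((h.always_noPayload c hc).append fun l₁ l₂ e => ?_).append
        (halw₀.mono fun τ hτ => hτ c)
      rcases List.cons_eq_append_iff.1 e with ⟨rfl, -⟩ | ⟨l₃, rfl, e'⟩
      · exact h.noPayload c
      · obtain ⟨rfl, rfl⟩ := List.nil_eq_append_iff.1 e'
        rw [← run_append]
        exact hnp₁ c
    · refine idle_of_notMem_writers (noReads_run hNR) fun hc' => ?_
      rw [run_append] at hc'
      have := hwr (run_writers hNW₀ hc')
      simp at this
      omega
    · rw [hfin]
      change ∃ v w, ((run σ₂ l₂).client c).activity = _ ∧ _ ∧ ((run σ₂ l₂).client c).unsent = _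
      rcases Nat.lt_or_ge c m with hlt | hge
      · rw [run_client_of_crashed ((hcc₂ c).2 hlt), hcl₂, hcl c (by omega)]
        exact h.ready c h1 hlt
      · obtain rfl : c = m := by omega
        obtain ⟨v, w, rep, hx, hw⟩ := hv
        rcases List.eq_nil_or_concat l₂ with rfl | ⟨l₃, b, e⟩
        · rw [run_nil, hcl₂, hclm] at hx ⊢
          simp only [ClientState.start, Activity.writing.injEq] at hx ⊢
          obtain ⟨rfl, rfl, rfl⟩ := hx
          exact ⟨_, _, ⟨rfl, rfl, trivial⟩, hw, rfl⟩
        · have e : l₂ = l₃ ++ [b] := by rw [e, List.concat_eq_append]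
          have hn := hnv l₃ b [] e
          rw [e, run_append, run_cons, run_nil] at hx ⊢
          by_cases hen : ∃ τ, P.Step b (run σ₂ l₃) τ
          · obtain ⟨τ, st⟩ := hen
            rw [exec_of_step st] at hx ⊢
            rcases step_enter_value (fun v => Action.IsControlled.noWrite (hl₂ b (by simp [e])) c v)
              st hx with ⟨rep', hx'⟩ | ⟨rfl, hu⟩
            · exact absurd ⟨_, _, _, hx', hw⟩ hn
            · exact ⟨v, w, hx, hw, hu⟩
          · rw [exec_of_not_enabled hen] at hx
            exact absurd ⟨_, _, _, hx, hw⟩ hn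
  · -- Otherwise the write terminates without sending the value.
    exfalso
    have hnv : ∀ l₂ : List (Action N V), (∀ b ∈ l₂, b.IsControlled ∨ b = .stutter) →
        ¬ AtValue m (run σ₂ l₂) := fun l₂ hl₂ hv => hA ⟨_, l₂, rfl, hl₂, hv⟩
    have hcs₂ : (run P.initialState (l ++ [a] ++ crash)).crashedServers = ∅ := by
      rw [run_append, run_crashedServers fun b hb => (hcrashNW b hb).2.2]
      exact hs₁
    have hval₂ : P.Valid f ν x (m + 1) (l ++ [a] ++ crash) :=
      hval.append (fun b hb => (hcrashNW b hb).1) (by rw [hcs₂]; simp)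
    have hrun₂ : run P.initialState (l ++ [a] ++ crash) = σ₂ := by rw [run_append]
    have hpre : ∀ l₅ : List (Action N V), ∀ n, n < (l ++ [a]).length →
        (P.finiteExecution (l ++ [a] ++ l₅)).action n =
          (P.finiteExecution (l ++ [a])).action n := fun l₅ n hn => by
      have := execution_extend_action (P := P) (l ++ [a]) l₅ [] (idleSchedule N V)
        (idleSchedule N V) hn
      rwa [List.append_nil] at this
    obtain ⟨l₂, hl₂, j, hj, hterm⟩ := exists_write_terminates hW hval₂.bounded hval₂.crashes
      (i := l.length) (c := m) (v := x m) (by simp) (by rw [hpre _ _ (by simp), hact])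
      (by rw [hrun₂, hcc₂]; simp)
    have hNW₂ : ∀ b ∈ l₂, b.NoWrite := fun b hb => Action.IsControlled.noWrite (hl₂ b hb)
    have hcs₃ : (run P.initialState (l ++ [a] ++ crash ++ l₂)).crashedServers = ∅ := by
      rw [run_append, run_crashedServers fun b hb => Action.IsControlled.noCrash (hl₂ b hb), hcs₂]
    have hval₃ := hval₂.append hNW₂ (by rw [hcs₃]; simp)
    have hact₃ : (P.finiteExecution (l ++ [a] ++ crash ++ l₂)).action l.length = a := by
      rw [List.append_assoc, hpre _ _ (by simp), hact]
    have hNR₃ : ∀ b ∈ l ++ [a] ++ crash ++ l₂, b.NoRead := by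
      intro b hb
      rcases List.mem_append.1 hb with hb | hb
      · rcases List.mem_append.1 hb with hb | hb
        · exact hNR₁ b hb
        · exact (hcrashNW b hb).2.1
      · exact Action.IsControlled.noRead (hl₂ b hb)
    have hass₃ : (l ++ [a] ++ crash ++ l₂).map (Protocol.assign x) = l ++ [a] ++ crash ++ l₂ :=
      map_assign_append (map_assign_append hass₁ fun b hb => (hcrashNW b hb).1) hNW₂
    have halw₂ : Always (fun τ => ∀ c, NoPayload c τ) σ₂ l₂ := fun l₃ l₄ e =>
      hleak l₃ (fun b hb => hl₂ b (by simp [e, hb])) fun l₅ b l₆ e' =>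
        hnv l₅ fun b hb => hl₂ b (by simp [e, e', hb])
    set σ₃ := run P.initialState (l ++ [a] ++ crash ++ l₂) with hσ₃
    have hrun₃ : σ₃ = run σ₂ l₂ := by rw [hσ₃, run_append, hrun₂]
    have hm₃ : m ∉ writers σ₃ := by
      have := Execution.notMem_writers_of_terminates hact₃ hterm (fun k hk v hv => ?_) hj
      · change m ∉ writers (trajectory _ _ _) at this
        rwa [trajectory_extend_length] at this
      · have := extend_append_noWrite (P := P) (l := l ++ [a]) (l' := crash ++ l₂)
          (as := idleSchedule N V)
          (fun n => Action.IsControlled.noWrite (idleSchedule_controlled n)) (fun b hb => by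
            rcases List.mem_append.1 hb with hb | hb
            · exact (hcrashNW b hb).1
            · exact hNW₂ b hb) (by rw [← List.append_assoc]; exact hv)
        simp at this
        omega
    have hmute₃ : ∀ c, Mute c σ₃ := by
      intro c
      by_cases hcm : c = m
      · subst hcm
        refine mute_of_idle hm₃ ?_
        rw [hrun₃]; exact halw₂.last c
      · rw [hrun₃]
        exact run_preserves (hmute c hcm) fun b hb _ _ hτ st => step_mute
          (fun v => hNW₂ b hb c v) hτ st
    have hid : (σ₃.client (m + 1)).activity = .idle := by
      refine idle_of_notMem_writers (noReads_run hNR₃) fun hc => ?_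
      rw [← hσ₃, hrun₃] at hc
      have hc := run_writers hNW₂ hc
      rw [writers, hcl₂] at hc
      have := hwr hc
      simp at this
    have hcc₃ : m + 1 ∉ σ₃.crashedClients := by
      rw [hrun₃, run_crashedClients hl₂, hcc₂]
      omega
    obtain ⟨l₄, hNW₄, hNC₄, v, hen⟩ := exists_read_returns hW hval₃.bounded hval₃.crashes hcc₃ hid
    have hcs₄ : (run P.initialState (l ++ [a] ++ crash ++ l₂ ++ l₄)).crashedServers.encard ≤ f := by
      rw [run_append, run_crashedServers hNC₄, hcs₃]; simp
    have hl0 : l.length ≠ 0 := by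
      obtain ⟨_, _, h1, -⟩ := h.valid.history.returned
      omega
    obtain ⟨c, hc1, hcm, rfl⟩ := hval₃.returnRead_of_terminates hP (noReads_run hNR₃) hNW₄ hcs₄ hen
      hact₃ hl0 hterm hj
    refine hval₃.ne_of_noPayload hP hass₃ hNR₃ (by omega) (j := c) ?_
      (fun d hd e => hinj d c (by omega) (by omega) e) (hy c (by omega)) (K := ∅) (by simp)
      ⟨l₄, hNW₄, blindRun_of_mute hNW₄ fun c _ => hmute₃ c, ?_, m + 1, ?_⟩ rfl
    · refine Always.append (Always.append (Always.append (h.always_noPayload c hc1) ?_) ?_) ?_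
      · intro l₁ l₂ e
        rcases List.cons_eq_append_iff.1 e with ⟨rfl, -⟩ | ⟨l₃, rfl, e'⟩
        · exact h.noPayload c
        · obtain ⟨rfl, rfl⟩ := List.nil_eq_append_iff.1 e'
          rw [← run_append]
          exact hnp₁ c
      · refine always_preserves (hnp₁ c) fun b hb σ τ hσ st => ?_
        obtain ⟨c, -, rfl⟩ := List.mem_map.1 hb
        cases st
        exact hσ
      · rw [hrun₂]
        exact halw₂.mono fun τ hτ => hτ c
    · rw [← run_append]; exact hcs₄
    · rw [← run_append]; exact hen

/-- All writers can be brought to the phase that sends the value. -/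
theorem exists_prepared [Countable V] {f ν : ℕ} (hν : 2 ≤ ν) (hP : P.EmulatesAtomic f ν)
    (hW : P.ConcurrencyWaitFree f ν) {x : ℕ → V}
    (hinj : ∀ c d, c < ν → d < ν → x c = x d → c = d) {y : V} (hy : ∀ c, c < ν → y ≠ x c) :
    ∃ l, P.Prepared f ν x ν l := by
  have key : ∀ m, 1 ≤ m → m ≤ ν → ∃ l, P.Prepared f ν x m l := by
    intro m hm
    induction m, hm using Nat.le_induction with
    | base => exact fun _ => exists_prepared_one hν hW x
    | succ m hm ih =>
      intro hmν
      obtain ⟨l, hl⟩ := ih (by omega)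
      exact hl.exists_succ hP hW hm hmν hinj hy
  exact key ν (by omega) le_rfl

/-! ### Delivering values -/

/-- The state of affairs while the values of the writes of the clients `1, …, ν - 1` are being
delivered: no value is in transit, since each one is received as soon as it is sent. -/
structure Poised (ν : ℕ) (x : ℕ → V) (num : ℕ → ℕ) (σ : P.State) : Prop where
  noReads : NoReads σ
  crashedClients : σ.crashedClients = ∅
  noPayload : ∀ c, NoPayload c σ
  idle : ∀ c, c = 0 ∨ ν ≤ c → (σ.client c).activity = .idle
  writing : ∀ c, 1 ≤ c → c < ν → (∃ w, (σ.client c).activity =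
    .writing (x c) w (fun _ => none) ∧ P.stage w = .value) ∧ (σ.client c).number = num c

/-- The actions by which values are delivered, and crashes of servers. -/
def IsDelivery : Action N V → Prop
  | .send _ _ => True
  | .serverReceive _ _ _ => True
  | .crashServer _ => True
  | _ => False

theorem IsDelivery.noWrite {a : Action N V} (h : IsDelivery a) : a.NoWrite := by
  rintro c v rfl; exact h

theorem IsDelivery.noRead {a : Action N V} (h : IsDelivery a) : a.NoRead := by
  rintro c rfl; exact h

theorem step_delivery {a : Action N V} (ha : IsDelivery a) {σ τ : P.State} (st : P.Step a σ τ) :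
    τ.crashedClients = σ.crashedClients ∧ ∀ c, (τ.client c).activity = (σ.client c).activity ∧
      (τ.client c).number = (σ.client c).number ∧ (τ.client c).unsent ⊆ (σ.client c).unsent := by
  cases st with
  | send _ c s q hc hs hq =>
    refine ⟨rfl, fun c' => ?_⟩
    change ((σ.setClient c _).client c').activity = _ ∧ ((σ.setClient c _).client c').number = _ ∧
      ((σ.setClient c _).client c').unsent ⊆ _
    rw [setClient_client]
    split_ifs with e
    · subst e
      exact ⟨rfl, rfl, Finset.erase_subset _ _⟩
    · exact ⟨rfl, rfl, subset_rfl⟩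
  | serverReceive => exact ⟨rfl, fun c' => ⟨rfl, rfl, subset_rfl⟩⟩
  | crashServer => exact ⟨rfl, fun c' => ⟨rfl, rfl, subset_rfl⟩⟩
  | _ => exact absurd ha id

theorem run_delivery {l : List (Action N V)} (hl : ∀ a ∈ l, IsDelivery a) (σ : P.State) :
    (run σ l).crashedClients = σ.crashedClients ∧
      ∀ c, ((run σ l).client c).activity = (σ.client c).activity ∧
      ((run σ l).client c).number = (σ.client c).number ∧
      ((run σ l).client c).unsent ⊆ (σ.client c).unsent :=
  run_preserves (p := fun τ => τ.crashedClients = σ.crashedClients ∧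
      ∀ c, (τ.client c).activity = (σ.client c).activity ∧
      (τ.client c).number = (σ.client c).number ∧
      (τ.client c).unsent ⊆ (σ.client c).unsent) ⟨rfl, fun _ => ⟨rfl, rfl, subset_rfl⟩⟩
    fun a ha _ _ h st => by
      obtain ⟨h1, h2⟩ := step_delivery (hl a ha) st
      exact ⟨h1.trans h.1, fun c => ⟨(h2 c).1.trans (h.2 c).1, (h2 c).2.1.trans (h.2 c).2.1,
        (h2 c).2.2.trans (h.2 c).2.2⟩⟩

theorem Poised.run {ν : ℕ} {x : ℕ → V} {num : ℕ → ℕ} {σ : P.State} (h : Poised ν x num σ)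
    {l : List (Action N V)} (hl : ∀ a ∈ l, IsDelivery a)
    (hp : ∀ c, NoPayload c (Protocol.run σ l)) : Poised ν x num (Protocol.run σ l) := by
  obtain ⟨h1, h2⟩ := run_delivery hl σ
  refine ⟨run_preserves h.noReads fun a ha _ _ hτ st => step_noReads (hl a ha).noRead hτ st,
    h1.trans h.crashedClients, hp, fun c hc => (h2 c).1.trans (h.idle c hc), fun c hc hcν => ?_⟩
  rw [(h2 c).1, (h2 c).2.1]
  exact h.writing c hc hcν

/-- The values of the clients in `J` are sent to server `s` and received there. -/
def deliver (num : ℕ → ℕ) (J : List ℕ) (s : Fin N) : List (Action N V) :=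
  J.flatMap fun c => [.send c s, .serverReceive c s (num c)]

/-- The values of the clients in `J` are delivered to the servers `a, …, b - 1`. -/
def segment (num : ℕ → ℕ) (J : List ℕ) (a b : ℕ) : List (Action N V) :=
  (List.range' a (b - a)).flatMap fun k => if h : k < N then deliver num J ⟨k, h⟩ else []

/-- The crash of server `t - 1`, if there is one. -/
def crashBefore (t : ℕ) : List (Action N V) :=
  if h : 0 < t ∧ t ≤ N then [.crashServer ⟨t - 1, by omega⟩] else []

/-- The values of the clients in `J` are delivered to the servers `a, …, t - 1`, and server `t - 1`
crashes. -/
def advance (num : ℕ → ℕ) (J : List ℕ) (a t : ℕ) : List (Action N V) :=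
  segment num J a t ++ crashBefore t

theorem mem_deliver {num : ℕ → ℕ} {J : List ℕ} {s : Fin N} {a : Action N V} :
    a ∈ deliver num J s ↔ ∃ c ∈ J, a = .send c s ∨ a = .serverReceive c s (num c) := by
  simp [deliver]

theorem mem_segment {num : ℕ → ℕ} {J : List ℕ} {a b : ℕ} {x : Action N V} :
    x ∈ segment num J a b ↔ ∃ s : Fin N, a ≤ s ∧ s < b ∧ x ∈ deliver num J s := by
  simp only [segment, List.mem_flatMap, List.mem_range'_1]
  constructor
  · rintro ⟨k, hk, hx⟩
    split_ifs at hx with h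
    · exact ⟨⟨k, h⟩, hk.1, by simp; omega, hx⟩
    · simp at hx
  · rintro ⟨s, h1, h2, hx⟩
    exact ⟨s, ⟨h1, by omega⟩, by rw [dif_pos s.2]; exact hx⟩

theorem segment_succ {num : ℕ → ℕ} {J : List ℕ} {a : ℕ} {d : Fin N} (h : a ≤ d) :
    (segment num J a (d + 1) : List (Action N V)) = segment num J a d ++ deliver num J d := by
  have : (d : ℕ) + 1 - a = (d - a) + 1 := by omega
  rw [segment, segment, this, List.range'_1_concat, List.flatMap_append]
  have h2 : a + (d - a) = (d : ℕ) := by omega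
  simp [h2]

theorem mem_crashBefore {t : ℕ} {x : Action N V} :
    x ∈ crashBefore t ↔ ∃ s : Fin N, (s : ℕ) + 1 = t ∧ x = .crashServer s := by
  unfold crashBefore
  split_ifs with h
  · rw [List.mem_singleton]
    constructor
    · rintro rfl
      exact ⟨⟨t - 1, by omega⟩, by simp; omega, rfl⟩
    · rintro ⟨s, hs, rfl⟩
      congr 1
      ext
      simp
      omega
  · simp only [List.not_mem_nil, false_iff, not_exists, not_and]
    intro s hs
    have := s.2
    omega

theorem isDelivery_segment {num : ℕ → ℕ} {J : List ℕ} {a t : ℕ} :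
    ∀ x ∈ (segment num J a t : List (Action N V)), IsDelivery x := by
  intro x hx
  obtain ⟨s, -, -, hx⟩ := mem_segment.1 hx
  obtain ⟨c, -, rfl | rfl⟩ := mem_deliver.1 hx <;> trivial

theorem isDelivery_crashBefore {t : ℕ} :
    ∀ x ∈ (crashBefore t : List (Action N V)), IsDelivery x := by
  intro x hx
  obtain ⟨s, -, rfl⟩ := mem_crashBefore.1 hx
  trivial

theorem isDelivery_advance {num : ℕ → ℕ} {J : List ℕ} {a t : ℕ} :
    ∀ x ∈ (advance num J a t : List (Action N V)), IsDelivery x := by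
  intro x hx
  rcases List.mem_append.1 hx with hx | hx
  · exact isDelivery_segment x hx
  · exact isDelivery_crashBefore x hx

theorem receive_mem_segment {num : ℕ → ℕ} {J : List ℕ} {a t c n : ℕ} {s : Fin N}
    (h : Action.serverReceive c s n ∈ (segment num J a t : List (Action N V))) :
    c ∈ J ∧ a ≤ s ∧ s < t := by
  obtain ⟨s', h1, h2, hx⟩ := mem_segment.1 h
  obtain ⟨c', hc, e | e⟩ := mem_deliver.1 hx
  · cases e
  · cases e
    exact ⟨hc, h1, h2⟩

theorem receive_mem_advance {num : ℕ → ℕ} {J : List ℕ} {a t c n : ℕ} {s : Fin N}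
    (h : Action.serverReceive c s n ∈ (advance num J a t : List (Action N V))) :
    c ∈ J ∧ a ≤ s ∧ s < t := by
  rcases List.mem_append.1 h with h | h
  · exact receive_mem_segment h
  · obtain ⟨s, -, e⟩ := mem_crashBefore.1 h
    cases e

/-- A value that is sent to a live server and received at once does not remain in transit. -/
theorem noPayload_send_receive {σ : P.State} {c n : ℕ} {s : Fin N} (h : ∀ c', NoPayload c' σ)
    (hn : (σ.client c).number = n) (hs : s ∉ σ.crashedServers) :
    ∀ c', NoPayload c' (run σ [.send c s, .serverReceive c s n]) := by
  have key : ∀ τ : P.State, (∀ c', NoPayload c' τ) →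
      ∀ c', NoPayload c' (exec (.serverReceive c s n) τ) := by
    intro τ hτ
    refine exec_preserves (p := fun τ => ∀ c', NoPayload c' τ) hτ fun τ' st c' s' n' q p => ?_
    cases st
    simp only [setMessage]
    split_ifs
    · simp
    · exact hτ _ _ _ _ _
  rw [run_cons, run_cons, run_nil]
  by_cases hen : ∃ τ, P.Step (.send c s) σ τ
  · obtain ⟨τ, st⟩ := hen
    rw [exec_of_step st]
    cases st with
    | send _ _ _ q hc hs' hq =>
      have st' := Step.serverReceive (P := P)
        { σ.setClient c { σ.client c with unsent := (σ.client c).unsent.erase s } with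
          requests := setMessage σ.requests c s (σ.client c).number (some q) } c s n q hs
          (by simp [setMessage, hn])
      rw [exec_of_step st']
      intro c' s' n' q' p'
      simp only [setMessage]
      split_ifs with h1 h2
      · simp
      · rw [hn] at h2
        exact absurd h2 h1
      · exact h _ _ _ _ _
  · rw [exec_of_not_enabled hen]
    exact key σ h

theorem Poised.deliver {ν : ℕ} {x : ℕ → V} {num : ℕ → ℕ} {J : List ℕ}
    (hJ : ∀ c ∈ J, 1 ≤ c ∧ c < ν) {s : Fin N} {σ : P.State} (h : Poised ν x num σ)
    (hs : s ∉ σ.crashedServers) :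
    Poised ν x num (Protocol.run σ (Protocol.deliver num J s)) := by
  induction J generalizing σ with
  | nil => exact h
  | cons c J ih =>
    rw [Protocol.deliver, List.flatMap_cons, run_append]
    refine ih (fun c hc => hJ c (by simp [hc])) (h.run ?_ (noPayload_send_receive h.noPayload
      (h.writing c (hJ c (by simp)).1 (hJ c (by simp)).2).2 hs)) ?_
    · intro a ha
      simp only [List.mem_cons, List.not_mem_nil, or_false] at ha
      rcases ha with rfl | rfl <;> trivial
    · rw [run_crashedServers]
      · exact hs
      · intro a ha
        simp only [List.mem_cons, List.not_mem_nil, or_false] at ha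
        rcases ha with rfl | rfl <;> rintro _ ⟨⟩

theorem segment_noCrash {num : ℕ → ℕ} {J : List ℕ} {a t : ℕ} :
    ∀ x ∈ (segment num J a t : List (Action N V)), x.NoCrash := by
  intro x hx
  obtain ⟨s, -, -, hx⟩ := mem_segment.1 hx
  obtain ⟨c, -, rfl | rfl⟩ := mem_deliver.1 hx <;> rintro _ ⟨⟩

theorem Poised.segment {ν : ℕ} {x : ℕ → V} {num : ℕ → ℕ} {J : List ℕ}
    (hJ : ∀ c ∈ J, 1 ≤ c ∧ c < ν) {a : ℕ} (t : ℕ) {σ : P.State} (h : Poised ν x num σ)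
    (hs : ∀ s ∈ σ.crashedServers, (s : ℕ) < a) :
    Poised ν x num (Protocol.run σ (Protocol.segment num J a t)) := by
  unfold Protocol.segment
  generalize t - a = n
  induction n generalizing a σ with
  | zero => exact h
  | succ n ih =>
    rw [List.range'_succ, List.flatMap_cons, run_append]
    have key : Poised ν x num (Protocol.run σ
        (if h : a < N then Protocol.deliver num J ⟨a, h⟩ else [])) ∧
        (Protocol.run σ (if h : a < N then Protocol.deliver num J ⟨a, h⟩ else [])).crashedServers =
          σ.crashedServers := by
      split_ifs with ha
      · refine ⟨h.deliver hJ fun h' => lt_irrefl _ (hs _ h'), run_crashedServers fun b hb => ?_⟩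
        obtain ⟨c, -, rfl | rfl⟩ := mem_deliver.1 hb <;> rintro _ ⟨⟩
      · exact ⟨h, rfl⟩
    refine ih key.1 fun s hs' => ?_
    rw [key.2] at hs'
    have := hs s hs'
    omega

theorem Poised.crashBefore {ν : ℕ} {x : ℕ → V} {num : ℕ → ℕ} (t : ℕ) {σ : P.State}
    (h : Poised ν x num σ) : Poised ν x num (Protocol.run σ (Protocol.crashBefore t)) := by
  refine h.run isDelivery_crashBefore (run_preserves (p := fun τ => ∀ c, NoPayload c τ) h.noPayload
    fun a ha _ _ hτ st => ?_)
  obtain ⟨s, -, rfl⟩ := mem_crashBefore.1 ha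
  cases st
  exact hτ

theorem Poised.advance {ν : ℕ} {x : ℕ → V} {num : ℕ → ℕ} {J : List ℕ}
    (hJ : ∀ c ∈ J, 1 ≤ c ∧ c < ν) {a : ℕ} (t : ℕ) {σ : P.State} (h : Poised ν x num σ)
    (hs : ∀ s ∈ σ.crashedServers, (s : ℕ) < a) :
    Poised ν x num (Protocol.run σ (Protocol.advance num J a t)) := by
  rw [Protocol.advance, run_append]
  exact (h.segment hJ t hs).crashBefore t

theorem run_crashBefore_crashedServers (σ : P.State) (t : ℕ) :
    (run σ (crashBefore t)).crashedServers = σ.crashedServers ∪ {s | (s : ℕ) + 1 = t} := by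
  unfold crashBefore
  split_ifs with h
  · rw [run_cons, run_nil, exec_of_step (.crashServer σ _)]
    ext s
    have : (s : ℕ) = t - 1 ↔ (s : ℕ) + 1 = t := by omega
    simp only [Set.mem_insert_iff, Set.mem_union, Set.mem_ofPred_eq, Fin.ext_iff, this, or_comm]
  · ext s
    have : ¬ (s : ℕ) + 1 = t := by have := s.2; omega
    simp only [run_nil, Set.mem_union, Set.mem_ofPred_eq, this, or_false]

theorem run_advance_crashedServers (σ : P.State) (num : ℕ → ℕ) (J : List ℕ) (a t : ℕ) :
    (run σ (advance num J a t)).crashedServers = σ.crashedServers ∪ {s | (s : ℕ) + 1 = t} := by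
  rw [advance, run_append, run_crashBefore_crashedServers, run_crashedServers segment_noCrash]

theorem run_advance_encard (σ : P.State) (num : ℕ → ℕ) (J : List ℕ) (a t : ℕ) :
    (run σ (advance num J a t)).crashedServers.encard ≤ σ.crashedServers.encard + 1 := by
  rw [run_advance_crashedServers]
  refine (Set.encard_union_le _ _).trans (add_le_add le_rfl ?_)
  refine Set.encard_le_one_iff.2 fun s s' hs hs' => ?_
  simp only [Set.mem_ofPred_eq] at hs hs'
  ext
  omega

theorem Poised.notMem_unsent {ν : ℕ} {x : ℕ → V} {num : ℕ → ℕ} {σ : P.State}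
    (h : Poised ν x num σ) {l : List (Action N V)} (hl : ∀ a ∈ l, IsDelivery a) {c : ℕ}
    (hc : 1 ≤ c) (hcν : c < ν) {s : Fin N} (hs : Action.send c s ∈ l) :
    s ∉ ((Protocol.run σ l).client c).unsent := by
  obtain ⟨l₁, l₂, rfl⟩ := List.append_of_mem hs
  rw [run_append, run_cons]
  intro hmem
  have h2 := ((run_delivery (fun a ha => hl a (by simp [ha])) _).2 c).2.2 hmem
  obtain ⟨h3, h4⟩ := run_delivery (l := l₁) (fun a ha => hl a (by simp [ha])) σ
  obtain ⟨⟨w, hw, -⟩, -⟩ := h.writing c hc hcν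
  by_cases hun : s ∈ ((Protocol.run σ l₁).client c).unsent
  · have st := Step.send (Protocol.run σ l₁) c s _ (by rw [h3, h.crashedClients]; simp) hun
      (by rw [(h4 c).1, hw]; rfl)
    rw [exec_of_step st] at h2
    simp [State.setClient] at h2
  · rw [exec_of_not_enabled] at h2
    · exact hun h2
    · rintro ⟨τ, st⟩
      cases st
      exact hun ‹_›

/-! ### The critical points -/

/-- The writers whose values are still being delivered, if those named in `p` have been stopped. -/
def active (ν : ℕ) (p : List (Fin N × ℕ)) : List ℕ :=
  (List.range' 1 (ν - 1)).filter fun c => c ∉ p.map Prod.snd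

/-- The first server that has not been dealt with. -/
def position : List (Fin N × ℕ) → ℕ
  | [] => 0
  | (d, _) :: _ => d

/-- The schedule with given critical servers and stopped writers, the latest one first: values of
all active writers are delivered to the servers one after the other. Before a critical server `d`,
server `d - 1` crashes, and one of the writers is stopped. -/
def schedule (num : ℕ → ℕ) (ν : ℕ) : List (Fin N × ℕ) → List (Action N V)
  | [] => []
  | (d, _) :: q => schedule num ν q ++ advance num (active ν q) (position q) d

theorem mem_active {ν c : ℕ} {p : List (Fin N × ℕ)} :
    c ∈ active ν p ↔ 1 ≤ c ∧ c < ν ∧ c ∉ p.map Prod.snd := by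
  simp only [active, List.mem_filter, List.mem_range'_1, decide_eq_true_eq]
  constructor
  · rintro ⟨h1, h2⟩; exact ⟨h1.1, by omega, h2⟩
  · rintro ⟨h1, h2, h3⟩; exact ⟨⟨h1, by omega⟩, h3⟩

theorem mem_active_cons {ν c j : ℕ} {d : Fin N} {q : List (Fin N × ℕ)} :
    c ∈ active ν ((d, j) :: q) ↔ c ∈ active ν q ∧ c ≠ j := by
  simp only [mem_active, List.map_cons, List.mem_cons]
  tauto

theorem active_bounds {ν : ℕ} {p : List (Fin N × ℕ)} : ∀ c ∈ active ν p, 1 ≤ c ∧ c < ν :=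
  fun _ hc => ⟨(mem_active.1 hc).1, (mem_active.1 hc).2.1⟩

/-- The active writers other than `j`. -/
def others (ν : ℕ) (p : List (Fin N × ℕ)) (j : ℕ) : Set ℕ := {c | c ∈ active ν p ∧ c ≠ j}

/-- The critical servers come in order, and each writer is stopped at most once. -/
def Admissible (ν : ℕ) : List (Fin N × ℕ) → Prop
  | [] => True
  | (d, j) :: q => Admissible ν q ∧ position q ≤ d ∧ j ∈ active ν q

theorem isDelivery_schedule {num : ℕ → ℕ} {ν : ℕ} {p : List (Fin N × ℕ)} :
    ∀ a ∈ (schedule num ν p : List (Action N V)), IsDelivery a := by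
  induction p with
  | nil => simp [schedule]
  | cons e q ih =>
    obtain ⟨d, j⟩ := e
    intro a ha
    rcases List.mem_append.1 ha with ha | ha
    · exact ih a ha
    · exact isDelivery_advance a ha

theorem receive_mem_schedule {num : ℕ → ℕ} {ν : ℕ} {p : List (Fin N × ℕ)} (hp : Admissible ν p)
    {c n : ℕ} {s : Fin N} (h : Action.serverReceive c s n ∈ (schedule num ν p : List (Action N V))) :
    s < position p := by
  induction p with
  | nil => simp [schedule] at h
  | cons e q ih =>
    obtain ⟨d, j⟩ := e
    rcases List.mem_append.1 h with h | h
    · exact lt_of_lt_of_le (ih hp.1 h) hp.2.1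
    · exact (receive_mem_advance h).2.2

theorem schedule_crashedServers {num : ℕ → ℕ} {ν : ℕ} {p : List (Fin N × ℕ)}
    (hp : Admissible ν p) {σ : P.State} (hσ : σ.crashedServers = ∅) :
    (∀ s ∈ (run σ (schedule num ν p)).crashedServers, (s : ℕ) < position p) ∧
      (run σ (schedule num ν p)).crashedServers.encard ≤ p.length := by
  induction p with
  | nil => simp [schedule, hσ]
  | cons e q ih =>
    obtain ⟨d, j⟩ := e
    obtain ⟨h1, h2⟩ := ih hp.1
    have hle := hp.2.1
    rw [schedule, run_append]
    refine ⟨fun s hs => ?_, ?_⟩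
    · rw [run_advance_crashedServers] at hs
      rcases hs with hs | hs
      · exact lt_of_lt_of_le (h1 s hs) hle
      · simp only [Set.mem_ofPred_eq] at hs
        simp only [position]
        omega
    · refine (run_advance_encard _ _ _ _ _).trans ?_
      rw [List.length_cons, Nat.cast_add, Nat.cast_one]
      exact add_le_add h2 le_rfl

theorem Poised.schedule {ν : ℕ} {x : ℕ → V} {num : ℕ → ℕ} {p : List (Fin N × ℕ)}
    (hp : Admissible ν p) {σ : P.State} (h : Poised ν x num σ) (hσ : σ.crashedServers = ∅) :
    Poised ν x num (Protocol.run σ (Protocol.schedule num ν p)) := by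
  induction p with
  | nil => exact h
  | cons e q ih =>
    obtain ⟨d, j⟩ := e
    rw [Protocol.schedule, run_append]
    exact (ih hp.1).advance active_bounds _ (schedule_crashedServers hp.1 hσ).1

/-- The values of active writers have been delivered to all servers before the position. -/
theorem Poised.notMem_unsent_schedule {ν : ℕ} {x : ℕ → V} {num : ℕ → ℕ} {p : List (Fin N × ℕ)}
    (hp : Admissible ν p) {σ : P.State} (h : Poised ν x num σ) (hσ : σ.crashedServers = ∅) {c : ℕ}
    (hc : c ∈ active ν p) {s : Fin N} (hs : s < position p) :
    s ∉ ((Protocol.run σ (Protocol.schedule num ν p)).client c).unsent := by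
  induction p with
  | nil => simp [position] at hs
  | cons e q ih =>
    obtain ⟨d, j⟩ := e
    rw [Protocol.schedule, run_append]
    have hc' := (mem_active_cons.1 hc).1
    rcases Nat.lt_or_ge s (position q) with h1 | h1
    · exact fun hm => ih hp.1 hc' h1 (((run_delivery isDelivery_advance _).2 c).2.2 hm)
    · refine (h.schedule hp.1 hσ).notMem_unsent isDelivery_advance (active_bounds c hc').1
        (active_bounds c hc').2 (List.mem_append_left _ (mem_segment.2 ⟨s, h1, hs,
          mem_deliver.2 ⟨c, hc', .inl rfl⟩⟩))

theorem blindRun_of_receive {K : Set ℕ} {σ : P.State} {l : List (Action N V)}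
    (h : ∀ c s n, Action.serverReceive c s n ∈ l → c ∈ K) : BlindRun ∅ K σ l := by
  rintro l₁ a l₂ rfl c s n rfl -
  exact ⟨by simp, fun _ hc => absurd (h c s n (by simp)) hc⟩

/-- All writes prepared, and the numbers of their phases. -/
structure Setup (P : Protocol N V) (f ν : ℕ) (x : ℕ → V) (num : ℕ → ℕ) (l : List (Action N V)) :
    Prop where
  prepared : P.Prepared f ν x ν l
  poised : Poised ν x num (run P.initialState l)

theorem Prepared.setup {f ν : ℕ} {x : ℕ → V} {l : List (Action N V)} (h : P.Prepared f ν x ν l) :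
    P.Setup f ν x (fun c => ((run P.initialState l).client c).number) l := by
  refine ⟨h, h.noReads, h.crashedClients, h.noPayload, h.idle, fun c hc hcν => ⟨?_, rfl⟩⟩
  obtain ⟨v, w, h1, h2, -⟩ := h.ready c hc hcν
  have hv : HasValues x (run P.initialState l) := by
    refine run_preserves (fun c v w rep hx => by simp [initialState] at hx)
      fun a ha _ _ hτ st => step_hasValues (fun c v e => ?_) hτ st
    subst e
    have h3 := h.assigned
    have h4 := List.map_eq_map_iff.1 (h3.trans (List.map_id l).symm) _ ha
    simp only [Protocol.assign, id, Action.invokeWrite.injEq, true_and] at h4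
    exact h4.symm
  obtain rfl := hv c _ _ _ h1
  exact ⟨w, h1, h2⟩

theorem Setup.assign {f ν : ℕ} {x : ℕ → V} {num : ℕ → ℕ} {l : List (Action N V)}
    (h : P.Setup f ν x num l) (x' : ℕ → V) : P.Setup f ν x' num (l.map (Protocol.assign x')) := by
  have h1 := (h.prepared.assign x').setup
  have hs := run_assign_sim (P := P) h.prepared.assigned h.prepared.noRead x'
  refine ⟨h1.prepared, h1.poised.noReads, h1.poised.crashedClients, h1.poised.noPayload,
    h1.poised.idle, fun c hc hcν => ⟨(h1.poised.writing c hc hcν).1, ?_⟩⟩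
  rw [← (hs.client c).number]
  exact (h.poised.writing c hc hcν).2

/-- The state at which the values of the active writers have been delivered to the servers before
`t`, and server `t - 1` has crashed. -/
noncomputable def probe (P : Protocol N V) (num : ℕ → ℕ) (ν : ℕ) (l : List (Action N V))
    (q : List (Fin N × ℕ)) (t : ℕ) : P.State :=
  run P.initialState (l ++ (schedule num ν q ++ advance num (active ν q) (position q) t))

/-- The state after the schedule. -/
noncomputable def final (P : Protocol N V) (num : ℕ → ℕ) (ν : ℕ) (l : List (Action N V))
    (q : List (Fin N × ℕ)) : P.State :=
  run P.initialState (l ++ schedule num ν q)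

theorem final_cons (num : ℕ → ℕ) (ν : ℕ) (l : List (Action N V)) (d : Fin N) (j : ℕ)
    (q : List (Fin N × ℕ)) : P.final num ν l ((d, j) :: q) = P.probe num ν l q d := rfl

theorem probe_eq (num : ℕ → ℕ) (ν : ℕ) (l : List (Action N V)) (q : List (Fin N × ℕ)) (t : ℕ) :
    P.probe num ν l q t = run (P.final num ν l q) (advance num (active ν q) (position q) t) := by
  rw [probe, final, ← List.append_assoc, run_append]

/-- The critical servers and the stopped writers for the values `x`, the latest ones first. In the
probe at `d`, no read returns the value of a writer without further help of this writer, even if the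
other writers that have not been stopped help; in the probe at `d + 1`, where server `d` has
crashed, the value of `j` can be returned in this way. -/
def Critical (P : Protocol N V) (f ν : ℕ) (x : ℕ → V) (num : ℕ → ℕ) (l : List (Action N V)) :
    List (Fin N × ℕ) → Prop
  | [] => True
  | (d, j) :: q => Critical P f ν x num l q ∧ position q ≤ d ∧ j ∈ active ν q ∧
      (∀ i, 1 ≤ i → i < ν → x i ∉ returnable f (others ν ((d, j) :: q) i)
        (P.final num ν l ((d, j) :: q))) ∧
      x j ∈ returnable f (others ν q j) (P.probe num ν l q (d + 1))

theorem Critical.admissible {f ν : ℕ} {x : ℕ → V} {num : ℕ → ℕ} {l : List (Action N V)}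
    {p : List (Fin N × ℕ)} (h : P.Critical f ν x num l p) : Admissible ν p := by
  induction p with
  | nil => trivial
  | cons e q ih =>
    obtain ⟨d, j⟩ := e
    exact ⟨ih h.1, h.2.1, h.2.2.1⟩

section

variable {f ν : ℕ} {x : ℕ → V} {num : ℕ → ℕ} {l : List (Action N V)}

theorem Setup.probe_poised (h : P.Setup f ν x num l) {q : List (Fin N × ℕ)}
    (hq : Admissible ν q) (t : ℕ) : Poised ν x num (P.probe num ν l q t) := by
  rw [probe_eq, final, run_append]
  exact (h.poised.schedule hq h.prepared.crashedServers).advance active_bounds _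
    (schedule_crashedServers hq h.prepared.crashedServers).1

theorem Setup.final_poised (h : P.Setup f ν x num l) {q : List (Fin N × ℕ)}
    (hq : Admissible ν q) : Poised ν x num (P.final num ν l q) := by
  rw [final, run_append]
  exact h.poised.schedule hq h.prepared.crashedServers

theorem Setup.final_encard (h : P.Setup f ν x num l) {q : List (Fin N × ℕ)}
    (hq : Admissible ν q) : (P.final num ν l q).crashedServers.encard ≤ q.length := by
  rw [final, run_append]
  exact (schedule_crashedServers hq h.prepared.crashedServers).2

theorem Setup.probe_encard (h : P.Setup f ν x num l) {q : List (Fin N × ℕ)}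
    (hq : Admissible ν q) (t : ℕ) :
    (P.probe num ν l q t).crashedServers.encard ≤ q.length + 1 := by
  rw [probe_eq]
  exact (run_advance_encard _ _ _ _ _).trans (add_le_add (h.final_encard hq) le_rfl)

theorem Setup.final_valid (h : P.Setup f ν x num l) {q : List (Fin N × ℕ)}
    (hq : Admissible ν q) (hf : q.length ≤ f) :
    P.Valid f ν x ν (l ++ schedule num ν q) := by
  refine h.prepared.valid.append (fun a ha => (isDelivery_schedule a ha).noWrite)
    ((h.final_encard hq).trans ?_)
  exact_mod_cast hf

theorem Setup.probe_valid (h : P.Setup f ν x num l) {q : List (Fin N × ℕ)}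
    (hq : Admissible ν q) (hf : q.length + 1 ≤ f) (t : ℕ) :
    P.Valid f ν x ν (l ++ (schedule num ν q ++ advance num (active ν q) (position q) t)) := by
  refine h.prepared.valid.append (fun a ha => ?_) ((h.probe_encard hq t).trans ?_)
  · rcases List.mem_append.1 ha with ha | ha
    · exact (isDelivery_schedule a ha).noWrite
    · exact (isDelivery_advance a ha).noWrite
  · exact_mod_cast hf

/-- What reads may return after the delivery of values of active writers, they might have returned
before, if the same writers helped. -/
theorem returnable_probe_subset {q : List (Fin N × ℕ)} {K : Set ℕ} (hK : ∀ c ∈ active ν q, c ∈ K)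
    (t : ℕ) : returnable f K (P.probe num ν l q t) ⊆ returnable f K (P.final num ν l q) := by
  rw [probe_eq]
  exact returnable_run_subset (fun a ha => (isDelivery_advance a ha).noWrite)
    (blindRun_of_receive fun c s n hm => hK c (receive_mem_advance hm).1)

/-- Without further help of writer `i`, the value of `i` cannot be returned. -/
theorem Setup.notMem_returnable (h : P.Setup f ν x num l) (hP : P.EmulatesAtomic f ν)
    (hν : 2 ≤ ν) (hinj : ∀ c d, c < ν → d < ν → x c = x d → c = d) {y : V}
    (hy : ∀ c, c < ν → y ≠ x c) {q : List (Fin N × ℕ)} (hq : P.Critical f ν x num l q) {i : ℕ}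
    (hi : 1 ≤ i) (hiν : i < ν) :
    x i ∉ returnable f (others ν q i) (P.final num ν l q) := by
  match q, hq with
  | [], _ =>
    intro hm
    rw [final, schedule, List.append_nil] at hm
    exact h.prepared.valid.ne_of_noPayload hP h.prepared.assigned h.prepared.noRead (by omega)
      (h.prepared.always_noPayload i hi) (fun c hc e => hinj c i hc hiν e) (hy i hiν)
      (K := others ν [] i) (fun h => h.2 rfl) hm rfl
  | (d, j) :: q, hq => exact hq.2.2.2.1 i hi hiν

theorem others_of_notMem {q : List (Fin N × ℕ)} {i : ℕ} (hi : i ∉ active ν q) :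
    others ν q i = {c | c ∈ active ν q} := by
  ext c
  simp only [others, Set.mem_ofPred_eq, and_iff_left_iff_imp]
  rintro hc rfl
  exact hi hc

/-- Values of stopped writers cannot be returned any more. -/
theorem Setup.mem_active_of_returnable (h : P.Setup f ν x num l) (hP : P.EmulatesAtomic f ν)
    (hν : 2 ≤ ν) (hinj : ∀ c d, c < ν → d < ν → x c = x d → c = d) {y : V}
    (hy : ∀ c, c < ν → y ≠ x c) {q : List (Fin N × ℕ)} (hq : P.Critical f ν x num l q) {i : ℕ}
    (hi : 1 ≤ i) (hiν : i < ν) {t : ℕ} {K : Set ℕ} (hK : ∀ c ∈ K, c ∈ active ν q)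
    (hm : x i ∈ returnable f K (P.probe num ν l q t)) : i ∈ active ν q := by
  by_contra hn
  refine h.notMem_returnable hP hν hinj hy hq hi hiν ?_
  rw [others_of_notMem hn]
  exact returnable_probe_subset (fun c hc => hc) t (returnable_mono hK _ hm)

theorem Poised.client_cases {σ : P.State} (h : Poised ν x num σ) (c : ℕ) :
    (σ.client c).activity = .idle ∨ 1 ≤ c ∧ c < ν := by
  by_cases hc : c = 0 ∨ ν ≤ c
  · exact .inl (h.idle c hc)
  · exact .inr (by omega)

/-- After the crash of all writers but those that have sent their values, no more values are sent. -/
theorem Poised.mute_crash {σ : P.State} (h : Poised ν x num σ) {cs : List ℕ}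
    (hcs : ∀ c, 1 ≤ c → c < ν → c ∈ cs ∨ (σ.client c).unsent = ∅) (c : ℕ) :
    Mute c (Protocol.run σ (cs.map .crashClient)) := by
  rw [run_crashClients]
  refine ⟨h.noPayload c, ?_⟩
  rcases h.client_cases c with hc | ⟨h1, h2⟩
  · exact .inr fun v w rep hx => by rw [hc] at hx; cases hx
  · rcases hcs c h1 h2 with h3 | h3
    · exact .inl (.inl h3)
    · refine .inr fun v w rep hx => .inr ⟨?_, h3⟩
      obtain ⟨⟨w', hw', hst⟩, -⟩ := h.writing c h1 h2
      have hx' : (σ.client c).activity = .writing v w rep := hx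
      rw [hw'] at hx'
      simp only [Activity.writing.injEq] at hx'
      rw [← hx'.2.1]
      exact hst

theorem crashClients_props (cs : List ℕ) : ∀ a ∈ (cs.map .crashClient : List (Action N V)),
    a.NoWrite ∧ a.NoCrash ∧ a.NoRead := by
  intro a ha
  obtain ⟨c, -, rfl⟩ := List.mem_map.1 ha
  exact ⟨by rintro _ _ ⟨⟩, by rintro _ ⟨⟩, by rintro _ ⟨⟩⟩

/-- If the values of an active writer have been delivered to all servers, then the value of some
active writer can be returned without further help. -/
theorem Setup.exists_returnable [Countable V] (h : P.Setup f ν x num l)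
    (hP : P.EmulatesAtomic f ν) (hW : P.ConcurrencyWaitFree f ν)
    {q : List (Fin N × ℕ)} (hq : Admissible ν q) (hf : q.length + 1 ≤ f) {j : ℕ}
    (hj : j ∈ active ν q) :
    ∃ i, 1 ≤ i ∧ i < ν ∧ x i ∈ returnable f ∅ (P.probe num ν l q N) := by
  set l₁ := l ++ (schedule num ν q ++ advance num (active ν q) (position q) N) with hl₁
  have hval₁ : P.Valid f ν x ν l₁ := h.probe_valid hq hf N
  have hpo : Poised ν x num (run P.initialState l₁) := h.probe_poised hq N
  obtain ⟨hj1, hjν⟩ := active_bounds j hj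
  have hun : ((run P.initialState l₁).client j).unsent = ∅ := by
    refine Finset.eq_empty_of_forall_notMem fun s => ?_
    change s ∉ ((P.probe num ν l q N).client j).unsent
    rw [probe_eq, final, run_append]
    rcases Nat.lt_or_ge s (position q) with h1 | h1
    · exact fun hm => h.poised.notMem_unsent_schedule hq h.prepared.crashedServers hj h1
        (((run_delivery isDelivery_advance _).2 j).2.2 hm)
    · exact (h.poised.schedule hq h.prepared.crashedServers).notMem_unsent isDelivery_advance hj1 hjν
        (List.mem_append_left _ (mem_segment.2 ⟨s, h1, s.2, mem_deliver.2 ⟨j, hj, .inl rfl⟩⟩))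
  -- All other writers crash; then no more values are sent, and the write of `j` terminates.
  set cs := (List.range ν).filter (· ≠ j) with hcs
  have hmem : ∀ c, c ∈ cs ↔ c < ν ∧ c ≠ j := by intro c; simp [hcs]
  set crash : List (Action N V) := cs.map .crashClient with hcrash
  have hcp := crashClients_props (V := V) (N := N) cs
  have hcr₂ : (run P.initialState (l₁ ++ crash)).crashedServers.encard ≤ f := by
    rw [run_append, run_crashedServers fun a ha => (hcp a ha).2.1]
    exact hval₁.crashes
  have hval₂ : P.Valid f ν x ν (l₁ ++ crash) :=
    hval₁.append (fun a ha => (hcp a ha).1) hcr₂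
  have hcc₂ : ∀ c, c ∈ (run P.initialState (l₁ ++ crash)).crashedClients ↔ c < ν ∧ c ≠ j := by
    intro c
    rw [run_append, run_crashClients]
    change c ∈ {c | c ∈ cs} ∪ (run P.initialState l₁).crashedClients ↔ _
    rw [hpo.crashedClients, Set.union_empty]
    exact hmem c
  have hmute : ∀ c, Mute c (run P.initialState (l₁ ++ crash)) := by
    intro c
    rw [run_append]
    refine hpo.mute_crash (fun c _ h2 => ?_) c
    by_cases hc : c = j
    · exact .inr (hc ▸ hun)
    · exact .inl ((hmem c).2 ⟨h2, hc⟩)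
  obtain ⟨i, hi, hact⟩ := hval₂.history.invoked j hj1 hjν
  have hi0 : i ≠ 0 := by
    rintro rfl
    have := hval₂.history.first
    rw [hact] at this
    simp only [Action.invokeWrite.injEq] at this
    omega
  obtain ⟨l₂, hl₂, k, hk, hterm⟩ := exists_write_terminates hW hval₂.bounded hval₂.crashes hi hact
    (by rw [hcc₂]; simp)
  have hNW₂ : ∀ b ∈ l₂, b.NoWrite := fun b hb => Action.IsControlled.noWrite (hl₂ b hb)
  have hcr₃ : (run P.initialState (l₁ ++ crash ++ l₂)).crashedServers.encard ≤ f := by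
    rw [run_append, run_crashedServers fun b hb => Action.IsControlled.noCrash (hl₂ b hb)]
    exact hcr₂
  have hval₃ := hval₂.append hNW₂ hcr₃
  have hact₃ : (P.finiteExecution (l₁ ++ crash ++ l₂)).action i = .invokeWrite j (x j) := by
    rw [← hact]
    have := execution_extend_action (P := P) (l₁ ++ crash) l₂ [] (idleSchedule N V)
      (idleSchedule N V) hi
    rwa [List.append_nil] at this
  have hNR₃ : NoReads (run P.initialState (l₁ ++ crash ++ l₂)) := by
    rw [run_append, run_append]
    refine run_preserves (run_preserves hpo.noReads fun a ha _ _ hτ st =>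
      step_noReads (hcp a ha).2.2 hτ st) fun a ha _ _ hτ st =>
        step_noReads (Action.IsControlled.noRead (hl₂ a ha)) hτ st
  have hid : ((run P.initialState (l₁ ++ crash ++ l₂)).client ν).activity = .idle := by
    refine idle_of_notMem_writers hNR₃ fun hc => ?_
    rw [List.append_assoc, run_append] at hc
    have := run_writers (fun a ha => ?_) hc
    · exact notMem_writers_of_idle (hpo.idle ν (.inr le_rfl)) this
    · rcases List.mem_append.1 ha with ha | ha
      · exact (hcp a ha).1
      · exact hNW₂ a ha
  obtain ⟨l₃, hNW₃, hNC₃, v, hen⟩ := exists_read_returns hW hval₃.bounded hcr₃ (c := ν)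
    (by rw [run_append, run_crashedClients hl₂, hcc₂]; simp) hid
  have hcr₄ : (run P.initialState (l₁ ++ crash ++ l₂ ++ l₃)).crashedServers.encard ≤ f := by
    rw [run_append, run_crashedServers hNC₃]
    exact hcr₃
  obtain ⟨c, hc1, hcν, rfl⟩ := hval₃.returnRead_of_terminates hP hNR₃ hNW₃ hcr₄ hen hact₃ hi0 hterm hk
  refine ⟨c, hc1, hcν, crash ++ (l₂ ++ l₃), fun a ha => ?_, ?_, ?_, ν, ?_⟩
  · rcases List.mem_append.1 ha with ha | ha
    · exact (hcp a ha).1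
    · rcases List.mem_append.1 ha with ha | ha
      · exact hNW₂ a ha
      · exact hNW₃ a ha
  · refine BlindRun.append (blindRun_of_receive fun c s n hm => ?_) ?_
    · obtain ⟨c, -, e⟩ := List.mem_map.1 hm
      cases e
    · change BlindRun ∅ ∅ (run (run P.initialState l₁) crash) _
      rw [← run_append]
      refine blindRun_of_mute (fun a ha => ?_) fun c _ => hmute c
      rcases List.mem_append.1 ha with ha | ha
      · exact hNW₂ a ha
      · exact hNW₃ a ha
  · change (run (run P.initialState l₁) _).crashedServers.encard ≤ _
    rw [← run_append, ← List.append_assoc, ← List.append_assoc]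
    exact hcr₄
  · change ∃ τ, P.Step _ (run (run P.initialState l₁) _) τ
    rw [← run_append, ← List.append_assoc, ← List.append_assoc]
    exact hen

theorem exists_mem_active {q : List (Fin N × ℕ)} (hq : q.length + 1 < ν) : ∃ j, j ∈ active ν q := by
  by_contra hn
  push Not at hn
  have hsub : Finset.Icc 1 (ν - 1) ⊆ (q.map Prod.snd).toFinset := by
    intro c hc
    rw [Finset.mem_Icc] at hc
    by_contra h
    exact hn c (mem_active.2 ⟨hc.1, by omega, fun h' => h (List.mem_toFinset.2 h')⟩)
  have h1 := Finset.card_le_card hsub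
  have h2 := List.toFinset_card_le (q.map Prod.snd)
  rw [Nat.card_Icc] at h1
  rw [List.length_map] at h2
  omega

/-- As long as there are active writers, there is another critical server. -/
theorem Setup.exists_critical_cons [Countable V] (h : P.Setup f ν x num l)
    (hP : P.EmulatesAtomic f ν) (hW : P.ConcurrencyWaitFree f ν) (hν : 2 ≤ ν) (hνf : ν ≤ f + 1)
    (hinj : ∀ c d, c < ν → d < ν → x c = x d → c = d) {y : V}
    (hy : ∀ c, c < ν → y ≠ x c) {q : List (Fin N × ℕ)} (hq : P.Critical f ν x num l q)
    (hlen : q.length + 1 < ν) : ∃ d j, P.Critical f ν x num l ((d, j) :: q) := by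
  classical
  obtain ⟨j₀, hj₀⟩ := exists_mem_active hlen
  have hN : position q ≤ N ∧ ∃ j ∈ active ν q,
      x j ∈ returnable f (others ν q j) (P.probe num ν l q N) := by
    obtain ⟨i, hi, hiν, hret⟩ := h.exists_returnable hP hW hq.admissible (by omega) hj₀
    refine ⟨?_, i, h.mem_active_of_returnable hP hν hinj hy hq hi hiν (by simp) hret,
      returnable_mono (by simp) _ hret⟩
    cases q with
    | nil => simp [position]
    | cons e q => exact e.1.2.le
  -- The critical server comes right before the first `t` at which some value can be returned.
  have hex : ∃ t, position q ≤ t ∧ ∃ j ∈ active ν q,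
      x j ∈ returnable f (others ν q j) (P.probe num ν l q t) := ⟨N, hN⟩
  obtain ⟨hpos, j, hj, hret⟩ := Nat.find_spec hex
  have hmin := fun m (hm : m < Nat.find hex) => Nat.find_min hex hm
  have hleN : Nat.find hex ≤ N := Nat.find_min' hex hN
  generalize Nat.find hex = t at hpos hret hmin hleN
  -- At `t = position q` nothing has been delivered since the last writer was stopped.
  have hne : t ≠ position q := by
    rintro rfl
    refine h.notMem_returnable hP hν hinj hy hq (active_bounds j hj).1 (active_bounds j hj).2 ?_
    rw [probe_eq] at hret
    refine returnable_run_subset (fun a ha => (isDelivery_advance a ha).noWrite)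
      (blindRun_of_receive fun c s n hm => ?_) hret
    have := receive_mem_advance hm
    omega
  obtain ⟨d, rfl⟩ : ∃ d, t = d + 1 := ⟨t - 1, by omega⟩
  refine ⟨⟨d, by omega⟩, j, hq, by simp; omega, hj, fun i hi hiν hm => ?_, hret⟩
  rw [final_cons] at hm
  have hsub : ∀ c ∈ others ν ((⟨d, by omega⟩, j) :: q : List (Fin N × ℕ)) i, c ∈ others ν q i := by
    rintro c ⟨hc, hci⟩
    exact ⟨(mem_active_cons.1 hc).1, hci⟩
  have hm' := returnable_mono hsub _ hm
  have hia := h.mem_active_of_returnable hP hν hinj hy hq hi hiν (fun c hc => hc.1) hm'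
  exact hmin d (by omega) ⟨by omega, i, hia, hm'⟩

theorem Setup.exists_critical [Countable V] (h : P.Setup f ν x num l)
    (hP : P.EmulatesAtomic f ν) (hW : P.ConcurrencyWaitFree f ν) (hν : 2 ≤ ν) (hνf : ν ≤ f + 1)
    (hinj : ∀ c d, c < ν → d < ν → x c = x d → c = d) {y : V}
    (hy : ∀ c, c < ν → y ≠ x c) : ∃ p, p.length + 1 = ν ∧ P.Critical f ν x num l p := by
  have key : ∀ n, n + 1 ≤ ν → ∃ p, p.length = n ∧ P.Critical f ν x num l p := by
    intro n
    induction n with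
    | zero => exact fun _ => ⟨[], rfl, trivial⟩
    | succ n ih =>
      intro hn
      obtain ⟨p, rfl, hp⟩ := ih (by omega)
      obtain ⟨d, j, hp'⟩ := h.exists_critical_cons hP hW hν hνf hinj hy hp (by omega)
      exact ⟨(d, j) :: p, rfl, hp'⟩
  obtain ⟨p, hp, hc⟩ := key (ν - 1) (by omega)
  exact ⟨p, by omega, hc⟩

/-- When all writers have been stopped, exactly the first value can be returned without their
help. -/
theorem Setup.returnable_final [Countable V] (h : P.Setup f ν x num l)
    (hP : P.EmulatesAtomic f ν) (hW : P.ConcurrencyWaitFree f ν) (hν : 2 ≤ ν) (hνf : ν ≤ f + 1)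
    (hinj : ∀ c d, c < ν → d < ν → x c = x d → c = d) {y : V}
    (hy : ∀ c, c < ν → y ≠ x c) {p : List (Fin N × ℕ)} (hp : P.Critical f ν x num l p)
    (hlen : p.length + 1 = ν) : returnable f ∅ (P.final num ν l p) = {x 0} := by
  have hadm := hp.admissible
  have hval : P.Valid f ν x ν (l ++ schedule num ν p) := h.final_valid hadm (by omega)
  have hpo : Poised ν x num (run P.initialState (l ++ schedule num ν p)) := h.final_poised hadm
  have hsub : ∀ v ∈ returnable f ∅ (P.final num ν l p), v = x 0 := by
    intro v hv
    obtain ⟨c, hc, rfl⟩ := hval.returnable_subset hP hpo.noReads (by omega) hv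
    rcases Nat.eq_zero_or_pos c with rfl | hc0
    · rfl
    · exact absurd (returnable_mono (by simp) _ hv)
        (h.notMem_returnable hP hν hinj hy hp hc0 hc)
  refine Set.Subset.antisymm hsub (Set.singleton_subset_iff.2 ?_)
  -- A read returns some value even if all writers crash.
  set crash : List (Action N V) := (List.range ν).map .crashClient with hcrash
  have hcp := crashClients_props (V := V) (N := N) (List.range ν)
  have hcr₂ : (run P.initialState (l ++ schedule num ν p ++ crash)).crashedServers.encard ≤ f := by
    rw [run_append, run_crashedServers fun a ha => (hcp a ha).2.1]
    exact hval.crashes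
  have hval₂ := hval.append (fun a ha => (hcp a ha).1) hcr₂
  have hrun₂ := run_crashClients (run P.initialState (l ++ schedule num ν p)) (List.range ν)
  rw [← hcrash, ← run_append] at hrun₂
  obtain ⟨l₃, hNW₃, hNC₃, v, hen⟩ := exists_read_returns hW hval₂.bounded hcr₂ (c := ν)
    (by
      rw [hrun₂]
      change ν ∉ {c | c ∈ List.range ν} ∪
        (run P.initialState (l ++ schedule num ν p)).crashedClients
      rw [hpo.crashedClients]
      simp) (by rw [hrun₂]; exact hpo.idle ν (.inr le_rfl))
  have hv : v ∈ returnable f ∅ (P.final num ν l p) := by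
    refine ⟨crash ++ l₃, fun a ha => ?_, ?_, ?_, ν, ?_⟩
    · rcases List.mem_append.1 ha with ha | ha
      · exact (hcp a ha).1
      · exact hNW₃ a ha
    · refine BlindRun.append (blindRun_of_receive fun c s n hm => ?_)
        (blindRun_of_mute hNW₃ fun c _ => hpo.mute_crash (fun c _ h2 => ?_) c)
      · obtain ⟨c, -, e⟩ := List.mem_map.1 hm
        cases e
      · exact .inl (List.mem_range.2 h2)
    · rw [final, ← run_append, ← List.append_assoc, run_append, run_crashedServers hNC₃]
      exact hcr₂
    · rw [final, ← run_append, ← List.append_assoc]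
      exact hen
  rw [← hsub v hv]
  exact hv

end

/-! ### Recovering the values from the servers -/

/-- Without values in transit, states with the same control flow differ only in the data of the
servers and the values of the writers. -/
theorem Poised.sim {ν : ℕ} {x x' : ℕ → V} {num : ℕ → ℕ} {σ τ : P.State} {D : Set (Fin N)}
    {K : Set ℕ} (hσ : Poised ν x num σ) (hτ : Poised ν x' num τ) (h : Sim Set.univ ∅ σ τ)
    (hD : ∀ s, s ∉ D → σ.server s = τ.server s) (hK : ∀ c ∈ K, x c = x' c) : Sim D K σ τ where
  metadata := h.metadata
  server := hD
  client c := by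
    refine ⟨?_, (h.client c).number, (h.client c).unsent, (h.client c).memory⟩
    rcases hσ.client_cases c with hc | ⟨h1, h2⟩
    · rw [hc, idle_of_sim (h.client c).activity hc]
      exact .idle
    · obtain ⟨⟨w, hw, -⟩, -⟩ := hσ.writing c h1 h2
      obtain ⟨⟨w', hw', -⟩, -⟩ := hτ.writing c h1 h2
      obtain ⟨v, hv, -⟩ := writing_of_sim (h.client c).activity hw
      rw [hw'] at hv
      cases hv
      rw [hw, hw']
      exact .writing _ _ _ _ fun hc => hK c hc
  requests c s n := by
    have hr := h.requests c s n
    have hp := hσ.noPayload c s n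
    generalize σ.requests c s n = X at hr hp
    generalize τ.requests c s n = Y at hr
    cases hr with
    | none => exact .none
    | write q p p' e =>
      refine .write _ _ _ (.inl (e.elim id fun e => ?_))
      obtain ⟨p₀, rfl⟩ := Option.isSome_iff_exists.1 e.2.1
      exact absurd rfl (hp q p₀)
    | read q => exact .read q
  replies := h.replies
  crashedServers := h.crashedServers
  crashedClients := h.crashedClients

theorem receive_notMem_crashBefore {t c n : ℕ} {s : Fin N} :
    Action.serverReceive c s n ∉ (crashBefore t : List (Action N V)) := by
  intro h
  obtain ⟨s, -, e⟩ := mem_crashBefore.1 h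
  cases e

/-- The servers before `d` are in the same state whether or not server `d` is dealt with. -/
theorem probe_succ_server {num : ℕ → ℕ} {ν : ℕ} {l : List (Action N V)} {q : List (Fin N × ℕ)}
    {d : Fin N} (hd : position q ≤ d) {s : Fin N} (hs : s < d) :
    (P.probe num ν l q (d + 1)).server s = (P.probe num ν l q d).server s := by
  have hne : ∀ c n, Action.serverReceive c s n ∉
      (deliver num (active ν q) d : List (Action N V)) := by
    intro c n hm
    obtain ⟨c', -, e | e⟩ := mem_deliver.1 hm <;> cases e
    exact lt_irrefl _ hs
  rw [probe_eq, probe_eq, advance, advance, run_append, run_append,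
    run_server fun _ _ => receive_notMem_crashBefore,
    run_server fun _ _ => receive_notMem_crashBefore, segment_succ hd, run_append, run_server hne]

section

variable {f ν : ℕ} {x : ℕ → V} {num : ℕ → ℕ} {l : List (Action N V)}

/-- When the writes have been prepared, the servers depend on the first value only. -/
theorem Setup.server_eq (h : P.Setup f ν x num l) {x' : ℕ → V} (h0 : x 0 = x' 0) (s : Fin N) :
    (run P.initialState l).server s = (run P.initialState (l.map (Protocol.assign x'))).server s := by
  have hs : Sim ∅ {0} (run P.initialState (l.map (Protocol.assign x)))
      (run P.initialState (l.map (Protocol.assign x'))) := by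
    refine (initialState_sim ∅ {0}).run (fun c hc => ?_) ?_
    · rw [Set.mem_singleton_iff.1 hc, h0]
    · rw [h.prepared.assigned]
      intro l₁ a l₂ e c s n _ _
      refine ⟨by simp, fun _ hc => ?_⟩
      exact h.prepared.always_noPayload c (Nat.pos_of_ne_zero hc) l₁ _ e s n
  rw [h.prepared.assigned] at hs
  exact hs.server s (by simp)

/-- The control flow during the deliveries does not depend on the values. -/
theorem Setup.sim (h : P.Setup f ν x num l) (x' : ℕ → V) {m : List (Action N V)}
    (hm : ∀ a ∈ m, IsDelivery a) : Sim Set.univ ∅ (run P.initialState (l ++ m))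
      (run P.initialState (l.map (Protocol.assign x') ++ m)) := by
  rw [run_append, run_append]
  have := noReads_sim (run_assign_sim h.prepared.assigned h.prepared.noRead x')
    h.prepared.noReads (l := m) (fun a ha => (hm a ha).noRead) x x'
  rwa [map_assign_of_noWrite fun a ha => (hm a ha).noWrite,
    map_assign_of_noWrite fun a ha => (hm a ha).noWrite] at this

theorem isDelivery_probe {q : List (Fin N × ℕ)} {t : ℕ} :
    ∀ a ∈ (schedule num ν q ++ advance num (active ν q) (position q) t : List (Action N V)),
      IsDelivery a := fun a ha =>
  (List.mem_append.1 ha).elim (isDelivery_schedule a) (isDelivery_advance a)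

/-- The state of a server that the schedule has not reached depends on the first value only. -/
theorem Setup.probe_server_eq (h : P.Setup f ν x num l) {x' : ℕ → V} (h0 : x 0 = x' 0)
    {q : List (Fin N × ℕ)} (hq : Admissible ν q) {t : ℕ} (ht : position q ≤ t) {s : Fin N}
    (hs : t ≤ s) : (P.probe num ν l q t).server s =
      (P.probe num ν (l.map (Protocol.assign x')) q t).server s := by
  have hne : ∀ c n, Action.serverReceive c s n ∉
      (schedule num ν q ++ advance num (active ν q) (position q) t : List (Action N V)) := by
    intro c n hm
    rcases List.mem_append.1 hm with hm | hm
    · have := receive_mem_schedule hq hm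
      omega
    · have := receive_mem_advance hm
      omega
  rw [probe, probe, run_append _ l, run_append _ (l.map _), run_server hne, run_server hne]
  exact h.server_eq h0 s

/-- The value of the writer stopped last is determined by the values of the writers that are still
active and by the states of the servers before the critical one: at the crash of this server it is
the only value besides theirs that can become visible. -/
theorem Setup.stopped_eq (h : P.Setup f ν x num l) (hP : P.EmulatesAtomic f ν) (hν : 2 ≤ ν)
    (hinj : ∀ c d, c < ν → d < ν → x c = x d → c = d) {x' : ℕ → V}
    (hinj' : ∀ c d, c < ν → d < ν → x' c = x' d → c = d) {y' : V}
    (hy' : ∀ c, c < ν → y' ≠ x' c) (h0 : x 0 = x' 0) {d : Fin N} {j : ℕ} {q : List (Fin N × ℕ)}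
    (hp : P.Critical f ν x num l ((d, j) :: q))
    (hp' : P.Critical f ν x' num (l.map (Protocol.assign x')) ((d, j) :: q))
    (hlen : q.length + 1 ≤ f)
    (hs : ∀ s : Fin N, s < d → (P.final num ν l ((d, j) :: q)).server s =
      (P.final num ν (l.map (Protocol.assign x')) ((d, j) :: q)).server s)
    (hact : ∀ c ∈ active ν ((d, j) :: q), x c = x' c) : x j = x' j := by
  have h' := h.assign x'
  obtain ⟨hq, hd, hj, -, hret⟩ := hp
  have hq' := hp'.1
  have hadm := hq.admissible
  have hKact : ∀ c ∈ others ν q j, x c = x' c := fun c hc => hact c (mem_active_cons.2 hc)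
  have hsim : Sim {d} (others ν q j) (P.probe num ν l q (d + 1))
      (P.probe num ν (l.map (Protocol.assign x')) q (d + 1)) := by
    refine (h.probe_poised hadm _).sim (h'.probe_poised hadm _) (h.sim x' isDelivery_probe)
      (fun s hsd => ?_) hKact
    rcases lt_or_gt_of_ne (show s ≠ d from hsd) with hlt | hgt
    · rw [probe_succ_server hd hlt, probe_succ_server hd hlt]
      exact hs s hlt
    · exact h.probe_server_eq h0 hadm (by omega) (by simpa using hgt)
  have hD : ({d} : Set (Fin N)) ⊆ (P.probe num ν l q (d + 1)).crashedServers := by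
    rw [probe_eq, run_advance_crashedServers]
    rintro s rfl
    exact .inr rfl
  have hret' := hsim.returnable_subset hD hret
  obtain ⟨c, hc, e⟩ := (h'.probe_valid hadm hlen (d + 1)).returnable_subset hP
    (h'.probe_poised hadm (d + 1)).noReads (by omega) hret'
  obtain ⟨hj1, hjν⟩ := active_bounds j hj
  -- The value is neither the first one, nor that of another active writer, nor that of a writer
  -- stopped before.
  rcases Nat.eq_zero_or_pos c with rfl | hc0
  · rw [← h0] at e
    have := hinj _ _ hjν (by omega) e
    omega
  · rw [e] at hret'
    have hca := h'.mem_active_of_returnable hP hν hinj' hy' hq' hc0 hc (fun c hc => hc.1) hret'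
    by_cases hcj : c = j
    · rw [e, hcj]
    · rw [← hact c (mem_active_cons.2 ⟨hca, hcj⟩)] at e
      exact absurd (hinj _ _ hjν hc e).symm hcj

/-- All values are determined by the first one, those of the active writers, and the states of the
servers that have been dealt with. -/
theorem Setup.eq_of_server_eq (h : P.Setup f ν x num l) (hP : P.EmulatesAtomic f ν) (hν : 2 ≤ ν)
    (hinj : ∀ c d, c < ν → d < ν → x c = x d → c = d) {x' : ℕ → V}
    (hinj' : ∀ c d, c < ν → d < ν → x' c = x' d → c = d) {y' : V}
    (hy' : ∀ c, c < ν → y' ≠ x' c) (h0 : x 0 = x' 0) {p : List (Fin N × ℕ)}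
    (hp : P.Critical f ν x num l p) (hp' : P.Critical f ν x' num (l.map (Protocol.assign x')) p)
    (hlen : p.length ≤ f)
    (hs : ∀ s : Fin N, s < position p → (P.final num ν l p).server s =
      (P.final num ν (l.map (Protocol.assign x')) p).server s)
    (hact : ∀ c ∈ active ν p, x c = x' c) {c : ℕ} (hc : c < ν) : x c = x' c := by
  induction p with
  | nil =>
    rcases Nat.eq_zero_or_pos c with rfl | hc0
    · exact h0
    · exact hact c (mem_active.2 ⟨hc0, hc, by simp⟩)
  | cons e q ih =>
    obtain ⟨d, j⟩ := e
    have hj := h.stopped_eq hP hν hinj hinj' hy' h0 hp hp' hlen (fun s hs' => hs s hs') hact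
    refine ih hp.1 hp'.1 (by simp at hlen; omega) (fun s hsq => ?_) fun c hc => ?_
    · have hne : ∀ c n, Action.serverReceive c s n ∉
          (advance num (active ν q) (position q) d : List (Action N V)) := by
        intro c n hm
        have := receive_mem_advance hm
        omega
      have := hs s (lt_of_lt_of_le hsq hp.2.1)
      rwa [final_cons, final_cons, probe_eq, probe_eq, run_server hne, run_server hne] at this
    · by_cases hcj : c = j
      · exact hcj ▸ hj
      · exact hact c (mem_active_cons.2 ⟨hc, hcj⟩)

/-- When all writers have been stopped, no value is active. -/
theorem active_eq_nil {p : List (Fin N × ℕ)} (hp : Admissible ν p) (hlen : p.length + 1 = ν) :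
    active ν p = [] := by
  have hlt : ∀ p : List (Fin N × ℕ), Admissible ν p →
      (p.map Prod.snd).Nodup ∧ ∀ j ∈ p.map Prod.snd, j ∈ Finset.Icc 1 (ν - 1) := by
    intro p
    induction p with
    | nil => simp
    | cons e q ih =>
      obtain ⟨d, j⟩ := e
      rintro ⟨hq, -, hj⟩
      obtain ⟨h1, h2, h3⟩ := mem_active.1 hj
      refine ⟨List.nodup_cons.2 ⟨h3, (ih hq).1⟩, fun i hi => ?_⟩
      rcases List.mem_cons.1 hi with rfl | hi
      · exact Finset.mem_Icc.2 ⟨h1, by omega⟩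
      · exact (ih hq).2 i hi
  obtain ⟨h1, h2⟩ := hlt p hp
  have heq : (p.map Prod.snd).toFinset = Finset.Icc 1 (ν - 1) := by
    refine Finset.eq_of_subset_of_card_le (fun j hj => h2 j (List.mem_toFinset.1 hj)) ?_
    rw [List.toFinset_card_of_nodup h1, List.length_map, Nat.card_Icc]
    omega
  refine List.eq_nil_iff_forall_not_mem.2 fun c hc => ?_
  obtain ⟨hc1, hcν, hc⟩ := mem_active.1 hc
  exact hc (List.mem_toFinset.1 (heq ▸ Finset.mem_Icc.2 ⟨hc1, by omega⟩))

/-- The critical servers and the states of all servers at the end of the schedule determine the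
values. -/
theorem Setup.values_eq [Countable V] (h : P.Setup f ν x num l) (hP : P.EmulatesAtomic f ν)
    (hW : P.ConcurrencyWaitFree f ν) (hν : 2 ≤ ν) (hνf : ν ≤ f + 1)
    (hinj : ∀ c d, c < ν → d < ν → x c = x d → c = d) {y : V} (hy : ∀ c, c < ν → y ≠ x c)
    {x' : ℕ → V} (hinj' : ∀ c d, c < ν → d < ν → x' c = x' d → c = d) {y' : V}
    (hy' : ∀ c, c < ν → y' ≠ x' c) {p : List (Fin N × ℕ)} (hlen : p.length + 1 = ν)
    (hp : P.Critical f ν x num l p) (hp' : P.Critical f ν x' num (l.map (Protocol.assign x')) p)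
    (hs : ∀ s, (P.final num ν l p).server s =
      (P.final num ν (l.map (Protocol.assign x')) p).server s) {c : ℕ} (hc : c < ν) :
    x c = x' c := by
  have h' := h.assign x'
  have hsim : Sim ∅ ∅ (P.final num ν l p) (P.final num ν (l.map (Protocol.assign x')) p) :=
    (h.final_poised hp.admissible).sim (h'.final_poised hp.admissible)
      (h.sim x' isDelivery_schedule) (fun s _ => hs s) (by simp)
  have h0 : x 0 = x' 0 := by
    have := hsim.returnable_eq (f := f) (by simp)
    rwa [h.returnable_final hP hW hν hνf hinj hy hp hlen,
      h'.returnable_final hP hW hν hνf hinj' hy' hp' hlen, Set.singleton_eq_singleton_iff] at this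
  exact h.eq_of_server_eq hP hν hinj hinj' hy' h0 hp hp' (by omega) (fun s _ => hs s)
    (by simp [active_eq_nil hp.admissible hlen]) hc

end

/-! ### Counting -/

theorem Admissible.snd_lt {ν : ℕ} {p : List (Fin N × ℕ)} (hp : Admissible ν p) :
    ∀ e ∈ p, e.2 < ν := by
  induction p with
  | nil => simp
  | cons e q ih =>
    intro e' he
    rcases List.mem_cons.1 he with rfl | he
    · exact (active_bounds _ hp.2.2).2
    · exact ih hp.1 e' he

/-- The number of candidates for critical servers and stopped writers does not depend on the
values. -/
theorem card_admissible_le {ν : ℕ} {T : Finset (List (Fin N × ℕ))}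
    (hT : ∀ p ∈ T, Admissible ν p ∧ p.length + 1 = ν) : T.card ≤ (N * ν) ^ (ν - 1) := by
  classical
  have hsub : T ⊆ (Finset.univ : Finset (Fin (ν - 1) → Fin N × Fin ν)).image
      fun g => List.ofFn fun i => ((g i).1, ((g i).2 : ℕ)) := by
    intro p hp
    obtain ⟨hadm, hlen⟩ := hT p hp
    obtain rfl : ν = p.length + 1 := hlen.symm
    exact Finset.mem_image.2 ⟨fun i => ((p.get i).1, ⟨(p.get i).2, hadm.snd_lt _ (p.get_mem i)⟩),
      Finset.mem_univ _, List.ofFn_get p⟩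
  refine (Finset.card_le_card hsub).trans (Finset.card_image_le.trans ?_)
  simp

/-- For one choice of critical servers, the data of the servers can take so many values that they
distinguish between a fixed part of all tuples of distinct values. -/
theorem exists_descFactorial_le [Fintype V] {f ν : ℕ} (hP : P.EmulatesAtomic f ν)
    (hW : P.ConcurrencyWaitFree f ν) (hν : 2 ≤ ν) (hνf : ν ≤ f + 1) (hV : ν < Fintype.card V) :
    ∃ e : P.Execution, e.BoundedConcurrency ν ∧ e.BoundedFailures f ∧ ∃ n,
      (Fintype.card V).descFactorial ν ≤ (N * ν) ^ (ν - 1) *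
        ∏ s, @Fintype.card (P.Data ((e.state n).server s).1) (P.dataFintype _) := by
  classical
  -- Tuples of distinct values, continued arbitrarily.
  let ext : (Fin ν ↪ V) → ℕ → V := fun g c => if h : c < ν then g ⟨c, h⟩ else P.default
  have hext : ∀ (g : Fin ν ↪ V) c (h : c < ν), ext g c = g ⟨c, h⟩ := fun g c h => dif_pos h
  have hinj : ∀ (g : Fin ν ↪ V) c d, c < ν → d < ν → ext g c = ext g d → c = d := by
    intro g c d hc hd e
    rw [hext g c hc, hext g d hd] at e
    simpa using g.injective e
  have hy : ∀ g : Fin ν ↪ V, ∃ y, ∀ c, c < ν → y ≠ ext g c := by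
    intro g
    have : ¬ Function.Surjective g := fun hs => by
      have := Fintype.card_le_of_surjective g hs
      rw [Fintype.card_fin] at this
      omega
    obtain ⟨y, hy⟩ := not_forall.1 this
    refine ⟨y, fun c hc e => hy ⟨⟨c, hc⟩, ?_⟩⟩
    rw [e, hext g c hc]
  obtain ⟨g₀⟩ : Nonempty (Fin ν ↪ V) :=
    Function.Embedding.nonempty_of_card_le (by rw [Fintype.card_fin]; exact hV.le)
  obtain ⟨y₀, hy₀⟩ := hy g₀
  obtain ⟨l, hl⟩ := exists_prepared hν hP hW (hinj g₀) hy₀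
  obtain ⟨num, h⟩ : ∃ num, P.Setup f ν (ext g₀) num l := ⟨_, hl.setup⟩
  have hcrit : ∀ g, ∃ p, p.length + 1 = ν ∧
      P.Critical f ν (ext g) num (l.map (Protocol.assign (ext g))) p := fun g =>
    (h.assign (ext g)).exists_critical hP hW hν hνf (hinj g) (hy g).choose_spec
  choose p hlen hp using hcrit
  -- `q` is the most frequent choice. The states of the servers determine the tuples with this choice.
  obtain ⟨q, hq, hmax⟩ := (Finset.univ.image p).exists_max_image
    (fun q => (Finset.univ.filter fun g => p g = q).card) ⟨p g₀, by simp⟩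
  obtain ⟨g₁, -, hg₁⟩ := Finset.mem_image.1 hq
  have hqlen : q.length + 1 = ν := hg₁ ▸ hlen g₁
  have hadm : Admissible ν q := hg₁ ▸ (hp g₁).admissible
  have hval := h.final_valid hadm (by omega)
  have hstate : (P.finiteExecution (l ++ schedule num ν q)).state (l ++ schedule num ν q).length =
      P.final num ν l q := trajectory_extend_length _ _ _
  refine ⟨P.finiteExecution (l ++ schedule num ν q), bounded_extend hval.bounded fun n =>
      Action.IsControlled.noWrite (idleSchedule_controlled n), crashes_extend hval.crashes fun n =>
      Action.IsControlled.noCrash (idleSchedule_controlled n),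
    (l ++ schedule num ν q).length, ?_⟩
  rw [hstate]
  have hfiber : (Finset.univ.filter fun g => p g = q).card ≤
      ∏ s, @Fintype.card (P.Data ((P.final num ν l q).server s).1) (P.dataFintype _) := by
    let _ := P.dataFintype
    have hmaps : Set.MapsTo
        (fun g => (P.final num ν (l.map (Protocol.assign (ext g))) q).server)
        (Finset.univ.filter fun g => p g = q : Finset (Fin ν ↪ V))
        (Fintype.piFinset fun s => (Finset.univ : Finset (P.Data ((P.final num ν l q).server s).1)).map
          (Function.Embedding.sigmaMk _)) := by
      intro g _
      refine Finset.mem_coe.2 (Fintype.mem_piFinset.2 fun s => Finset.mem_map.2 ?_)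
      have hm : ((P.final num ν l q).server s).1 =
          ((P.final num ν (l.map (Protocol.assign (ext g))) q).server s).1 :=
        (h.sim (ext g) isDelivery_schedule).metadata s
      change ∃ a ∈ _, _ = (P.final num ν (l.map (Protocol.assign (ext g))) q).server s
      generalize (P.final num ν (l.map (Protocol.assign (ext g))) q).server s = Y at hm
      obtain ⟨μ, d⟩ := Y
      subst hm
      exact ⟨d, Finset.mem_univ _, rfl⟩
    refine (Finset.card_le_card_of_injOn _ hmaps ?_).trans (le_of_eq ?_)
    · intro g hg g' hg' e
      have hg : p g = q := by simpa using hg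
      have hg' : p g' = q := by simpa using hg'
      have hll : (l.map (Protocol.assign (ext g))).map (Protocol.assign (ext g')) =
          l.map (Protocol.assign (ext g')) := by
        rw [List.map_map]
        exact List.map_congr_left fun a _ => assign_assign _ _ _
      ext i
      have := (h.assign (ext g)).values_eq hP hW hν hνf (hinj g) (hy g).choose_spec (hinj g')
        (hy g').choose_spec hqlen (hg ▸ hp g) (by rw [hll]; exact hg' ▸ hp g')
        (fun s => by rw [hll]; exact congrFun e s) i.2
      rwa [hext g _ i.2, hext g' _ i.2] at this
    · rw [Fintype.card_piFinset]
      exact Finset.prod_congr rfl fun s _ => Finset.card_map _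
  calc (Fintype.card V).descFactorial ν = Fintype.card (Fin ν ↪ V) := by
        rw [Fintype.card_embedding_eq, Fintype.card_fin]
    _ ≤ (Finset.univ.filter fun g => p g = q).card * (Finset.univ.image p).card :=
        Finset.card_le_mul_card_image _ _ hmax
    _ ≤ _ := by
        rw [mul_comm]
        refine Nat.mul_le_mul (card_admissible_le fun r hr => ?_) hfiber
        obtain ⟨g, -, rfl⟩ := Finset.mem_image.1 hr
        exact ⟨(hp g).admissible, hlen g⟩

/-- Fewer than `ν` concurrent writes can force the servers to store almost `ν` values. -/
theorem exists_storageCost_ge {f ν : ℕ} (hN : 0 < N) (hν : 2 ≤ ν) (hνf : ν ≤ f + 1) {δ : ℝ}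
    (hδ : 0 < δ) : ∃ B : ℕ, ∀ (V : Type) [Fintype V] (P : Protocol N V), B ≤ Fintype.card V →
      P.EmulatesAtomic f ν → P.ConcurrencyWaitFree f ν →
      ∃ e : P.Execution, e.BoundedConcurrency ν ∧ e.BoundedFailures f ∧
        ∃ n, (1 - δ) * ν ≤ (e.state n).storageCost := by
  have hν0 : (0 : ℝ) < ν := by positivity
  set M : ℕ := (N * ν) ^ (ν - 1) with hM
  have hM0 : 0 < M := by positivity
  -- If `logb 2 |V| ≥ A`, then the loss `ν + logb 2 M` is at most `δ * ν * logb 2 |V|`.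
  set A : ℝ := (ν + Real.logb 2 M) / (δ * ν) with hA
  refine ⟨max (2 * ν) ⌈(2 : ℝ) ^ A⌉₊, fun V _ P hB hP hW => ?_⟩
  have hB1 : 2 * ν ≤ Fintype.card V := (le_max_left _ _).trans hB
  have hB2 : (2 : ℝ) ^ A ≤ Fintype.card V :=
    (Nat.le_ceil _).trans (by exact_mod_cast (le_max_right _ _).trans hB)
  obtain ⟨e, he1, he2, n, hn⟩ := exists_descFactorial_le hP hW hν hνf (by omega)
  refine ⟨e, he1, he2, n, ?_⟩
  set q := Fintype.card V with hq
  have hq0 : (0 : ℝ) < q := by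
    have : 0 < q := by omega
    exact_mod_cast this
  set data : ℕ := ∏ s, @Fintype.card (P.Data ((e.state n).server s).1) (P.dataFintype _) with hdata
  have hpow : ((q : ℝ) / 2) ^ ν ≤ M * data := by
    have h1 : (q + 1 - ν) ^ ν ≤ M * data := (Nat.pow_sub_le_descFactorial q ν).trans hn
    have h2 : ((q + 1 - ν : ℕ) : ℝ) ^ ν ≤ M * data := by exact_mod_cast h1
    refine (pow_le_pow_left₀ (by positivity) ?_ ν).trans h2
    rw [Nat.cast_sub (by omega)]
    have : (2 * ν : ℝ) ≤ q := by exact_mod_cast hB1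
    push_cast
    linarith
  have hdata0 : data ≠ 0 := by
    intro h0
    rw [h0] at hpow
    have : (0 : ℝ) < ((q : ℝ) / 2) ^ ν := by positivity
    simp at hpow
    linarith
  have hsum : ∑ s, Real.logb 2 (@Fintype.card (P.Data ((e.state n).server s).1) (P.dataFintype _)) =
      Real.logb 2 data := by
    rw [hdata, Nat.cast_prod, Real.logb_prod]
    intro s _ h0
    exact hdata0 (Finset.prod_eq_zero (Finset.mem_univ s) (by exact_mod_cast h0))
  have hlog : ν * (Real.logb 2 q - 1) ≤ Real.logb 2 M + Real.logb 2 data := by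
    have h1 := Real.logb_le_logb_of_le (b := 2) (by norm_num) (by positivity) hpow
    rw [Real.logb_pow, Real.logb_div hq0.ne' (by norm_num), Real.logb_self_eq_one (by norm_num),
      Real.logb_mul (by positivity) (by exact_mod_cast hdata0)] at h1
    exact h1
  have hAq : A ≤ Real.logb 2 q := (Real.le_logb_iff_rpow_le (by norm_num) hq0).2 hB2
  have hlq : 0 < Real.logb 2 q := Real.logb_pos (by norm_num) (by
    have : 1 < q := by omega
    exact_mod_cast this)
  rw [State.storageCost, hsum, le_div_iff₀ hlq]
  rw [hA, div_le_iff₀ (by positivity)] at hAq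
  nlinarith

end Protocol

/-! ### The storage cost of the algorithm -/

theorem natCast_codingParameter {N f ν : ℕ} (hN : 2 * f < N) :
    ((codingParameter N f ν : ℕ) : ℝ) = (⌈((N : ℝ) - 2 * f) / ν⌉ : ℝ) := by
  have h : (2 * f : ℝ) < N := by exact_mod_cast hN
  exact natCast_ceil_eq_intCast_ceil (div_nonneg (by linarith) (by positivity))

theorem TwoA.storageCost_eq {N f ν : ℕ} {V W : Type} [Fintype V] [Nontrivial V] [Fintype W]
    (C : MDSCode N (codingParameter N f ν) V W) (v₀ : V) (σ : (protocol N f ν C v₀).State) :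
    σ.storageCost = (N : ℝ) / codingParameter N f ν := by
  have hW : Real.logb 2 (Fintype.card W) ≠ 0 := by
    intro h0
    have h1 := Fintype.one_lt_card (α := V)
    rw [C.card_eq] at h1
    have h2 : 2 ≤ Fintype.card W := by
      by_contra hlt
      have : Fintype.card W ^ codingParameter N f ν ≤ 1 := pow_le_one₀ (by omega) (by omega)
      omega
    have : 0 < Real.logb 2 (Fintype.card W) := Real.logb_pos (by norm_num) (by exact_mod_cast h2)
    linarith
  have hsum : ∑ s, Real.logb 2 (@Fintype.card ((protocol N f ν C v₀).Data (σ.server s).1)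
      ((protocol N f ν C v₀).dataFintype _)) = N * Real.logb 2 (Fintype.card W) := by
    change ∑ _s : Fin N, Real.logb 2 (Fintype.card W) = _
    rw [Finset.sum_const, Finset.card_univ, Fintype.card_fin, nsmul_eq_mul]
  rw [Protocol.State.storageCost, hsum, C.card_eq, Nat.cast_pow, Real.logb_pow,
    mul_div_mul_right _ _ hW]

/-! ### Comparison of the bounds -/

section

variable {N f ν : ℕ}

theorem div_ceil_le (hN : 2 * f < N) (hν : 2 ≤ ν) :
    (N : ℝ) / (⌈((N : ℝ) - 2 * f) / ν⌉ : ℝ) ≤ ν * N / ((N : ℝ) - 2 * f) := by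
  have h : (0 : ℝ) < N - 2 * f := by
    have : (2 * f : ℝ) < N := by exact_mod_cast hN
    linarith
  have hν0 : (0 : ℝ) < ν := by positivity
  rw [show (ν * N : ℝ) / (N - 2 * f) = N / ((N - 2 * f) / ν) by field_simp]
  exact div_le_div_of_nonneg_left (by positivity) (by positivity) (Int.le_ceil _)

theorem le_mul_sub {ε : ℝ} (hε : 0 < ε) (hR : 2 * (1 + ε) / ε * f ≤ N) :
    (N : ℝ) ≤ (1 + ε) * (N - 2 * f) := by
  rw [div_mul_eq_mul_div, div_le_iff₀ hε] at hR
  linarith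

theorem cadambeBound_le (hN : 2 * f < N) (hν : 2 ≤ ν) :
    cadambeBound N f ν ≤ (N : ℝ) / (⌈((N : ℝ) - 2 * f) / ν⌉ : ℝ) := by
  have h : (2 * f : ℝ) < N := by exact_mod_cast hN
  have hν0 : (0 : ℝ) < ν := by positivity
  have hν2 : (2 : ℝ) ≤ ν := by exact_mod_cast hν
  set K := ⌈((N : ℝ) - 2 * f) / ν⌉ with hK
  have hK0 : 0 < K := Int.ceil_pos.2 (div_pos (by linarith) hν0)
  have hceil : ν * K ≤ (N : ℤ) - 2 * f + ν - 1 := by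
    have h1 : (K : ℝ) < (N - 2 * f) / ν + 1 := Int.ceil_lt_add_one _
    have h2 : (ν * K : ℝ) < N - 2 * f + ν := by
      rw [show (N - 2 * f + ν : ℝ) = ν * ((N - 2 * f) / ν + 1) by field_simp]
      exact mul_lt_mul_of_pos_left h1 hν0
    have h3 : (ν * K : ℤ) < N - 2 * f + ν := by exact_mod_cast h2
    omega
  have hceil' : (ν * K : ℝ) ≤ N - 2 * f + ν - 1 := by exact_mod_cast hceil
  rw [cadambeBound, div_le_div_iff₀ (by linarith) (by exact_mod_cast hK0)]
  have hf : (0 : ℝ) ≤ f := by positivity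
  nlinarith [mul_le_mul_of_nonneg_left hceil' (Nat.cast_nonneg (α := ℝ) N)]

theorem div_ceil_le_cadambeBound (hN : 2 * f < N) (hν : 2 ≤ ν) (hνf : ν ≤ f + 1) {ε : ℝ}
    (hε : 0 < ε) (hR : 2 * (1 + ε) / ε * f ≤ N) :
    (N : ℝ) / (⌈((N : ℝ) - 2 * f) / ν⌉ : ℝ) ≤ (1 + ε) * cadambeBound N f ν := by
  have h : (2 * f : ℝ) < N := by exact_mod_cast hN
  have hν2 : (2 : ℝ) ≤ ν := by exact_mod_cast hν
  have hνf' : (ν : ℝ) ≤ f + 1 := by exact_mod_cast hνf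
  have hf : (0 : ℝ) ≤ f := by positivity
  refine (div_ceil_le hN hν).trans ?_
  rw [cadambeBound, ← mul_div_assoc, div_le_div_iff₀ (by linarith) (by linarith)]
  have h1 := le_mul_sub hε hR
  have h2 : (N : ℝ) - f + ν - 1 ≤ (1 + ε) * (N - 2 * f) := by linarith
  have := mul_le_mul_of_nonneg_left h2 (by positivity : (0 : ℝ) ≤ ν * N)
  linarith

end

end SharedMemory

theorem mainTheorem11 :
    -- the storage cost at every point of every execution
    (∀ (N f ν : ℕ), 2 * f < N → 2 ≤ ν →
      ∀ (V W : Type) [Fintype V] [Nontrivial V] [Fintype W]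
        (C : SharedMemory.MDSCode N (SharedMemory.codingParameter N f ν) V W) (v₀ : V)
        (e : (SharedMemory.TwoA.protocol N f ν C v₀).Execution), e.BoundedConcurrency ν →
        ∀ n, (e.state n).storageCost = (N : ℝ) / (⌈((N : ℝ) - 2 * f) / ν⌉ : ℝ)) ∧
    -- for `N ≫ f` and `ν ≤ f + 1` it asymptotically equals `ν N / (N - f + ν - 1)`
    (∀ ε : ℝ, 0 < ε → ∃ R : ℝ, ∀ (N f ν : ℕ), 2 * f < N → 2 ≤ ν → ν ≤ f + 1 → R * f ≤ N →
      SharedMemory.cadambeBound N f ν ≤ (N : ℝ) / (⌈((N : ℝ) - 2 * f) / ν⌉ : ℝ) ∧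
      (N : ℝ) / (⌈((N : ℝ) - 2 * f) / ν⌉ : ℝ) ≤ (1 + ε) * SharedMemory.cadambeBound N f ν) ∧
    -- it is asymptotically optimal for `N ≫ f` and `ν ≤ f + 1`
    (∀ ε : ℝ, 0 < ε → ∃ R : ℝ, ∀ (N f ν : ℕ), 2 * f < N → 2 ≤ ν → ν ≤ f + 1 → R * f ≤ N →
      ∃ B : ℕ, ∀ (V : Type) [Fintype V] (P : SharedMemory.Protocol N V), B ≤ Fintype.card V →
        P.EmulatesAtomic f ν → P.ConcurrencyWaitFree f ν →
        ∃ e : P.Execution, e.BoundedConcurrency ν ∧ e.BoundedFailures f ∧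
          ∃ n, (1 - ε) * ((N : ℝ) / (⌈((N : ℝ) - 2 * f) / ν⌉ : ℝ)) ≤
            (e.state n).storageCost) := by
  refine ⟨fun N f ν hN hν V W _ _ _ C v₀ e _ n => ?_, fun ε hε => ?_, fun ε hε => ?_⟩
  · rw [SharedMemory.TwoA.storageCost_eq, SharedMemory.natCast_codingParameter hN]
  · exact ⟨2 * (1 + ε) / ε, fun N f ν hN hν hνf hR => ⟨SharedMemory.cadambeBound_le hN hν,
      SharedMemory.div_ceil_le_cadambeBound hN hν hνf hε hR⟩⟩
  · -- `η = min ε 1`; the two losses, `1 + η` here and `1 - η ^ 2` in the counting, give `1 - η`.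
    obtain ⟨η, hη0, hη1, hηε⟩ : ∃ η : ℝ, 0 < η ∧ η ≤ 1 ∧ η ≤ ε :=
      ⟨min ε 1, lt_min hε one_pos, min_le_right _ _, min_le_left _ _⟩
    refine ⟨2 * (1 + η) / η, fun N f ν hN hν hνf hR => ?_⟩
    obtain ⟨B, hB⟩ := SharedMemory.Protocol.exists_storageCost_ge (N := N) (by omega) hν hνf
      (show 0 < η ^ 2 by positivity)
    refine ⟨B, fun V _ P hV hP hW => ?_⟩
    obtain ⟨e, he₁, he₂, n, hn⟩ := hB V P hV hP hW
    refine ⟨e, he₁, he₂, n, le_trans ?_ hn⟩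
    have h : (0 : ℝ) < N - 2 * f := by
      have : (2 * f : ℝ) < N := by exact_mod_cast hN
      linarith
    have h1 : (N : ℝ) / (⌈((N : ℝ) - 2 * f) / ν⌉ : ℝ) ≤ (1 + η) * ν := by
      refine (SharedMemory.div_ceil_le hN hν).trans ?_
      rw [div_le_iff₀ h]
      have := mul_le_mul_of_nonneg_left (SharedMemory.le_mul_sub hη0 hR)
        (Nat.cast_nonneg (α := ℝ) ν)
      linarith
    have h2 : (0 : ℝ) ≤ (N : ℝ) / (⌈((N : ℝ) - 2 * f) / ν⌉ : ℝ) :=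
      div_nonneg (by positivity)
        (Int.cast_nonneg (Int.ceil_nonneg (div_nonneg h.le (by positivity))))
    calc (1 - ε) * ((N : ℝ) / (⌈((N : ℝ) - 2 * f) / ν⌉ : ℝ))
        ≤ (1 - η) * ((N : ℝ) / (⌈((N : ℝ) - 2 * f) / ν⌉ : ℝ)) := by gcongr
      _ ≤ (1 - η) * ((1 + η) * ν) := mul_le_mul_of_nonneg_left h1 (by linarith)
      _ = (1 - η ^ 2) * ν := by ring
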